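/- **Setting.** Let $\mathfrak g$ be a finite-dimensional complex simple Lie algebra with Cartan subalgebra $\mathfrak h$ and simple roots $\alpha_1,\dots,\alpha_r$; let $(\cdot,\cdot)$ be the form on $\mathfrak h^*$ induced by the Killing form, normalized so that short roots have $(\alpha,\alpha)=2$; put $d_i=(\alpha_i,\alpha_i)/2$, $(\alpha_i,\alpha_j)=d_ia_{ij}$, and let $2\rho$ be the sum of the positive roots. Let $q>0$ be real, $q\neq1$, $q_i=q^{d_i}$, and $[x]_p=\frac{p^x-p^{-x}}{p-p^{-1}}$. Let $U_q(\mathfrak g)$ be the algebra generated by $E_i,F_i,K_i^{\pm1}$ with $K_iK_j=K_jK_i$, $K_iE_jK_i^{-1}=q_i^{a_{ij}}E_j$, $K_iF_jK_i^{-1}=q_i^{-a_{ij}}F_j$, $E_iF_j-F_jE_i=\delta_{ij}\frac{K_i-K_i^{-1}}{q_i-q_i^{-1}}$ and the quantum Serre relations, with the Hopf $*$-structure $\Delta(K_i)=K_i\otimes K_i$, $\Delta(E_i)=E_i\otimes K_i+1\otimes E_i$, $\Delta(F_i)=F_i\otimes1+K_i^{-1}\otimes F_i$, $S(K_i)=K_i^{-1}$,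 $S(E_i)=-E_iK_i^{-1}$, $S(F_i)=-K_iF_i$, $\varepsilon(K_i)=1$, $\varepsilon(E_i)=\varepsilon(F_i)=0$, $K_i^*=K_i$, $E_i^*=K_iF_i$, $F_i^*=E_iK_i^{-1}$. For $\lambda=\sum n_i\alpha_i$ write $K_\lambda=\prod K_i^{n_i}$. Let $\mathbb C_q[G]\subset U_q(\mathfrak g)^*$ be the span of the matrix coefficients of finite-dimensional (type 1) representations, with product $(\phi\psi)(X)=(\phi\otimes\psi)(\Delta X)$, counit $\varepsilon(\phi)=\phi(1)$, involution $\phi^*(X)=\overline{\phi(S(X)^*)}$ and actions $(X\triangleright\phi)(Y)=\phi(YX)$, $(\phi\triangleleft X)(Y)=\phi(XY)$. Put $\mathbb C_q[T\backslash G]=\{a\in\mathbb C_q[G]: a\triangleleft K_\lambda=a\ \forall\lambda\}$, $\mathbb C_q[G/T]=\{a\in\mathbb C_q[G]: K_\lambda\triangleright a=a\ \forall\lambda\}$, and let $\theta(a)=K_{2\rho}\triangleright a\triangleleft K_{2\rho}$, an automorphism of each of these algebras. For an algebra $A$ with automorphism $\sigma$, $HH_\bullet^\sigma(A)=H_\bullet(A,{}_\sigma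 A)$ is Hochschild homology with coefficients in the bimodule $A$ with actions $a\cdot b\cdot c=\sigma(a)bc$; it is identified with the homology of the normalized complex $A\otimes(A/\mathbb C)^{\otimes n}$, so that a chain which is a cycle in the normalized complex has a class in $HH^\sigma_\bullet(A)$. Let $V(\Lambda)$ be a finite-dimensional irreducible (type 1) representation of $U_q(\mathfrak g)$ with an orthonormal basis of weight vectors $v_i$, of weights $\lambda_i$; let $\pi(X)^i_j$ be the matrix of $X$ and $u^i_j(X)=\pi(X)^i_j$. Define matrices $\mathsf M^n_m,\mathsf N^n_m$ over $\mathbb C_q[G]$ by $(\mathsf M^n_m)^i_j=u^{m*}_iu^n_j$ and $(\mathsf N^n_m)^i_j=u^i_mu^{j*}_n$, and for complex numbers $c^m_n$ put $\mathsf P=\sum_{m,n}c^m_n\mathsf M^n_m$, $\mathsf Q=\sum_{m,n}c^m_n\mathsf N^n_m$, $$C(\mathsf P)=\mathrm{Tr}\big(\pi(K_{2\rho}^{-1})(2\mathsf P-\mathrm{Id})\otimes\mathsf P\otimes\mathsf P\big),\qquad C(\mathsf Q)=\mathrm{Tr}\big(\pi(K_{2\rho})(2\mathsf Q-\mathrm{Id})\otimes\mathsf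 Q\otimes\mathsf Q\big),$$ $$\chi_a(\mathsf P)=\sum_ic^i_i\,q^{(\alpha_a-2\rho,\lambda_i)}\,[d_a^{-1}(\alpha_a,\lambda_i)]_{q_a},\qquad\tilde\chi_a(\mathsf Q)=\sum_ic^i_i\,q^{-(\alpha_a-2\rho,\lambda_i)}\,[d_a^{-1}(\alpha_a,\lambda_i)]_{q_a},$$ and $\eta_a(a_0\otimes a_1\otimes a_2)=\varepsilon(a_0)\,\varepsilon(F_a\triangleright a_1)\,\varepsilon(E_a\triangleright a_2)$. **Theorem.** Suppose $c^m_n=0$ whenever $\lambda_m\neq\lambda_n$. 1) Suppose $\mathsf P^2=\mathsf P$. Then $\mathsf P$ has entries in $\mathbb C_q[T\backslash G]$, $C(\mathsf P)$ is a cycle of the normalized complex and defines a class $[C(\mathsf P)]\in HH_2^\theta(\mathbb C_q[T\backslash G])$, every $\eta_a$ is a $\theta$-twisted Hochschild $2$-cocycle on $\mathbb C_q[T\backslash G]$, and its pairing with $[C(\mathsf P)]$ is $\chi_a(\mathsf P)$. In particular, if $\chi_a(\mathsf P)\neq0$ for some $a$, then $[C(\mathsf P)]\neq0$. 2) Suppose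 $\mathsf Q^2=\mathsf Q$. Then $\mathsf Q$ has entries in $\mathbb C_q[G/T]$, $C(\mathsf Q)$ is a cycle of the normalized complex and defines a class $[C(\mathsf Q)]\in HH_2^\theta(\mathbb C_q[G/T])$, every $\eta_a$ is a $\theta$-twisted Hochschild $2$-cocycle on $\mathbb C_q[G/T]$, and its pairing with $[C(\mathsf Q)]$ is $\tilde\chi_a(\mathsf Q)$. In particular, if $\tilde\chi_a(\mathsf Q)\neq0$ for some $a$, then $[C(\mathsf Q)]\neq0$. -/

import Mathlib

noncomputable section
namespace QFlag

/-- The quantum integer `[n]_p = (pⁿ - p⁻ⁿ) / (p - p⁻¹)`. -/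
def qInt (p : ℂ) (n : ℕ) : ℂ := (p ^ n - p⁻¹ ^ n) / (p - p⁻¹)

/-- The quantum factorial `[n]_p! = [1]_p ⋯ [n]_p`. -/
def qFactorial (p : ℂ) (n : ℕ) : ℂ := ∏ k ∈ Finset.range n, qInt p (k + 1)

/-- The quantum binomial coefficient `[n choose k]_p` (used for `k ≤ n`). -/
def qBinom (p : ℂ) (n k : ℕ) : ℂ := qFactorial p n / (qFactorial p k * qFactorial p (n - k))

section Serre
variable {B : Type*} [Ring B] [Algebra ℂ B]

/-- The quantum Serre expression
`∑_{k=0}^r (-1)^k [r choose k]_p x^{r-k} y x^k`. -/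
def qSerre (p : ℂ) (r : ℕ) (x y : B) : B :=
  ∑ k ∈ Finset.range (r + 1), ((-1) ^ k * qBinom p r k) • (x ^ (r - k) * y * x ^ k)

lemma qInt_inv (p : ℂ) (n : ℕ) : qInt p⁻¹ n = qInt p n := by
  unfold qInt
  rw [inv_inv, ← neg_sub (p ^ n), ← neg_sub p, neg_div_neg_eq]

lemma qBinom_inv (p : ℂ) (n k : ℕ) : qBinom p⁻¹ n k = qBinom p n k := by
  simp only [qBinom, qFactorial, qInt_inv]

lemma conj_qBinom (p : ℂ) (n k : ℕ) :
    (starRingEnd ℂ) (qBinom p n k) = qBinom ((starRingEnd ℂ) p) n k := by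
  simp only [qBinom, qFactorial, qInt, map_div₀, map_mul, map_prod, map_sub, map_pow, map_inv₀]

lemma qBinom_symm (p : ℂ) {n k : ℕ} (h : k ≤ n) : qBinom p n (n - k) = qBinom p n k := by
  rw [qBinom, qBinom, Nat.sub_sub_self h, mul_comm]

/-- `p` is generic: nonzero and not a root of unity. -/
def Generic (p : ℂ) : Prop := p ≠ 0 ∧ ∀ n : ℕ, 0 < n → p ^ n ≠ 1

lemma Generic.inv {p : ℂ} (h : Generic p) : Generic p⁻¹ :=
  ⟨inv_ne_zero h.1, fun n hn => by
    rw [inv_pow]; exact fun h' => h.2 n hn (by simpa using h')⟩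

lemma Generic.qInt_ne {p : ℂ} (h : Generic p) (n : ℕ) : qInt p (n + 1) ≠ 0 := by
  have key : ∀ m : ℕ, p ^ (m + 1) - p⁻¹ ^ (m + 1) ≠ 0 := by
    intro m hm
    have h1 : p ^ (m + 1) ≠ 0 := pow_ne_zero _ h.1
    rw [sub_eq_zero, inv_pow] at hm
    apply h.2 (2 * (m + 1)) (by omega)
    rw [two_mul, pow_add]
    nth_rewrite 1 [hm]
    exact inv_mul_cancel₀ h1
  unfold qInt
  refine div_ne_zero (key n) ?_
  simpa using key 0

lemma Generic.qFactorial_ne {p : ℂ} (h : Generic p) (n : ℕ) : qFactorial p n ≠ 0 :=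
  Finset.prod_ne_zero_iff.mpr fun k _ => h.qInt_ne k

lemma Generic.qBinom_zero {p : ℂ} (h : Generic p) (n : ℕ) : qBinom p n 0 = 1 := by
  have : qFactorial p 0 = 1 := Finset.prod_range_zero _
  rw [qBinom, this, one_mul, Nat.sub_zero, div_self (h.qFactorial_ne n)]

lemma Generic.qBinom_self {p : ℂ} (h : Generic p) (n : ℕ) : qBinom p n n = 1 := by
  have := qBinom_symm p (Nat.zero_le n)
  rw [Nat.sub_zero] at this
  rw [this, h.qBinom_zero]

lemma qInt_add (p : ℂ) (hp : p ≠ 0) (a b : ℕ) :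
    qInt p (a + b) = p⁻¹ ^ a * qInt p b + p ^ b * qInt p a := by
  have h1 : p ^ a ≠ 0 := pow_ne_zero _ hp
  have h2 : p ^ b ≠ 0 := pow_ne_zero _ hp
  simp only [qInt, pow_add]
  rw [mul_div_assoc', mul_div_assoc', ← add_div]
  congr 1
  ring

/-- Pascal's rule. -/
lemma Generic.qBinom_succ {p : ℂ} (h : Generic p) {n k : ℕ} (hk : k + 1 ≤ n) :
    qBinom p (n + 1) (k + 1) =
      p⁻¹ ^ (k + 1) * qBinom p n (k + 1) + p ^ (n - k) * qBinom p n k := by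
  obtain ⟨m, rfl⟩ : ∃ m, n = k + 1 + m := ⟨n - (k + 1), by omega⟩
  have f1 := h.qFactorial_ne k
  have f2 := h.qFactorial_ne m
  have i1 := h.qInt_ne k
  have i2 := h.qInt_ne m
  have e1 : qFactorial p (k + 1) = qFactorial p k * qInt p (k + 1) := Finset.prod_range_succ _ _
  have e2 : qFactorial p (m + 1) = qFactorial p m * qInt p (m + 1) := Finset.prod_range_succ _ _
  have e3 : qFactorial p (k + 1 + m + 1) = qFactorial p (k + 1 + m) * qInt p (k + 1 + (m + 1)) :=
    Finset.prod_range_succ _ _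
  have s1 : k + 1 + m + 1 - (k + 1) = m + 1 := by omega
  have s2 : k + 1 + m - (k + 1) = m := by omega
  have s3 : k + 1 + m - k = m + 1 := by omega
  simp only [qBinom, s1, s2, s3]
  rw [e3, e1, e2, qInt_add p h.1]
  field_simp

/-- Auxiliary weighted Serre expression; `qSerre` is the case `s = 1`. -/
def qSerreAux (p s : ℂ) (r : ℕ) (x y : B) : B :=
  ∑ k ∈ Finset.range (r + 1), ((-1) ^ k * qBinom p r k * s ^ k) • (x ^ (r - k) * y * x ^ k)

lemma qSerreAux_one (p : ℂ) (r : ℕ) (x y : B) : qSerreAux p 1 r x y = qSerre p r x y := by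
  simp [qSerreAux, qSerre]

lemma qSerreAux_inv (p s : ℂ) (r : ℕ) (x y : B) : qSerreAux p⁻¹ s r x y = qSerreAux p s r x y := by
  simp [qSerreAux, qBinom_inv]

lemma qSerreAux_zero {p : ℂ} (h : Generic p) (s : ℂ) (x y : B) : qSerreAux p s 0 x y = y := by
  simp [qSerreAux, h.qBinom_zero]

lemma qSerreAux_succ {p : ℂ} (h : Generic p) (s : ℂ) (r : ℕ) (x y : B) :
    qSerreAux p s (r + 1) x y =
      qSerreAux p (s * p⁻¹) r x (x * y - (s * p ^ r) • (y * x)) := by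
  set c : ℕ → ℂ := fun k => (-1) ^ k * qBinom p r k * (s * p⁻¹) ^ k with hc
  have hR : qSerreAux p (s * p⁻¹) r x (x * y - (s * p ^ r) • (y * x)) =
      ∑ k ∈ Finset.range (r + 1), c k • (x ^ (r + 1 - k) * y * x ^ k) -
      ∑ k ∈ Finset.range (r + 1), (c k * (s * p ^ r)) • (x ^ (r - k) * y * x ^ (k + 1)) := by
    rw [qSerreAux, ← Finset.sum_sub_distrib]
    refine Finset.sum_congr rfl fun k hk => ?_
    have : r + 1 - k = (r - k) + 1 := by have := Finset.mem_range.mp hk; omega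
    rw [this, pow_succ x (r - k), mul_sub, sub_mul, smul_sub, mul_smul_comm, smul_mul_assoc,
      smul_smul, pow_succ' x k]
    simp only [mul_assoc, hc]
  rw [hR, qSerreAux, Finset.sum_range_succ, Finset.sum_range_succ']
  rw [Finset.sum_range_succ' (n := r), Finset.sum_range_succ (n := r)
    (f := fun k => (c k * (s * p ^ r)) • (x ^ (r - k) * y * x ^ (k + 1)))]
  have h0 : c 0 = 1 := by simp [hc, h.qBinom_zero]
  have hr : c r * (s * p ^ r) = (-1) ^ r * s ^ (r + 1) := by
    have : p ^ r ≠ 0 := pow_ne_zero _ h.1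
    simp only [hc, h.qBinom_self, mul_pow, inv_pow]
    field_simp
    ring
  rw [h0, hr, h.qBinom_zero, h.qBinom_self]
  have hm : ∀ k ∈ Finset.range r,
      ((-1) ^ (k + 1) * qBinom p (r + 1) (k + 1) * s ^ (k + 1)) •
        (x ^ (r + 1 - (k + 1)) * y * x ^ (k + 1)) =
      c (k + 1) • (x ^ (r + 1 - (k + 1)) * y * x ^ (k + 1)) -
        (c k * (s * p ^ r)) • (x ^ (r - k) * y * x ^ (k + 1)) := by
    intro k hk
    have hk' := Finset.mem_range.mp hk
    rw [Nat.add_sub_add_right, ← sub_smul]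
    congr 1
    rw [h.qBinom_succ (by omega)]
    have e : p ^ r = p ^ (r - k) * p ^ k := by rw [← pow_add]; congr 1; omega
    have : p ^ k ≠ 0 := pow_ne_zero _ h.1
    simp only [hc, e, mul_pow, inv_pow, pow_succ]
    field_simp
    ring
  rw [Finset.sum_congr rfl hm, Finset.sum_sub_distrib]
  simp only [Nat.sub_self, pow_succ, pow_zero]
  simp
  module

lemma qSerreAux_add_left {p : ℂ} (h : Generic p) (r : ℕ) : ∀ (s : ℂ) (x y z : B),
    y * x = (p ^ 2)⁻¹ • (x * y) → y * z = (s * p ^ r * p⁻¹) • (z * y) →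
    qSerreAux p s r (x + y) z = qSerreAux p s r x z := by
  have hp := h.1
  induction r with
  | zero => intro s x y z _ _; simp only [qSerreAux_zero h]
  | succ r ih =>
    intro s x y z hyx hyz
    have hyz' : y * z = (s * p ^ r) • (z * y) := by
      rw [hyz]; congr 1; rw [pow_succ]; field_simp
    rw [qSerreAux_succ h, qSerreAux_succ h]
    have e : (x + y) * z - (s * p ^ r) • (z * (x + y)) = x * z - (s * p ^ r) • (z * x) := by
      rw [add_mul, mul_add, smul_add, hyz']; abel
    rw [e]
    refine ih _ _ _ _ hyx ?_
    have h1 : y * (x * z) = ((p ^ 2)⁻¹ * (s * p ^ r)) • (x * (z * y)) := by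
      rw [← mul_assoc, hyx, smul_mul_assoc, mul_assoc, hyz', mul_smul_comm, smul_smul]
    have h2 : y * (z * x) = ((s * p ^ r) * (p ^ 2)⁻¹) • (z * (x * y)) := by
      rw [← mul_assoc, hyz', smul_mul_assoc, mul_assoc, hyx, mul_smul_comm, smul_smul]
    rw [mul_sub, mul_smul_comm, h1, h2, sub_mul, smul_sub, smul_mul_assoc, smul_smul, smul_smul,
      mul_assoc x, mul_assoc z]
    congr 2
    · field_simp
    · field_simp

lemma qSerreAux_add_right (p s : ℂ) (r : ℕ) (x y z : B) :
    qSerreAux p s r x (y + z) = qSerreAux p s r x y + qSerreAux p s r x z := by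
  simp only [qSerreAux, mul_add, add_mul, smul_add, Finset.sum_add_distrib]

/-- Compatibility of the Serre expression with skew-primitive coproducts. -/
lemma qSerre_add {p : ℂ} (h : Generic p) (r : ℕ) (x y z w : B)
    (hyx : y * x = (p ^ 2)⁻¹ • (x * y)) (hyz : y * z = (p ^ r * p⁻¹) • (z * y))
    (hxw : x * w = (p⁻¹ ^ r * p) • (w * x)) :
    qSerre p r (x + y) (z + w) = qSerre p r x z + qSerre p r y w := by
  simp only [← qSerreAux_one]
  rw [qSerreAux_add_right, qSerreAux_add_left h r 1 x y z hyx (by simpa using hyz)]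
  congr 1
  rw [← qSerreAux_inv, ← qSerreAux_inv p, add_comm]
  have hp2 : p ^ 2 ≠ 0 := pow_ne_zero _ h.1
  refine qSerreAux_add_left h.inv r 1 y x w ?_ (by simpa using hxw)
  rw [hyx, smul_smul]
  simp [hp2]

lemma qSerreAux_mul {p : ℂ} (h : Generic p) (r : ℕ) : ∀ (s α β : ℂ) (e g m k : B),
    g * e = α • (e * g) → g * m = β • (m * g) → k * e = β • (e * k) → g * k = k * g →
    ∃ c : ℂ, qSerreAux p s r (e * g) (m * k) = c • (qSerreAux p s r e m * (g ^ r * k)) := by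
  induction r with
  | zero => intro s α β e g m k _ _ _ _; exact ⟨1, by simp [qSerreAux_zero h]⟩
  | succ r ih =>
    intro s α β e g m k hge hgm hke hgk
    have key : e * g * (m * k) - (s * p ^ r) • (m * k * (e * g)) =
        (e * m - (s * p ^ r) • (m * e)) * (β • (g * k)) := by
      have a1 : e * g * (m * k) = β • (e * m * (g * k)) := by
        rw [mul_assoc, ← mul_assoc g, hgm, smul_mul_assoc, mul_smul_comm]; simp only [mul_assoc]
      have a2 : m * k * (e * g) = β • (m * e * (g * k)) := by
        rw [mul_assoc, ← mul_assoc k, hke, smul_mul_assoc, mul_smul_comm, mul_assoc e k g, ← hgk]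
        simp only [mul_assoc]
      rw [a1, a2, mul_smul_comm, sub_mul, smul_mul_assoc, smul_sub, smul_comm]
    obtain ⟨c, hc⟩ := ih (s * p⁻¹) α (α * β) e g (e * m - (s * p ^ r) • (m * e)) (β • (g * k)) hge
      (by
        have b1 : g * (e * m) = (α * β) • (e * m * g) := by
          rw [← mul_assoc, hge, smul_mul_assoc, mul_assoc, hgm, mul_smul_comm, smul_smul, mul_assoc]
        have b2 : g * (m * e) = (α * β) • (m * e * g) := by
          rw [← mul_assoc, hgm, smul_mul_assoc, mul_assoc, hge, mul_smul_comm, smul_smul, mul_assoc,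
            mul_comm α]
        rw [mul_sub, mul_smul_comm, b1, b2, sub_mul, smul_mul_assoc, smul_sub, smul_comm])
      (by
        rw [smul_mul_assoc, mul_smul_comm, mul_assoc, hke, mul_smul_comm, ← mul_assoc, hge,
          smul_mul_assoc, mul_assoc, smul_smul, smul_smul, smul_smul]
        congr 1; ring)
      (by rw [smul_mul_assoc, mul_smul_comm, mul_assoc, hgk])
    refine ⟨c * β, ?_⟩
    rw [qSerreAux_succ h, qSerreAux_succ h, key, hc, mul_smul_comm, mul_smul_comm, smul_smul,
      pow_succ, mul_assoc (g ^ r)]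

lemma qSerre_mul_eq_zero {p : ℂ} (h : Generic p) (r : ℕ) (α β : ℂ) (e g m k : B)
    (hge : g * e = α • (e * g)) (hgm : g * m = β • (m * g)) (hke : k * e = β • (e * k))
    (hgk : g * k = k * g) (h0 : qSerre p r e m = 0) : qSerre p r (e * g) (m * k) = 0 := by
  obtain ⟨c, hc⟩ := qSerreAux_mul h r 1 α β e g m k hge hgm hke hgk
  rw [← qSerreAux_one, hc, qSerreAux_one, h0, zero_mul, smul_zero]

lemma qSerre_smul (p : ℂ) (r : ℕ) (c d : ℂ) (x y : B) :
    qSerre p r (c • x) (d • y) = (c ^ r * d) • qSerre p r x y := by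
  rw [qSerre, qSerre, Finset.smul_sum]
  refine Finset.sum_congr rfl fun k hk => ?_
  have : c ^ r = c ^ (r - k) * c ^ k := by
    rw [← pow_add]; congr 1; have := Finset.mem_range.mp hk; omega
  rw [smul_pow, smul_pow, smul_mul_smul_comm, smul_mul_smul_comm, smul_smul, smul_smul, this]
  congr 1; ring

lemma qSerre_neg (p : ℂ) (r : ℕ) (x y : B) (h : qSerre p r x y = 0) :
    qSerre p r (-x) (-y) = 0 := by
  have := qSerre_smul p r (-1) (-1) x y
  rw [neg_one_smul, neg_one_smul] at this
  rw [this, h, smul_zero]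

lemma qSerre_zero_right (p : ℂ) (r : ℕ) (x : B) : qSerre p r x 0 = 0 := by simp [qSerre]

lemma sum_reverse_qSerre (p : ℂ) (r : ℕ) (x y : B) :
    ∑ k ∈ Finset.range (r + 1), ((-1) ^ k * qBinom p r k) • (x ^ k * y * x ^ (r - k)) =
      (-1 : ℂ) ^ r • qSerre p r x y := by
  rw [← Finset.sum_range_reflect, qSerre, Finset.smul_sum]
  refine Finset.sum_congr rfl fun k hk => ?_
  have hk' := Finset.mem_range.mp hk
  have e : r + 1 - 1 - k = r - k := by omega
  rw [e, Nat.sub_sub_self (by omega), qBinom_symm p (by omega), smul_smul]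
  congr 1
  have h1 : (-1 : ℂ) ^ r = (-1) ^ (r - k) * (-1) ^ k := by rw [← pow_add]; congr 1; omega
  have h2 : (-1 : ℂ) ^ k * (-1) ^ k = 1 := by rw [← mul_pow]; simp
  linear_combination (-(-1 : ℂ) ^ (r - k) * qBinom p r k) * h2 - (-1 : ℂ) ^ k * qBinom p r k * h1

lemma op_qSerre (p : ℂ) (r : ℕ) (x y : B) :
    qSerre p r (MulOpposite.op x) (MulOpposite.op y) =
      MulOpposite.op ((-1 : ℂ) ^ r • qSerre p r x y) := by
  rw [← sum_reverse_qSerre, qSerre, Finset.op_sum]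
  refine Finset.sum_congr rfl fun k _ => ?_
  simp [mul_assoc]

lemma map_qSerre {C : Type*} [Ring C] [Algebra ℂ C] (f : B →ₐ[ℂ] C) (p : ℂ) (r : ℕ) (x y : B) :
    f (qSerre p r x y) = qSerre p r (f x) (f y) := by
  simp [qSerre]

open TensorProduct in
lemma qSerre_tmul {C : Type*} [Ring C] [Algebra ℂ C] (p : ℂ) (r : ℕ) (x y : B) (g k : C)
    (hgk : g * k = k * g) (h : qSerre p r x y = 0) :
    qSerre p r (x ⊗ₜ[ℂ] g) (y ⊗ₜ[ℂ] k) = 0 := by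
  have : qSerre p r (x ⊗ₜ[ℂ] g) (y ⊗ₜ[ℂ] k) = qSerre p r x y ⊗ₜ[ℂ] (g ^ r * k) := by
    rw [qSerre, qSerre, TensorProduct.sum_tmul]
    refine Finset.sum_congr rfl fun n hn => ?_
    have hn' := Finset.mem_range.mp hn
    rw [Algebra.TensorProduct.tmul_pow, Algebra.TensorProduct.tmul_pow,
      Algebra.TensorProduct.tmul_mul_tmul, Algebra.TensorProduct.tmul_mul_tmul,
      TensorProduct.smul_tmul', mul_assoc (g ^ (r - n)), ← ((show Commute g k from hgk).pow_left n).eq,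
      ← mul_assoc (g ^ (r - n)), ← pow_add]
    congr 3; omega
  rw [this, h, TensorProduct.zero_tmul]

open TensorProduct in
lemma qSerre_one_tmul {C : Type*} [Ring C] [Algebra ℂ C] (p : ℂ) (r : ℕ) (x y : C)
    (h : qSerre p r x y = 0) :
    qSerre p r ((1 : B) ⊗ₜ[ℂ] x) (1 ⊗ₜ[ℂ] y) = 0 := by
  have := map_qSerre (Algebra.TensorProduct.includeRight : C →ₐ[ℂ] B ⊗[ℂ] C) p r x y
  rw [h, map_zero] at this
  exact this.symm

end Serre
end QFlag

namespace QFlag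

open scoped TensorProduct
open MulOpposite (op unop)

/-- The numerical data entering the definition of `U_q(𝔤)`: a real number `q > 0`, `q ≠ 1`, the
Cartan matrix `a_{ij}` with its symmetrizer `d_i = (α_i, α_i) / 2`, and the coordinates of `2ρ` in
the basis of simple roots. It is only used for the datum `QuantumDatum.ofLie` of a Lie algebra. -/
structure QuantumDatum (ι : Type*) [Fintype ι] where
  q : ℝ
  q_pos : 0 < q
  q_ne_one : q ≠ 1
  cartan : ι → ι → ℤ
  d : ι → ℝ
  d_pos : ∀ i, 0 < d i
  cartan_diag : ∀ i, cartan i i = 2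
  cartan_offdiag : ∀ i j, i ≠ j → cartan i j ≤ 0
  cartan_symm : ∀ i j, d i * cartan i j = d j * cartan j i
  twoRho : ι → ℤ
  twoRho_spec : ∀ i, ∑ j, cartan i j * twoRho j = 2

variable {ι : Type*} [Fintype ι]

namespace QuantumDatum

variable (D : QuantumDatum ι)

/-- `q_i = q^{d_i}`. -/
def qi (i : ι) : ℂ := ((D.q ^ D.d i : ℝ) : ℂ)

lemma qi_generic (i : ι) : Generic (D.qi i) := by
  have h0 : (0 : ℝ) < D.q ^ D.d i := Real.rpow_pos_of_pos D.q_pos _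
  refine ⟨by simpa [qi] using h0.ne', fun n hn h => ?_⟩
  have h1 : (D.q ^ D.d i) ^ n = (1 : ℝ) := by unfold qi at h; exact_mod_cast h
  have h2 : D.q ^ D.d i = 1 := (pow_eq_one_iff_of_nonneg h0.le hn.ne').mp h1
  rcases lt_or_gt_of_ne D.q_ne_one with h3 | h3
  · exact absurd h2 (Real.rpow_lt_one D.q_pos.le h3 (D.d_pos i)).ne
  · exact absurd h2 (Real.one_lt_rpow h3 (D.d_pos i)).ne'

lemma qi_ne (i : ι) : D.qi i ≠ 0 := (D.qi_generic i).1

lemma qi_zpow_symm (i j : ι) : D.qi i ^ D.cartan i j = D.qi j ^ D.cartan j i := by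
  unfold qi
  rw [← Complex.ofReal_zpow, ← Complex.ofReal_zpow, ← Real.rpow_intCast, ← Real.rpow_intCast,
    ← Real.rpow_mul D.q_pos.le, ← Real.rpow_mul D.q_pos.le, D.cartan_symm]

lemma conj_qi (i : ι) : (starRingEnd ℂ) (D.qi i) = D.qi i := Complex.conj_ofReal _

/-- The exponent `1 - a_{ij}` in the quantum Serre relations. -/
def serreDeg (i j : ι) : ℕ := (1 - D.cartan i j).toNat

lemma qi_pow_serreDeg {i j : ι} (h : i ≠ j) :
    D.qi i ^ D.serreDeg i j * (D.qi i)⁻¹ = (D.qi i ^ D.cartan i j)⁻¹ := by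
  have h0 := D.qi_ne i
  have h1 : ((D.serreDeg i j : ℕ) : ℤ) = 1 - D.cartan i j :=
    Int.toNat_of_nonneg (by have := D.cartan_offdiag i j h; omega)
  rw [← zpow_natCast, h1, zpow_sub₀ h0, zpow_one]
  field_simp

lemma qi_inv_pow_serreDeg {i j : ι} (h : i ≠ j) :
    (D.qi i)⁻¹ ^ D.serreDeg i j * D.qi i = D.qi i ^ D.cartan i j := by
  rw [← inv_inj, ← D.qi_pow_serreDeg h, mul_inv, inv_pow, inv_inv]

end QuantumDatum

/-- Symbols for the generators `E_i`, `F_i`, `K_i`, `K_i⁻¹`. -/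
inductive Gen (ι : Type*)
  | E (i : ι)
  | F (i : ι)
  | K (i : ι)
  | Kinv (i : ι)

/-- The defining relations of `U_q(𝔤)`, for elements of an arbitrary algebra. -/
structure QRel (D : QuantumDatum ι) {B : Type*} [Ring B] [Algebra ℂ B]
    (E F K L : ι → B) : Prop where
  KL : ∀ i, K i * L i = 1
  LK : ∀ i, L i * K i = 1
  KK : ∀ i j, K i * K j = K j * K i
  KE : ∀ i j, K i * E j * L i = D.qi i ^ D.cartan i j • E j
  KF : ∀ i j, K i * F j * L i = D.qi i ^ (-D.cartan i j) • F j
  EF_same : ∀ i, E i * F i - F i * E i = (D.qi i - (D.qi i)⁻¹)⁻¹ • (K i - L i)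
  EF_ne : ∀ i j, i ≠ j → E i * F j - F j * E i = 0
  serreE : ∀ i j, i ≠ j → qSerre (D.qi i) (D.serreDeg i j) (E i) (E j) = 0
  serreF : ∀ i j, i ≠ j → qSerre (D.qi i) (D.serreDeg i j) (F i) (F j) = 0

namespace Uq

variable (D : QuantumDatum ι)

/-- Generators of the free algebra. -/
def g (x : Gen ι) : FreeAlgebra ℂ (Gen ι) := FreeAlgebra.ι ℂ x

open Gen in
/-- The defining relations of `U_q(𝔤)` in the free algebra. -/
inductive Rel : FreeAlgebra ℂ (Gen ι) → FreeAlgebra ℂ (Gen ι) → Prop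
  | KL (i : ι) : Rel (g (K i) * g (Kinv i)) 1
  | LK (i : ι) : Rel (g (Kinv i) * g (K i)) 1
  | KK (i j : ι) : Rel (g (K i) * g (K j)) (g (K j) * g (K i))
  | KE (i j : ι) : Rel (g (K i) * g (E j) * g (Kinv i)) (D.qi i ^ D.cartan i j • g (E j))
  | KF (i j : ι) : Rel (g (K i) * g (F j) * g (Kinv i)) (D.qi i ^ (-D.cartan i j) • g (F j))
  | EF_same (i : ι) : Rel (g (E i) * g (F i) - g (F i) * g (E i))
      ((D.qi i - (D.qi i)⁻¹)⁻¹ • (g (K i) - g (Kinv i)))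
  | EF_ne (i j : ι) (h : i ≠ j) : Rel (g (E i) * g (F j) - g (F j) * g (E i)) 0
  | serreE (i j : ι) (h : i ≠ j) :
      Rel (qSerre (D.qi i) (D.serreDeg i j) (g (E i)) (g (E j))) 0
  | serreF (i j : ι) (h : i ≠ j) :
      Rel (qSerre (D.qi i) (D.serreDeg i j) (g (F i)) (g (F j))) 0

end Uq

/-- The quantized enveloping algebra `U_q(𝔤)`. -/
def Uq (D : QuantumDatum ι) : Type _ := RingQuot (Uq.Rel D)

namespace Uq

section Basic
variable (D : QuantumDatum ι)

instance : Ring (Uq D) := inferInstanceAs (Ring (RingQuot (Uq.Rel D)))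
instance : Algebra ℂ (Uq D) := inferInstanceAs (Algebra ℂ (RingQuot (Uq.Rel D)))

/-- The quotient map from the free algebra. -/
def mk : FreeAlgebra ℂ (Gen ι) →ₐ[ℂ] Uq D := RingQuot.mkAlgHom ℂ (Uq.Rel D)

def E (i : ι) : Uq D := mk D (g (Gen.E i))
def F (i : ι) : Uq D := mk D (g (Gen.F i))
def K (i : ι) : Uq D := mk D (g (Gen.K i))
/-- The generator `K_i⁻¹`. -/
def Kinv (i : ι) : Uq D := mk D (g (Gen.Kinv i))

lemma mk_rel {x y : FreeAlgebra ℂ (Gen ι)} (h : Rel D x y) : mk D x = mk D y :=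
  RingQuot.mkAlgHom_rel ℂ h

lemma qrel : QRel D (E D) (F D) (K D) (Kinv D) where
  KL i := by simpa only [E, F, K, Kinv, map_mul, map_one, map_smul] using mk_rel D (.KL i)
  LK i := by simpa only [E, F, K, Kinv, map_mul, map_one, map_smul] using mk_rel D (.LK i)
  KK i j := by simpa only [E, F, K, Kinv, map_mul, map_one, map_smul] using mk_rel D (.KK i j)
  KE i j := by simpa only [E, F, K, Kinv, map_mul, map_one, map_smul] using mk_rel D (.KE i j)
  KF i j := by simpa only [E, F, K, Kinv, map_mul, map_one, map_smul] using mk_rel D (.KF i j)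
  EF_same i := by simpa only [E, F, K, Kinv, map_mul, map_sub, map_smul] using mk_rel D (.EF_same i)
  EF_ne i j h := by simpa only [E, F, K, Kinv, map_mul, map_sub, map_zero] using mk_rel D (.EF_ne i j h)
  serreE i j h := by simpa only [E, F, K, Kinv, map_qSerre, map_zero] using mk_rel D (.serreE i j h)
  serreF i j h := by simpa only [E, F, K, Kinv, map_qSerre, map_zero] using mk_rel D (.serreF i j h)

end Basic

section Lift
variable {D : QuantumDatum ι} {B : Type*} [Ring B] [Algebra ℂ B]

/-- The value of a symbol under an assignment of the generators. -/
def genVal (e f k l : ι → B) : Gen ι → B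
  | .E i => e i
  | .F i => f i
  | .K i => k i
  | .Kinv i => l i

/-- The universal property of `U_q(𝔤)`. -/
def lift {e f k l : ι → B} (h : QRel D e f k l) : Uq D →ₐ[ℂ] B :=
  RingQuot.liftAlgHom ℂ ⟨FreeAlgebra.lift ℂ (genVal e f k l), by
    intro x y hxy
    cases hxy with
    | KL i => simpa [g, genVal] using h.KL i
    | LK i => simpa [g, genVal] using h.LK i
    | KK i j => simpa [g, genVal] using h.KK i j
    | KE i j => simpa [g, genVal] using h.KE i j
    | KF i j => simpa only [g, genVal, map_mul, map_smul, FreeAlgebra.lift_ι_apply] using h.KF i j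
    | EF_same i =>
      simpa only [g, genVal, map_mul, map_sub, map_smul, FreeAlgebra.lift_ι_apply] using h.EF_same i
    | EF_ne i j hij =>
      simpa only [g, genVal, map_mul, map_sub, map_zero, FreeAlgebra.lift_ι_apply]
        using h.EF_ne i j hij
    | serreE i j hij =>
      simpa only [g, genVal, map_qSerre, map_zero, FreeAlgebra.lift_ι_apply] using h.serreE i j hij
    | serreF i j hij =>
      simpa only [g, genVal, map_qSerre, map_zero, FreeAlgebra.lift_ι_apply] using h.serreF i j hij⟩

lemma lift_mk {e f k l : ι → B} (h : QRel D e f k l) (x : Gen ι) :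
    lift h (mk D (g x)) = genVal e f k l x := by
  unfold lift mk
  refine (RingQuot.liftAlgHom_mkAlgHom_apply ℂ _ _ _).trans ?_
  simp [g]

lemma lift_E {e f k l : ι → B} (h : QRel D e f k l) (i : ι) : lift h (E D i) = e i := lift_mk h _
lemma lift_F {e f k l : ι → B} (h : QRel D e f k l) (i : ι) : lift h (F D i) = f i := lift_mk h _
lemma lift_K {e f k l : ι → B} (h : QRel D e f k l) (i : ι) : lift h (K D i) = k i := lift_mk h _
lemma lift_Kinv {e f k l : ι → B} (h : QRel D e f k l) (i : ι) : lift h (Kinv D i) = l i :=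
  lift_mk h _

lemma algHom_ext {a b : Uq D →ₐ[ℂ] B} (hE : ∀ i, a (E D i) = b (E D i))
    (hF : ∀ i, a (F D i) = b (F D i)) (hK : ∀ i, a (K D i) = b (K D i))
    (hL : ∀ i, a (Kinv D i) = b (Kinv D i)) : a = b := by
  refine RingQuot.ringQuot_ext' ℂ a b ?_
  refine FreeAlgebra.hom_ext ?_
  funext x
  cases x with
  | E i => exact hE i
  | F i => exact hF i
  | K i => exact hK i
  | Kinv i => exact hL i

end Lift

end Uq

namespace QRel

variable {D : QuantumDatum ι} {B : Type*} [Ring B] [Algebra ℂ B] {E F K L : ι → B}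

lemma K_mul {c : ℂ} {i : ι} {x : B} (h : QRel D E F K L) (hx : K i * x * L i = c • x) :
    K i * x = c • (x * K i) := by
  have := congrArg (· * K i) hx
  simpa only [mul_assoc, h.LK, mul_one, smul_mul_assoc] using this

lemma L_mul {c : ℂ} {i : ι} {x : B} (h : QRel D E F K L) (hc : c ≠ 0)
    (hx : K i * x * L i = c • x) : L i * x = c⁻¹ • (x * L i) := by
  have := congrArg (L i * ·) hx
  simp only [mul_assoc, mul_smul_comm] at this
  rw [← mul_assoc, h.LK, one_mul] at this
  rw [this, smul_smul, inv_mul_cancel₀ hc, one_smul]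

lemma qne (D : QuantumDatum ι) (i : ι) (n : ℤ) : D.qi i ^ n ≠ 0 := zpow_ne_zero _ (D.qi_ne i)

lemma K_E (h : QRel D E F K L) (i j : ι) : K i * E j = D.qi i ^ D.cartan i j • (E j * K i) :=
  h.K_mul (h.KE i j)

lemma L_E (h : QRel D E F K L) (i j : ι) : L i * E j = (D.qi i ^ D.cartan i j)⁻¹ • (E j * L i) :=
  h.L_mul (qne D i _) (h.KE i j)

lemma K_F (h : QRel D E F K L) (i j : ι) : K i * F j = (D.qi i ^ D.cartan i j)⁻¹ • (F j * K i) := by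
  rw [← zpow_neg]; exact h.K_mul (h.KF i j)

lemma L_F (h : QRel D E F K L) (i j : ι) : L i * F j = D.qi i ^ D.cartan i j • (F j * L i) := by
  have := h.L_mul (qne D i _) (h.KF i j)
  rwa [← zpow_neg, neg_neg] at this

lemma KL_comm (h : QRel D E F K L) (i j : ι) : K i * L j = L j * K i := by
  have h1 : L j * (K j * K i) * L j = L j * (K i * K j) * L j := by rw [h.KK]
  rw [← mul_assoc, h.LK, one_mul, mul_assoc, mul_assoc, h.KL, mul_one] at h1
  exact h1

lemma LL_comm (h : QRel D E F K L) (i j : ι) : L i * L j = L j * L i := by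
  have h1 : L i * (K i * L j) * L i = L i * (L j * K i) * L i := by rw [h.KL_comm]
  rw [← mul_assoc, h.LK, one_mul, mul_assoc, mul_assoc, h.KL, mul_one] at h1
  exact h1.symm

/-- Both `K_j F_j E_i K_i⁻¹` and `E_i K_i⁻¹ K_j F_j` can be put in the form `K_j ⋯ K_i⁻¹`. -/
lemma swap (h : QRel D E F K L) (i j : ι) :
    E i * L i * (K j * F j) = K j * (E i * F j) * L i := by
  have h1 : L i * (K j * F j) = D.qi i ^ D.cartan i j • (K j * (F j * L i)) := by
    rw [← mul_assoc, ← h.KL_comm, mul_assoc, h.L_F, mul_smul_comm]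
  have h2 : E i * K j = (D.qi j ^ D.cartan j i)⁻¹ • (K j * E i) := by
    rw [h.K_E, smul_smul, inv_mul_cancel₀ (qne D j _), one_smul]
  rw [mul_assoc, h1, mul_smul_comm, ← mul_assoc, h2, smul_mul_assoc, smul_smul, D.qi_zpow_symm i j,
    mul_inv_cancel₀ (qne D j _), one_smul]
  simp only [mul_assoc]

lemma qi_self (D : QuantumDatum ι) (i : ι) : D.qi i ^ D.cartan i i = D.qi i ^ 2 := by
  rw [D.cartan_diag]; exact zpow_ofNat _ 2

lemma serreEL (h : QRel D E F K L) {i j : ι} (hij : i ≠ j) :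
    qSerre (D.qi i) (D.serreDeg i j) (E i * L i) (E j * L j) = 0 := by
  refine qSerre_mul_eq_zero (D.qi_generic i) _ _ _ _ _ _ _ (h.L_E i i) (h.L_E i j) ?_
    (h.LL_comm i j) (h.serreE i j hij)
  rw [h.L_E, D.qi_zpow_symm j i]

lemma serreKF (h : QRel D E F K L) {i j : ι} (hij : i ≠ j) :
    qSerre (D.qi i) (D.serreDeg i j) (K i * F i) (K j * F j) = 0 := by
  have h1 : qSerre (D.qi i) (D.serreDeg i j) (F i * K i) (F j * K j) = 0 := by
    refine qSerre_mul_eq_zero (D.qi_generic i) _ _ _ _ _ _ _ (h.K_F i i) (h.K_F i j) ?_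
      (h.KK i j) (h.serreF i j hij)
    rw [h.K_F, D.qi_zpow_symm j i]
  rw [h.K_F, h.K_F, qSerre_smul, h1, smul_zero]

end QRel

namespace Uq

variable (D : QuantumDatum ι)

lemma qrel_counit : QRel D (B := ℂ) (fun _ => 0) (fun _ => 0) (fun _ => 1) (fun _ => 1) where
  KL _ := by simp
  LK _ := by simp
  KK _ _ := by simp
  KE _ _ := by simp
  KF _ _ := by simp
  EF_same _ := by simp
  EF_ne _ _ _ := by simp
  serreE _ _ _ := qSerre_zero_right _ _ _
  serreF _ _ _ := qSerre_zero_right _ _ _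

/-- The counit: `ε(E_i) = ε(F_i) = 0`, `ε(K_i) = 1`. -/
def counitHom : Uq D →ₐ[ℂ] ℂ := lift (qrel_counit D)

lemma qrel_comul : QRel D (B := Uq D ⊗[ℂ] Uq D)
    (fun i => E D i ⊗ₜ K D i + 1 ⊗ₜ E D i) (fun i => F D i ⊗ₜ 1 + Kinv D i ⊗ₜ F D i)
    (fun i => K D i ⊗ₜ K D i) (fun i => Kinv D i ⊗ₜ Kinv D i) where
  KL i := by
    rw [Algebra.TensorProduct.tmul_mul_tmul, (qrel D).KL, Algebra.TensorProduct.one_def]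
  LK i := by
    rw [Algebra.TensorProduct.tmul_mul_tmul, (qrel D).LK, Algebra.TensorProduct.one_def]
  KK i j := by
    rw [Algebra.TensorProduct.tmul_mul_tmul, Algebra.TensorProduct.tmul_mul_tmul, (qrel D).KK]
  KE i j := by
    simp only [mul_add, add_mul, Algebra.TensorProduct.tmul_mul_tmul, (qrel D).KE, mul_one,
      (qrel D).KL]
    rw [(qrel D).KK, mul_assoc (K D j), (qrel D).KL, mul_one, TensorProduct.tmul_smul,
      ← TensorProduct.smul_tmul', smul_add]
  KF i j := by
    simp only [mul_add, add_mul, Algebra.TensorProduct.tmul_mul_tmul, (qrel D).KF, mul_one,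
      (qrel D).KL]
    rw [(qrel D).KL_comm, mul_assoc (Kinv D j), (qrel D).KL, mul_one, TensorProduct.tmul_smul,
      ← TensorProduct.smul_tmul', smul_add]
  EF_same i := by
    have h := (qrel D).EF_same i
    have h1 : K D i * F D i = (D.qi i ^ 2)⁻¹ • (F D i * K D i) := by
      rw [(qrel D).K_F, QRel.qi_self]
    have h2 : Kinv D i * E D i = (D.qi i ^ 2)⁻¹ • (E D i * Kinv D i) := by
      rw [(qrel D).L_E, QRel.qi_self]
    have e : (E D i ⊗ₜ[ℂ] K D i + 1 ⊗ₜ E D i) * (F D i ⊗ₜ 1 + Kinv D i ⊗ₜ F D i) -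
        (F D i ⊗ₜ 1 + Kinv D i ⊗ₜ F D i) * (E D i ⊗ₜ K D i + 1 ⊗ₜ E D i) =
        (E D i * F D i - F D i * E D i) ⊗ₜ K D i +
          Kinv D i ⊗ₜ (E D i * F D i - F D i * E D i) := by
      simp only [mul_add, add_mul, Algebra.TensorProduct.tmul_mul_tmul, mul_one, one_mul, h1, h2,
        TensorProduct.sub_tmul, TensorProduct.tmul_sub, TensorProduct.tmul_smul,
        ← TensorProduct.smul_tmul']
      abel
    rw [e, h, ← TensorProduct.smul_tmul', TensorProduct.tmul_smul, ← smul_add,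
      TensorProduct.sub_tmul, TensorProduct.tmul_sub]
    congr 1
    abel
  EF_ne i j hij := by
    have h := (qrel D).EF_ne i j hij
    have h1 : K D i * F D j = (D.qi i ^ D.cartan i j)⁻¹ • (F D j * K D i) := (qrel D).K_F i j
    have h2 : Kinv D j * E D i = (D.qi i ^ D.cartan i j)⁻¹ • (E D i * Kinv D j) := by
      rw [(qrel D).L_E, D.qi_zpow_symm]
    have e : (E D i ⊗ₜ[ℂ] K D i + 1 ⊗ₜ E D i) * (F D j ⊗ₜ 1 + Kinv D j ⊗ₜ F D j) -
        (F D j ⊗ₜ 1 + Kinv D j ⊗ₜ F D j) * (E D i ⊗ₜ K D i + 1 ⊗ₜ E D i) =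
        (E D i * F D j - F D j * E D i) ⊗ₜ K D i +
          Kinv D j ⊗ₜ (E D i * F D j - F D j * E D i) := by
      simp only [mul_add, add_mul, Algebra.TensorProduct.tmul_mul_tmul, mul_one, one_mul, h1, h2,
        TensorProduct.sub_tmul, TensorProduct.tmul_sub, TensorProduct.tmul_smul,
        ← TensorProduct.smul_tmul']
      abel
    rw [e, h, TensorProduct.zero_tmul, TensorProduct.tmul_zero, add_zero]
  serreE i j hij := by
    have h := qrel D
    have e2 := QRel.qi_self D i
    rw [qSerre_add (D.qi_generic i), qSerre_tmul _ _ _ _ _ _ (h.KK i j) (h.serreE i j hij),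
      qSerre_one_tmul _ _ _ _ (h.serreE i j hij), add_zero]
    · rw [Algebra.TensorProduct.tmul_mul_tmul, Algebra.TensorProduct.tmul_mul_tmul, one_mul, mul_one,
        h.K_E, e2, TensorProduct.tmul_smul, smul_smul,
        inv_mul_cancel₀ (pow_ne_zero _ (D.qi_ne i)), one_smul]
    · rw [Algebra.TensorProduct.tmul_mul_tmul, Algebra.TensorProduct.tmul_mul_tmul, one_mul, mul_one,
        h.K_E, D.qi_pow_serreDeg hij, TensorProduct.tmul_smul, smul_smul, D.qi_zpow_symm i j,
        inv_mul_cancel₀ (QRel.qne D j _), one_smul]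
    · rw [Algebra.TensorProduct.tmul_mul_tmul, Algebra.TensorProduct.tmul_mul_tmul, one_mul, mul_one,
        h.K_E, D.qi_inv_pow_serreDeg hij, TensorProduct.tmul_smul]
  serreF i j hij := by
    have h := qrel D
    have e2 := QRel.qi_self D i
    have hF : qSerre (D.qi i) (D.serreDeg i j) (Kinv D i ⊗ₜ[ℂ] F D i) (Kinv D j ⊗ₜ[ℂ] F D j) = 0 := by
      have h0 := qSerre_tmul (D.qi i) (D.serreDeg i j) (F D i) (F D j) _ _ (h.LL_comm i j)
        (h.serreF i j hij)
      have := map_qSerre (Algebra.TensorProduct.comm ℂ (Uq D) (Uq D)).toAlgHom (D.qi i)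
        (D.serreDeg i j) (F D i ⊗ₜ[ℂ] Kinv D i) (F D j ⊗ₜ[ℂ] Kinv D j)
      rw [h0, map_zero] at this
      exact this.symm
    rw [add_comm (F D i ⊗ₜ[ℂ] (1 : Uq D)), add_comm (F D j ⊗ₜ[ℂ] (1 : Uq D)),
      qSerre_add (D.qi_generic i), hF, qSerre_tmul _ _ _ _ _ _ rfl (h.serreF i j hij), add_zero]
    · rw [Algebra.TensorProduct.tmul_mul_tmul, Algebra.TensorProduct.tmul_mul_tmul, one_mul, mul_one,
        h.L_F, e2, ← TensorProduct.smul_tmul', smul_smul,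
        inv_mul_cancel₀ (pow_ne_zero _ (D.qi_ne i)), one_smul]
    · rw [Algebra.TensorProduct.tmul_mul_tmul, Algebra.TensorProduct.tmul_mul_tmul, one_mul, mul_one,
        h.L_F, D.qi_pow_serreDeg hij, ← TensorProduct.smul_tmul', smul_smul, D.qi_zpow_symm j i,
        inv_mul_cancel₀ (QRel.qne D i _), one_smul]
    · rw [Algebra.TensorProduct.tmul_mul_tmul, Algebra.TensorProduct.tmul_mul_tmul, one_mul, mul_one,
        h.L_F, D.qi_inv_pow_serreDeg hij, ← TensorProduct.smul_tmul']

/-- The coproduct: `Δ(K_i) = K_i ⊗ K_i`, `Δ(E_i) = E_i ⊗ K_i + 1 ⊗ E_i`,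
`Δ(F_i) = F_i ⊗ 1 + K_i⁻¹ ⊗ F_i`. -/
def comulHom : Uq D →ₐ[ℂ] Uq D ⊗[ℂ] Uq D := lift (qrel_comul D)

lemma qrel_antipode : QRel D (B := (Uq D)ᵐᵒᵖ)
    (fun i => op (-(E D i * Kinv D i))) (fun i => op (-(K D i * F D i)))
    (fun i => op (Kinv D i)) (fun i => op (K D i)) where
  KL i := by rw [← MulOpposite.op_mul, (qrel D).KL, MulOpposite.op_one]
  LK i := by rw [← MulOpposite.op_mul, (qrel D).LK, MulOpposite.op_one]
  KK i j := by rw [← MulOpposite.op_mul, ← MulOpposite.op_mul, (qrel D).LL_comm]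
  KE i j := by
    rw [← MulOpposite.op_mul, ← MulOpposite.op_mul, ← MulOpposite.op_smul]
    congr 1
    rw [neg_mul, mul_neg, smul_neg, mul_assoc (E D j), (qrel D).LL_comm, ← mul_assoc, ← mul_assoc,
      (qrel D).KE, smul_mul_assoc]
  KF i j := by
    rw [← MulOpposite.op_mul, ← MulOpposite.op_mul, ← MulOpposite.op_smul]
    congr 1
    rw [neg_mul, mul_neg, smul_neg, ← mul_assoc, ← mul_assoc, (qrel D).KK, mul_assoc (K D j),
      mul_assoc (K D j), (qrel D).KF, mul_smul_comm]
  EF_same i := by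
    rw [← MulOpposite.op_mul, ← MulOpposite.op_mul, ← MulOpposite.op_sub, ← MulOpposite.op_sub,
      ← MulOpposite.op_smul]
    congr 1
    have h := (qrel D).EF_same i
    have e : K D i * F D i * (E D i * Kinv D i) = K D i * (F D i * E D i) * Kinv D i := by
      simp only [mul_assoc]
    rw [neg_mul_neg, neg_mul_neg, (qrel D).swap, e, ← sub_mul, ← mul_sub, ← neg_sub (E D i * F D i),
      h, mul_neg, neg_mul, mul_smul_comm, smul_mul_assoc, ← smul_neg]
    congr 1
    rw [mul_sub, sub_mul, (qrel D).KL, one_mul, mul_assoc, (qrel D).KL, mul_one, neg_sub]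
  EF_ne i j hij := by
    rw [← MulOpposite.op_mul, ← MulOpposite.op_mul, ← MulOpposite.op_sub, ← MulOpposite.op_zero]
    congr 1
    have h := (qrel D).EF_ne i j hij
    have e : K D j * F D j * (E D i * Kinv D i) = K D j * (F D j * E D i) * Kinv D i := by
      simp only [mul_assoc]
    rw [neg_mul_neg, neg_mul_neg, (qrel D).swap, e, ← sub_mul, ← mul_sub, ← neg_sub (E D i * F D j),
      h, neg_zero, mul_zero, zero_mul]
  serreE i j hij := by
    rw [op_qSerre, qSerre_neg _ _ _ _ ((qrel D).serreEL hij), smul_zero, MulOpposite.op_zero]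
  serreF i j hij := by
    rw [op_qSerre, qSerre_neg _ _ _ _ ((qrel D).serreKF hij), smul_zero, MulOpposite.op_zero]

/-- The antipode, as an algebra map to the opposite algebra. -/
def antipodeHom : Uq D →ₐ[ℂ] (Uq D)ᵐᵒᵖ := lift (qrel_antipode D)

/-- The antipode: `S(K_i) = K_i⁻¹`, `S(E_i) = -E_i K_i⁻¹`, `S(F_i) = -K_i F_i`. -/
def antipode (x : Uq D) : Uq D := unop (antipodeHom D x)

instance : Bialgebra ℂ (Uq D) :=
  Bialgebra.ofAlgHom (comulHom D) (counitHom D)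
    (by
      refine algHom_ext ?_ ?_ ?_ ?_ <;> intro i <;>
      simp only [AlgHom.comp_apply, comulHom, lift_E, lift_F, lift_K, lift_Kinv, map_add,
        Algebra.TensorProduct.map_tmul, AlgHom.id_apply, map_one, TensorProduct.add_tmul,
        TensorProduct.tmul_add, Algebra.TensorProduct.one_def, add_assoc] <;> rfl)
    (by
      refine algHom_ext ?_ ?_ ?_ ?_ <;> intro i <;>
      simp [comulHom, counitHom, lift_E, lift_F, lift_K, lift_Kinv])
    (by
      refine algHom_ext ?_ ?_ ?_ ?_ <;> intro i <;>
      simp [comulHom, counitHom, lift_E, lift_F, lift_K, lift_Kinv])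

end Uq

/-- The opposite algebra with the complex conjugate scalar multiplication. -/
def ConjOp (B : Type*) : Type _ := Bᵐᵒᵖ

namespace ConjOp
variable {B : Type*} [Ring B]

instance : Ring (ConjOp B) := inferInstanceAs (Ring Bᵐᵒᵖ)

instance [Algebra ℂ B] : Algebra ℂ (ConjOp B) :=
  ((algebraMap ℂ Bᵐᵒᵖ).comp (starRingEnd ℂ)).toAlgebra' fun c x =>
    Algebra.commutes (A := Bᵐᵒᵖ) ((starRingEnd ℂ) c) x

/-- The identification of a ring with its opposite. -/
def mk : B ≃+ ConjOp B := MulOpposite.opAddEquiv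

lemma mk_mul (x y : B) : (mk (x * y) : ConjOp B) = mk y * mk x := rfl
lemma mk_one : (mk 1 : ConjOp B) = 1 := rfl
lemma mk_pow (x : B) (n : ℕ) : (mk (x ^ n) : ConjOp B) = mk x ^ n := MulOpposite.op_pow x n
lemma smul_mk [Algebra ℂ B] (c : ℂ) (x : B) : c • (mk x : ConjOp B) = mk ((starRingEnd ℂ) c • x) := by
  rw [Algebra.smul_def]
  change op (algebraMap ℂ B ((starRingEnd ℂ) c)) * op x = op _
  rw [← MulOpposite.op_mul, Algebra.smul_def, Algebra.commutes]

lemma qSerre_mk [Algebra ℂ B] (p : ℂ) (hp : (starRingEnd ℂ) p = p) (r : ℕ) (x y : B) :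
    qSerre p r (mk x : ConjOp B) (mk y) = mk ((-1 : ℂ) ^ r • qSerre p r x y) := by
  rw [← sum_reverse_qSerre, qSerre, map_sum]
  refine Finset.sum_congr rfl fun k _ => ?_
  rw [← mk_pow, ← mk_pow, ← mk_mul, ← mk_mul, smul_mk, map_mul, conj_qBinom, hp, map_pow, map_neg,
    map_one, mul_assoc]

end ConjOp

namespace Uq

variable (D : QuantumDatum ι)

lemma qrel_star : QRel D (B := ConjOp (Uq D))
    (fun i => ConjOp.mk (K D i * F D i)) (fun i => ConjOp.mk (E D i * Kinv D i))
    (fun i => ConjOp.mk (K D i)) (fun i => ConjOp.mk (Kinv D i)) where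
  KL i := by rw [← ConjOp.mk_mul, (qrel D).LK, ConjOp.mk_one]
  LK i := by rw [← ConjOp.mk_mul, (qrel D).KL, ConjOp.mk_one]
  KK i j := by rw [← ConjOp.mk_mul, ← ConjOp.mk_mul, (qrel D).KK]
  KE i j := by
    rw [← ConjOp.mk_mul, ← ConjOp.mk_mul, ConjOp.smul_mk, map_zpow₀, D.conj_qi]
    congr 1
    have := (qrel D).L_F i j
    rw [← mul_assoc, ← mul_assoc, ← (qrel D).KL_comm, mul_assoc (K D j), this]
    simp only [mul_smul_comm, smul_mul_assoc, mul_assoc, (qrel D).LK, mul_one]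
  KF i j := by
    rw [← ConjOp.mk_mul, ← ConjOp.mk_mul, ConjOp.smul_mk, map_zpow₀, D.conj_qi]
    congr 1
    have := (qrel D).L_E i j
    rw [mul_assoc (E D j), ← (qrel D).KL_comm, ← mul_assoc, ← mul_assoc, this, zpow_neg]
    simp only [smul_mul_assoc, mul_assoc]
    rw [← mul_assoc (Kinv D i), (qrel D).LK, one_mul]
  EF_same i := by
    rw [← ConjOp.mk_mul, ← ConjOp.mk_mul, ← map_sub, ← map_sub, ConjOp.smul_mk,
      map_inv₀ (starRingEnd ℂ), map_sub (starRingEnd ℂ), map_inv₀ (starRingEnd ℂ), D.conj_qi]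
    congr 1
    have h := (qrel D).EF_same i
    have e : K D i * F D i * (E D i * Kinv D i) = K D i * (F D i * E D i) * Kinv D i := by
      simp only [mul_assoc]
    rw [(qrel D).swap, e, ← sub_mul, ← mul_sub, h, mul_smul_comm, smul_mul_assoc]
    congr 1
    rw [mul_sub, sub_mul, (qrel D).KL, one_mul, mul_assoc, (qrel D).KL, mul_one]
  EF_ne i j hij := by
    rw [← ConjOp.mk_mul, ← ConjOp.mk_mul, ← map_sub]
    have h := (qrel D).EF_ne j i hij.symm
    have e : K D i * F D i * (E D j * Kinv D j) = K D i * (F D i * E D j) * Kinv D j := by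
      simp only [mul_assoc]
    rw [(qrel D).swap, e, ← sub_mul, ← mul_sub, h, mul_zero, zero_mul, map_zero]
  serreE i j hij := by
    rw [ConjOp.qSerre_mk _ (D.conj_qi i), (qrel D).serreKF hij, smul_zero, map_zero]
  serreF i j hij := by
    rw [ConjOp.qSerre_mk _ (D.conj_qi i), (qrel D).serreEL hij, smul_zero, map_zero]

/-- The `*`-structure of the compact real form, as an algebra map to the conjugate opposite. -/
def starHom : Uq D →ₐ[ℂ] ConjOp (Uq D) := lift (qrel_star D)

/-- The `*`-structure of the compact real form: the conjugate-linear anti-multiplicative map with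
`K_i^* = K_i`, `E_i^* = K_i F_i`, `F_i^* = E_i K_i⁻¹`. -/
def starMap (x : Uq D) : Uq D := ConjOp.mk.symm (starHom D x)

end Uq
end QFlag

namespace QFlag

open scoped TensorProduct
open WithConv (toConv)

variable {ι : Type*} [Fintype ι]

namespace Uq

variable (D : QuantumDatum ι)

/-- `K_i` as a unit. -/
def Kunit (i : ι) : (Uq D)ˣ := ⟨K D i, Kinv D i, (qrel D).KL i, (qrel D).LK i⟩

lemma Kunit_commute (i j : ι) : Commute (Kunit D i) (Kunit D j) :=
  Units.ext ((qrel D).KK i j)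

lemma Kunit_zpow_commute : Pairwise fun i j => ∀ m n : Multiplicative ℤ,
    Commute (zpowersHom (Uq D)ˣ (Kunit D i) m) (zpowersHom (Uq D)ˣ (Kunit D j) n) :=
  fun i j _ m n => by
    simpa [zpowersHom_apply] using ((Kunit_commute D i j).zpow_left _).zpow_right _

/-- The homomorphism from the root lattice to the units of `U_q(𝔤)`. -/
def KHom : (ι → Multiplicative ℤ) →* (Uq D)ˣ :=
  MonoidHom.noncommPiCoprod (fun i => zpowersHom (Uq D)ˣ (Kunit D i)) (Kunit_zpow_commute D)

/-- `K_λ = K_1^{n_1} ⋯ K_r^{n_r}` for `λ = ∑ n_i α_i`. -/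
def Kpow (n : ι → ℤ) : Uq D := (KHom D fun i => Multiplicative.ofAdd (n i) : (Uq D)ˣ)

lemma Kpow_add (m n : ι → ℤ) : Kpow D (m + n) = Kpow D m * Kpow D n := by
  unfold Kpow
  rw [← Units.val_mul, ← map_mul]
  rfl

lemma Kpow_zero : Kpow D 0 = 1 := by
  unfold Kpow
  rw [← Units.val_one, ← map_one (KHom D)]
  rfl

lemma Kpow_mul_neg (n : ι → ℤ) : Kpow D n * Kpow D (-n) = 1 := by
  rw [← Kpow_add, add_neg_cancel, Kpow_zero]

lemma Kpow_neg_mul (n : ι → ℤ) : Kpow D (-n) * Kpow D n = 1 := by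
  rw [← Kpow_add, neg_add_cancel, Kpow_zero]

lemma comul_eq (x : Uq D) : Coalgebra.comul (R := ℂ) x = comulHom D x := rfl

lemma counit_eq (x : Uq D) : Coalgebra.counit (R := ℂ) x = counitHom D x := rfl

/-- Two monoid homomorphisms which agree on the `K_i` agree on all `K_λ`. -/
lemma eq_on_KHom {M : Type*} [Monoid M] (f h : (Uq D)ˣ →* M)
    (hK : ∀ i, f (Kunit D i) = h (Kunit D i)) (n : ι → Multiplicative ℤ) :
    f (KHom D n) = h (KHom D n) := by
  have : KHom D n ∈ f.eqLocus h := by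
    unfold KHom
    rw [MonoidHom.noncommPiCoprod_apply]
    refine Subgroup.noncommProd_mem _ _ fun i _ => ?_
    rw [zpowersHom_apply]
    exact Subgroup.zpow_mem _ (hK i) _
  exact this

lemma comul_Kpow (n : ι → ℤ) :
    Coalgebra.comul (R := ℂ) (Kpow D n) = Kpow D n ⊗ₜ[ℂ] Kpow D n := by
  let f : (Uq D)ˣ →* (Uq D ⊗[ℂ] Uq D) := (comulHom D : Uq D →* _).comp (Units.coeHom _)
  let h : (Uq D)ˣ →* (Uq D ⊗[ℂ] Uq D) :=
    { toFun := fun u => (u : Uq D) ⊗ₜ[ℂ] (u : Uq D)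
      map_one' := rfl
      map_mul' := fun u v => by rw [Units.val_mul, Algebra.TensorProduct.tmul_mul_tmul] }
  exact eq_on_KHom D f h (fun i => lift_K _ i) _

lemma counit_Kpow (n : ι → ℤ) : Coalgebra.counit (R := ℂ) (Kpow D n) = (1 : ℂ) := by
  let f : (Uq D)ˣ →* ℂ := (counitHom D : Uq D →* ℂ).comp (Units.coeHom _)
  exact eq_on_KHom D f 1 (fun i => lift_K _ i) _

end Uq

section Dual
variable (D : QuantumDatum ι)

/-- The linear dual of `U_q(𝔤)`, with the product `(φψ)(X) = (φ ⊗ ψ)(Δ X)` and the unit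
`1(X) = ε(X)`. -/
abbrev DualAlg : Type _ := WithConv (Uq D →ₗ[ℂ] ℂ)

variable {D}

/-- The left action `(X ▷ φ)(Y) = φ(Y X)`. -/
def lact (X : Uq D) (φ : DualAlg D) : DualAlg D := toConv (φ.ofConv ∘ₗ LinearMap.mulRight ℂ X)

/-- The right action `(φ ◁ X)(Y) = φ(X Y)`. -/
def ract (φ : DualAlg D) (X : Uq D) : DualAlg D := toConv (φ.ofConv ∘ₗ LinearMap.mulLeft ℂ X)

/-- The counit `ε(φ) = φ(1)`. -/
def dualCounit (φ : DualAlg D) : ℂ := φ 1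

/-- The `*`-structure `φ^*(X) = conj (φ (S(X)^*))`. -/
def dualStar (φ : DualAlg D) : DualAlg D :=
  toConv
    { toFun := fun X => (starRingEnd ℂ) (φ (Uq.starMap D (Uq.antipode D X)))
      map_add' := fun X Y => by
        simp only [Uq.antipode, Uq.starMap, map_add, MulOpposite.unop_add]
      map_smul' := fun c X => by
        have h : Uq.starMap D (Uq.antipode D (c • X)) =
            (starRingEnd ℂ) c • Uq.starMap D (Uq.antipode D X) := by
          rw [Uq.antipode, map_smul, MulOpposite.unop_smul, Uq.starMap, map_smul]
          rw [← ConjOp.mk.apply_symm_apply (Uq.starHom D (MulOpposite.unop (Uq.antipodeHom D X))),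
            ConjOp.smul_mk, AddEquiv.symm_apply_apply]
          rfl
        rw [h, map_smul, smul_eq_mul, map_mul, Complex.conj_conj]
        rfl }

lemma lact_apply (X Y : Uq D) (φ : DualAlg D) : lact X φ Y = φ (Y * X) := rfl
lemma ract_apply (X Y : Uq D) (φ : DualAlg D) : ract φ X Y = φ (X * Y) := rfl

lemma lact_Kpow_mul (n : ι → ℤ) (φ ψ : DualAlg D) :
    lact (Uq.Kpow D n) (φ * ψ) = lact (Uq.Kpow D n) φ * lact (Uq.Kpow D n) ψ := by
  refine WithConv.ext (LinearMap.ext fun Y => ?_)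
  change (φ * ψ) (Y * Uq.Kpow D n) = (lact _ φ * lact _ ψ) Y
  rw [LinearMap.convMul_apply, LinearMap.convMul_apply, Bialgebra.comul_mul, Uq.comul_Kpow]
  congr 1
  induction Coalgebra.comul (R := ℂ) Y using TensorProduct.induction_on with
  | zero => simp
  | add x y hx hy => rw [add_mul, map_add, map_add, hx, hy]
  | tmul x y => rw [Algebra.TensorProduct.tmul_mul_tmul]; rfl

lemma ract_Kpow_mul (n : ι → ℤ) (φ ψ : DualAlg D) :
    ract (φ * ψ) (Uq.Kpow D n) = ract φ (Uq.Kpow D n) * ract ψ (Uq.Kpow D n) := by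
  refine WithConv.ext (LinearMap.ext fun Y => ?_)
  change (φ * ψ) (Uq.Kpow D n * Y) = (ract φ _ * ract ψ _) Y
  rw [LinearMap.convMul_apply, LinearMap.convMul_apply, Bialgebra.comul_mul, Uq.comul_Kpow]
  congr 1
  induction Coalgebra.comul (R := ℂ) Y using TensorProduct.induction_on with
  | zero => simp
  | add x y hx hy => rw [mul_add, map_add, map_add, hx, hy]
  | tmul x y => rw [Algebra.TensorProduct.tmul_mul_tmul]; rfl

lemma lact_Kpow_one (n : ι → ℤ) : lact (Uq.Kpow D n) (1 : DualAlg D) = 1 := by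
  refine WithConv.ext (LinearMap.ext fun Y => ?_)
  change Coalgebra.counit (R := ℂ) (Y * Uq.Kpow D n) = Coalgebra.counit (R := ℂ) Y
  rw [Bialgebra.counit_mul, Uq.counit_Kpow, mul_one]

lemma ract_Kpow_one (n : ι → ℤ) : ract (1 : DualAlg D) (Uq.Kpow D n) = 1 := by
  refine WithConv.ext (LinearMap.ext fun Y => ?_)
  change Coalgebra.counit (R := ℂ) (Uq.Kpow D n * Y) = Coalgebra.counit (R := ℂ) Y
  rw [Bialgebra.counit_mul, Uq.counit_Kpow, one_mul]

variable (D)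

/-- `σ_{λ,μ}(a) = K_λ ▷ a ◁ K_μ` as an algebra endomorphism of the dual of `U_q(𝔤)`. -/
def sigmaHom (l m : ι → ℤ) : DualAlg D →ₐ[ℂ] DualAlg D :=
  AlgHom.ofLinearMap
    { toFun := fun a => ract (lact (Uq.Kpow D l) a) (Uq.Kpow D m)
      map_add' := fun _ _ => rfl
      map_smul' := fun _ _ => rfl }
    (by
      change ract (lact (Uq.Kpow D l) 1) (Uq.Kpow D m) = 1
      rw [lact_Kpow_one, ract_Kpow_one])
    (fun a b => by
      change ract (lact (Uq.Kpow D l) (a * b)) (Uq.Kpow D m) = ract (lact _ a) _ * ract (lact _ b) _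
      rw [lact_Kpow_mul, ract_Kpow_mul])

lemma sigmaHom_apply (l m : ι → ℤ) (a : DualAlg D) (Y : Uq D) :
    sigmaHom D l m a Y = a (Uq.Kpow D m * Y * Uq.Kpow D l) := rfl

lemma sigmaHom_comp (l m l' m' : ι → ℤ) (hl : l + l' = 0) (hm : m + m' = 0) :
    (sigmaHom D l m).comp (sigmaHom D l' m') = AlgHom.id ℂ _ := by
  refine AlgHom.ext fun a => WithConv.ext (LinearMap.ext fun Y => ?_)
  change a (Uq.Kpow D m' * (Uq.Kpow D m * Y * Uq.Kpow D l) * Uq.Kpow D l') = a Y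
  have e : Uq.Kpow D m' * (Uq.Kpow D m * Y * Uq.Kpow D l) * Uq.Kpow D l' =
      Uq.Kpow D m' * Uq.Kpow D m * Y * (Uq.Kpow D l * Uq.Kpow D l') := by simp only [mul_assoc]
  rw [e, ← Uq.Kpow_add, ← Uq.Kpow_add, add_comm m', hl, hm, Uq.Kpow_zero, one_mul, mul_one]

end Dual

/-- A finite-dimensional representation of `U_q(𝔤)` (of type 1), written in a basis `{v_k}` of
weight vectors: the matrix `π(X)^k_l` is `π X k l`, and `v_k` has weight `λ_k`, given by its
coordinates `wt k j = ⟨λ_k, α_j^∨⟩` in the basis of fundamental weights. Thus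
`K_j v_k = q^{(α_j, λ_k)} v_k` with `(α_j, λ_k) = d_j ⟨λ_k, α_j^∨⟩`. -/
structure WeightRep (D : QuantumDatum ι) (κ : Type) [Fintype κ] [DecidableEq κ] where
  π : Uq D →ₐ[ℂ] Matrix κ κ ℂ
  wt : κ → ι → ℤ
  π_K : ∀ j, π (Uq.K D j) = Matrix.diagonal fun k => D.qi j ^ wt k j

namespace WeightRep

variable {D : QuantumDatum ι}

/-- The matrix coefficient `u^k_l(X) = π(X)^k_l`. -/
def coef {κ : Type} [Fintype κ] [DecidableEq κ] (V : WeightRep D κ) (k l : κ) : DualAlg D :=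
  toConv (Matrix.entryLinearMap ℂ ℂ k l ∘ₗ V.π.toLinearMap)

lemma coef_apply {κ : Type} [Fintype κ] [DecidableEq κ] (V : WeightRep D κ) (k l : κ) (X : Uq D) :
    V.coef k l X = V.π X k l := rfl

variable (D) in
/-- The trivial representation. -/
def triv : WeightRep D Unit where
  π := (Algebra.ofId ℂ (Matrix Unit Unit ℂ)).comp (Uq.counitHom D)
  wt := 0
  π_K j := by
    rw [AlgHom.comp_apply, Uq.counitHom, Uq.lift_K, map_one]
    simp

variable {κ κ' : Type} [Fintype κ] [DecidableEq κ] [Fintype κ'] [DecidableEq κ']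

/-- The tensor product of two representations. -/
def tensor (V : WeightRep D κ) (W : WeightRep D κ') : WeightRep D (κ × κ') where
  π := ((Matrix.kroneckerAlgEquiv κ κ' ℂ).toAlgHom.comp (Algebra.TensorProduct.map V.π W.π)).comp
    (Uq.comulHom D)
  wt k := V.wt k.1 + W.wt k.2
  π_K j := by
    have h : Uq.comulHom D (Uq.K D j) = Uq.K D j ⊗ₜ Uq.K D j := Uq.lift_K _ j
    rw [AlgHom.comp_apply, h, AlgHom.comp_apply, Algebra.TensorProduct.map_tmul, V.π_K, W.π_K]
    change Matrix.kroneckerAlgEquiv κ κ' ℂ _ = _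
    rw [Matrix.kroneckerAlgEquiv_apply, kroneckerLinearEquiv_tmul, Matrix.diagonal_kronecker_diagonal]
    congr 1
    funext k
    exact (zpow_add₀ (D.qi_ne j) _ _).symm

lemma coef_mul_coef (V : WeightRep D κ) (W : WeightRep D κ') (k l : κ) (k' l' : κ') :
    V.coef k l * W.coef k' l' = (V.tensor W).coef (k, k') (l, l') := by
  refine WithConv.ext (LinearMap.ext fun Y => ?_)
  change (V.coef k l * W.coef k' l') Y =
    kroneckerLinearEquiv κ κ κ' κ' ℂ (Algebra.TensorProduct.map V.π W.π (Uq.comulHom D Y))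
      (k, k') (l, l')
  rw [LinearMap.convMul_apply, Uq.comul_eq]
  induction Uq.comulHom D Y using TensorProduct.induction_on with
  | zero => simp
  | add x y hx hy => rw [map_add, map_add, map_add, map_add, Matrix.add_apply, hx, hy]
  | tmul x y => rw [Algebra.TensorProduct.map_tmul, kroneckerLinearEquiv_tmul]; rfl

end WeightRep

section Rings
variable (D : QuantumDatum ι)

/-- The set of matrix coefficients of finite-dimensional representations. -/
def matrixCoeffs : Set (DualAlg D) :=
  {φ | ∃ (κ : Type) (_ : Fintype κ) (_ : DecidableEq κ) (V : WeightRep D κ) (k l : κ),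
    φ = V.coef k l}

/-- The quantized coordinate ring `ℂ_q[G]`: the span of the matrix coefficients of
finite-dimensional representations, a subalgebra of the dual of `U_q(𝔤)`. -/
def CqG : Subalgebra ℂ (DualAlg D) :=
  (Submodule.span ℂ (matrixCoeffs D)).toSubalgebra
    (Submodule.subset_span ⟨Unit, inferInstance, inferInstance, WeightRep.triv D, (), (), by
      refine WithConv.ext (LinearMap.ext fun Y => ?_)
      change Coalgebra.counit (R := ℂ) Y = algebraMap ℂ (Matrix Unit Unit ℂ) (Uq.counitHom D Y) () ()
      rw [Uq.counit_eq, Matrix.algebraMap_matrix_apply]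
      simp⟩)
    (by
      intro x y hx hy
      have h := Submodule.mul_mem_mul hx hy
      rw [Submodule.span_mul_span] at h
      refine Submodule.span_mono ?_ h
      rintro _ ⟨_, ⟨κ, i1, i2, V, k, l, rfl⟩, _, ⟨κ', i3, i4, W, k', l', rfl⟩, rfl⟩
      exact ⟨κ × κ', inferInstance, inferInstance, V.tensor W, (k, k'), (l, l'),
        V.coef_mul_coef W k l k' l'⟩)

lemma lact_mem_CqG (X : Uq D) {a : DualAlg D} (ha : a ∈ CqG D) : lact X a ∈ CqG D := by
  change a ∈ Submodule.span ℂ (matrixCoeffs D) at ha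
  change lact X a ∈ Submodule.span ℂ (matrixCoeffs D)
  induction ha using Submodule.span_induction with
  | zero => exact Submodule.zero_mem _
  | add x y _ _ hx hy => exact Submodule.add_mem _ hx hy
  | smul c x _ hx => exact Submodule.smul_mem _ c hx
  | mem x hx =>
    obtain ⟨κ, i1, i2, V, k, l, rfl⟩ := hx
    have : lact X (V.coef k l) = ∑ m, V.π X m l • V.coef k m := by
      refine WithConv.ext (LinearMap.ext fun Y => ?_)
      rw [WithConv.ofConv_sum, LinearMap.sum_apply]
      change V.π (Y * X) k l = ∑ m, V.π X m l * V.π Y k m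
      rw [map_mul, Matrix.mul_apply]
      exact Finset.sum_congr rfl fun m _ => mul_comm _ _
    rw [this]
    exact Submodule.sum_mem _ fun m _ => Submodule.smul_mem _ _
      (Submodule.subset_span ⟨κ, i1, i2, V, k, m, rfl⟩)

lemma ract_mem_CqG (X : Uq D) {a : DualAlg D} (ha : a ∈ CqG D) : ract a X ∈ CqG D := by
  change a ∈ Submodule.span ℂ (matrixCoeffs D) at ha
  change ract a X ∈ Submodule.span ℂ (matrixCoeffs D)
  induction ha using Submodule.span_induction with
  | zero => exact Submodule.zero_mem _
  | add x y _ _ hx hy => exact Submodule.add_mem _ hx hy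
  | smul c x _ hx => exact Submodule.smul_mem _ c hx
  | mem x hx =>
    obtain ⟨κ, i1, i2, V, k, l, rfl⟩ := hx
    have : ract (V.coef k l) X = ∑ m, V.π X k m • V.coef m l := by
      refine WithConv.ext (LinearMap.ext fun Y => ?_)
      rw [WithConv.ofConv_sum, LinearMap.sum_apply]
      change V.π (X * Y) k l = ∑ m, V.π X k m * V.π Y m l
      rw [map_mul, Matrix.mul_apply]
    rw [this]
    exact Submodule.sum_mem _ fun m _ => Submodule.smul_mem _ _
      (Submodule.subset_span ⟨κ, i1, i2, V, m, l, rfl⟩)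

lemma sigmaHom_mem_CqG (l m : ι → ℤ) {a : DualAlg D} (ha : a ∈ CqG D) :
    sigmaHom D l m a ∈ CqG D :=
  ract_mem_CqG D _ (lact_mem_CqG D _ ha)

/-- `ℂ_q[T\G] = {a ∈ ℂ_q[G] : a ◁ K_λ = a for all λ}`, as a subalgebra of the dual. -/
def subTG : Subalgebra ℂ (DualAlg D) where
  carrier := {a | a ∈ CqG D ∧ ∀ n, ract a (Uq.Kpow D n) = a}
  mul_mem' ha hb := ⟨mul_mem ha.1 hb.1, fun n => by rw [ract_Kpow_mul, ha.2, hb.2]⟩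
  add_mem' {a b} ha hb := ⟨add_mem ha.1 hb.1, fun n => by
    change ract a _ + ract b _ = a + b
    rw [ha.2, hb.2]⟩
  algebraMap_mem' c := ⟨(CqG D).algebraMap_mem c, fun n => by
    rw [Algebra.algebraMap_eq_smul_one]
    change c • ract 1 _ = _
    rw [ract_Kpow_one]⟩

/-- `ℂ_q[G/T] = {a ∈ ℂ_q[G] : K_λ ▷ a = a for all λ}`, as a subalgebra of the dual. -/
def subGT : Subalgebra ℂ (DualAlg D) where
  carrier := {a | a ∈ CqG D ∧ ∀ n, lact (Uq.Kpow D n) a = a}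
  mul_mem' ha hb := ⟨mul_mem ha.1 hb.1, fun n => by rw [lact_Kpow_mul, ha.2, hb.2]⟩
  add_mem' {a b} ha hb := ⟨add_mem ha.1 hb.1, fun n => by
    change lact _ a + lact _ b = a + b
    rw [ha.2, hb.2]⟩
  algebraMap_mem' c := ⟨(CqG D).algebraMap_mem c, fun n => by
    rw [Algebra.algebraMap_eq_smul_one]
    change c • lact _ 1 = _
    rw [lact_Kpow_one]⟩

lemma lact_ract_comm (X Y : Uq D) (a : DualAlg D) : lact X (ract a Y) = ract (lact X a) Y := by
  refine WithConv.ext (LinearMap.ext fun Z => ?_)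
  change a (Y * (Z * X)) = a (Y * Z * X)
  rw [mul_assoc]

lemma Kpow_comm (m n : ι → ℤ) : Uq.Kpow D m * Uq.Kpow D n = Uq.Kpow D n * Uq.Kpow D m := by
  rw [← Uq.Kpow_add, ← Uq.Kpow_add, add_comm]

lemma sigmaHom_mem_subTG (l m : ι → ℤ) {a : DualAlg D} (ha : a ∈ subTG D) :
    sigmaHom D l m a ∈ subTG D := by
  refine ⟨sigmaHom_mem_CqG D l m ha.1, fun n => ?_⟩
  change ract (ract (lact _ a) _) _ = ract (lact _ a) _
  rw [← lact_ract_comm, ← lact_ract_comm, ha.2, ha.2]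

lemma sigmaHom_mem_subGT (l m : ι → ℤ) {a : DualAlg D} (ha : a ∈ subGT D) :
    sigmaHom D l m a ∈ subGT D := by
  refine ⟨sigmaHom_mem_CqG D l m ha.1, fun n => ?_⟩
  change lact _ (ract (lact _ a) _) = ract (lact _ a) _
  rw [lact_ract_comm, ha.2, ha.2]

/-- Restriction of `σ_{λ,μ}` to an invariant subalgebra, as an automorphism. -/
def sigmaRestrict (S : Subalgebra ℂ (DualAlg D))
    (hS : ∀ l m : ι → ℤ, ∀ a ∈ S, sigmaHom D l m a ∈ S) (l m : ι → ℤ) : S ≃ₐ[ℂ] S :=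
  AlgEquiv.ofAlgHom
    (((sigmaHom D l m).comp S.val).codRestrict S fun a => hS l m a a.2)
    (((sigmaHom D (-l) (-m)).comp S.val).codRestrict S fun a => hS (-l) (-m) a a.2)
    (AlgHom.ext fun a => Subtype.ext
      (DFunLike.congr_fun (sigmaHom_comp D l m (-l) (-m) (add_neg_cancel l) (add_neg_cancel m)) a.1))
    (AlgHom.ext fun a => Subtype.ext
      (DFunLike.congr_fun (sigmaHom_comp D (-l) (-m) l m (neg_add_cancel l) (neg_add_cancel m)) a.1))

/-- The algebra `ℂ_q[T\G]`. -/
def CqTG : Type _ := subTG D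

/-- The algebra `ℂ_q[G/T]`. -/
def CqGT : Type _ := subGT D

instance : Ring (CqTG D) := inferInstanceAs (Ring (subTG D))
instance : Algebra ℂ (CqTG D) := inferInstanceAs (Algebra ℂ (subTG D))
instance : Ring (CqGT D) := inferInstanceAs (Ring (subGT D))
instance : Algebra ℂ (CqGT D) := inferInstanceAs (Algebra ℂ (subGT D))

/-- The inclusion of `ℂ_q[T\G]` in the dual of `U_q(𝔤)`. -/
def CqTG.incl : CqTG D →ₐ[ℂ] DualAlg D := (subTG D).val

/-- The inclusion of `ℂ_q[G/T]` in the dual of `U_q(𝔤)`. -/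
def CqGT.incl : CqGT D →ₐ[ℂ] DualAlg D := (subGT D).val

/-- The modular automorphism `θ(a) = K_{2ρ} ▷ a ◁ K_{2ρ}` restricted to `ℂ_q[T\G]`. -/
def thetaTG : CqTG D ≃ₐ[ℂ] CqTG D :=
  sigmaRestrict D (subTG D) (fun l m _ => sigmaHom_mem_subTG D l m) D.twoRho D.twoRho

/-- The modular automorphism `θ(a) = K_{2ρ} ▷ a ◁ K_{2ρ}` restricted to `ℂ_q[G/T]`. -/
def thetaGT : CqGT D ≃ₐ[ℂ] CqGT D :=
  sigmaRestrict D (subGT D) (fun l m _ => sigmaHom_mem_subGT D l m) D.twoRho D.twoRho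

lemma thetaTG_apply (a : CqTG D) (Y : Uq D) : CqTG.incl D (thetaTG D a) Y =
    CqTG.incl D a (Uq.Kpow D D.twoRho * Y * Uq.Kpow D D.twoRho) := rfl

lemma thetaGT_apply (a : CqGT D) (Y : Uq D) : CqGT.incl D (thetaGT D a) Y =
    CqGT.incl D a (Uq.Kpow D D.twoRho * Y * Uq.Kpow D D.twoRho) := rfl

end Rings
end QFlag

namespace QFlag

open scoped TensorProduct

namespace Hochschild

section
set_option maxSynthPendingDepth 6

variable {A : Type*} [Ring A] [Algebra ℂ A]

/-- Multiplication of the first two factors. -/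
def firstFace (X : Type*) [AddCommGroup X] [Module ℂ X] : A ⊗[ℂ] (A ⊗[ℂ] X) →ₗ[ℂ] A ⊗[ℂ] X :=
  (LinearMap.mul' ℂ A).rTensor X ∘ₗ (TensorProduct.assoc ℂ A A X).symm.toLinearMap

lemma firstFace_tmul (X : Type*) [AddCommGroup X] [Module ℂ X] (a b : A) (x : X) :
    firstFace X (a ⊗ₜ[ℂ] (b ⊗ₜ[ℂ] x)) = (a * b) ⊗ₜ x := rfl

/-- The twisted cyclic face `a ⊗ x ⊗ b ↦ σ(b) a ⊗ x`. -/
def lastFace (σ : A ≃ₐ[ℂ] A) (X : Type*) [AddCommGroup X] [Module ℂ X] :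
    A ⊗[ℂ] (X ⊗[ℂ] A) →ₗ[ℂ] A ⊗[ℂ] X :=
  firstFace X ∘ₗ σ.toLinearMap.rTensor (A ⊗[ℂ] X) ∘ₗ
    (TensorProduct.comm ℂ (A ⊗[ℂ] X) A).toLinearMap ∘ₗ (TensorProduct.assoc ℂ A X A).symm.toLinearMap

lemma lastFace_tmul (σ : A ≃ₐ[ℂ] A) (X : Type*) [AddCommGroup X] [Module ℂ X] (a b : A) (x : X) :
    lastFace σ X (a ⊗ₜ[ℂ] (x ⊗ₜ[ℂ] b)) = (σ b * a) ⊗ₜ x := rfl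

/-- The Hochschild boundary `b_σ : C_2 → C_1` with coefficients in the twisted bimodule `_σA`. -/
def b₂ (σ : A ≃ₐ[ℂ] A) : A ⊗[ℂ] (A ⊗[ℂ] A) →ₗ[ℂ] A ⊗[ℂ] A :=
  firstFace A - (LinearMap.mul' ℂ A).lTensor A + lastFace σ A

lemma b₂_tmul (σ : A ≃ₐ[ℂ] A) (a₀ a₁ a₂ : A) :
    b₂ σ (a₀ ⊗ₜ[ℂ] (a₁ ⊗ₜ[ℂ] a₂)) =
      (a₀ * a₁) ⊗ₜ a₂ - a₀ ⊗ₜ (a₁ * a₂) + (σ a₂ * a₀) ⊗ₜ a₁ := rfl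

/-- The Hochschild boundary `b_σ : C_3 → C_2` with coefficients in the twisted bimodule `_σA`. -/
def b₃ (σ : A ≃ₐ[ℂ] A) : A ⊗[ℂ] (A ⊗[ℂ] (A ⊗[ℂ] A)) →ₗ[ℂ] A ⊗[ℂ] (A ⊗[ℂ] A) :=
  firstFace (A ⊗[ℂ] A) - (firstFace A).lTensor A + ((LinearMap.mul' ℂ A).lTensor A).lTensor A -
    lastFace σ (A ⊗[ℂ] A) ∘ₗ (TensorProduct.assoc ℂ A A A).symm.toLinearMap.lTensor A

lemma b₃_tmul (σ : A ≃ₐ[ℂ] A) (a₀ a₁ a₂ a₃ : A) :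
    b₃ σ (a₀ ⊗ₜ[ℂ] (a₁ ⊗ₜ[ℂ] (a₂ ⊗ₜ[ℂ] a₃))) =
      (a₀ * a₁) ⊗ₜ (a₂ ⊗ₜ a₃) - a₀ ⊗ₜ ((a₁ * a₂) ⊗ₜ a₃) + a₀ ⊗ₜ (a₁ ⊗ₜ (a₂ * a₃)) -
        (σ a₃ * a₀) ⊗ₜ (a₁ ⊗ₜ a₂) := rfl

lemma b₂_b₃ (σ : A ≃ₐ[ℂ] A) : b₂ σ ∘ₗ b₃ σ = 0 := by
  refine TensorProduct.ext' fun a₀ y => ?_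
  induction y using TensorProduct.induction_on with
  | zero => simp
  | add x y hx hy => rw [TensorProduct.tmul_add, map_add, map_add, hx, hy]
  | tmul a₁ y => ?_
  induction y using TensorProduct.induction_on with
  | zero => simp
  | add x y hx hy => rw [TensorProduct.tmul_add, TensorProduct.tmul_add, map_add, map_add, hx, hy]
  | tmul a₂ a₃ => ?_
  rw [LinearMap.comp_apply, b₃_tmul]
  simp only [map_add, map_sub, b₂_tmul, mul_assoc, map_mul, LinearMap.zero_apply]
  abel

/-- The twisted Hochschild homology `HH_2^σ(A) = H_2(A, _σA)`: cycles modulo boundaries. -/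
def HH₂ (σ : A ≃ₐ[ℂ] A) : Type _ :=
  LinearMap.ker (b₂ σ) ⧸ (LinearMap.range (b₃ σ)).comap (LinearMap.ker (b₂ σ)).subtype

instance (σ : A ≃ₐ[ℂ] A) : AddCommGroup (HH₂ σ) :=
  inferInstanceAs (AddCommGroup (_ ⧸ (LinearMap.range (b₃ σ)).comap (LinearMap.ker (b₂ σ)).subtype))

instance (σ : A ≃ₐ[ℂ] A) : Module ℂ (HH₂ σ) :=
  inferInstanceAs (Module ℂ (_ ⧸ (LinearMap.range (b₃ σ)).comap (LinearMap.ker (b₂ σ)).subtype))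

/-- Degenerate `1`-chains: the kernel of `A ⊗ A → A ⊗ (A/ℂ)`. -/
def degen₁ (A : Type*) [Ring A] [Algebra ℂ A] : Submodule ℂ (A ⊗[ℂ] A) :=
  Submodule.span ℂ {x | ∃ a : A, x = a ⊗ₜ 1}

/-- Degenerate `2`-chains: the kernel of `A ⊗ A ⊗ A → A ⊗ (A/ℂ) ⊗ (A/ℂ)`. -/
def degen₂ (A : Type*) [Ring A] [Algebra ℂ A] : Submodule ℂ (A ⊗[ℂ] (A ⊗[ℂ] A)) :=
  Submodule.span ℂ {x | ∃ a b : A, x = a ⊗ₜ (1 ⊗ₜ b) ∨ x = a ⊗ₜ (b ⊗ₜ 1)}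

/-- Chains representing cycles of the normalized Hochschild complex `A ⊗ (A/ℂ)^{⊗ n}`. -/
def normCycles (σ : A ≃ₐ[ℂ] A) : Submodule ℂ (A ⊗[ℂ] (A ⊗[ℂ] A)) := (degen₁ A).comap (b₂ σ)

/-- Chains representing boundaries of the normalized Hochschild complex. -/
def normBoundaries (σ : A ≃ₐ[ℂ] A) : Submodule ℂ (A ⊗[ℂ] (A ⊗[ℂ] A)) :=
  LinearMap.range (b₃ σ) ⊔ degen₂ A

/-- The second homology of the normalized Hochschild complex. -/
def NHH₂ (σ : A ≃ₐ[ℂ] A) : Type _ :=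
  normCycles σ ⧸ (normBoundaries σ).comap (normCycles σ).subtype

instance (σ : A ≃ₐ[ℂ] A) : AddCommGroup (NHH₂ σ) :=
  inferInstanceAs (AddCommGroup (_ ⧸ (normBoundaries σ).comap (normCycles σ).subtype))

instance (σ : A ≃ₐ[ℂ] A) : Module ℂ (NHH₂ σ) :=
  inferInstanceAs (Module ℂ (_ ⧸ (normBoundaries σ).comap (normCycles σ).subtype))

lemma mem_degen₁ {x : A ⊗[ℂ] A} (h : x ∈ degen₁ A) : ∃ a : A, x = a ⊗ₜ 1 := by
  induction h using Submodule.span_induction with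
  | zero => exact ⟨0, (TensorProduct.zero_tmul _ _).symm⟩
  | add x y _ _ hx hy =>
    obtain ⟨a, rfl⟩ := hx
    obtain ⟨b, rfl⟩ := hy
    exact ⟨a + b, (TensorProduct.add_tmul _ _ _).symm⟩
  | smul c x _ hx =>
    obtain ⟨a, rfl⟩ := hx
    exact ⟨c • a, TensorProduct.smul_tmul' _ _ _⟩
  | mem x hx => exact hx

lemma mem_degen₂ (σ : A ≃ₐ[ℂ] A) {x : A ⊗[ℂ] (A ⊗[ℂ] A)} (h : x ∈ degen₂ A) :
    ∃ a : A, x - a ⊗ₜ (1 ⊗ₜ 1) ∈ LinearMap.range (b₃ σ) := by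
  induction h using Submodule.span_induction with
  | zero => exact ⟨0, by simp⟩
  | add x y _ _ hx hy =>
    obtain ⟨a, ha⟩ := hx
    obtain ⟨b, hb⟩ := hy
    refine ⟨a + b, ?_⟩
    have := Submodule.add_mem _ ha hb
    rw [TensorProduct.add_tmul]
    convert this using 1
    abel
  | smul c x _ hx =>
    obtain ⟨a, ha⟩ := hx
    refine ⟨c • a, ?_⟩
    have := Submodule.smul_mem _ c ha
    rwa [smul_sub, TensorProduct.smul_tmul'] at this
  | mem x hx =>
    obtain ⟨a, b, rfl | rfl⟩ := hx
    · refine ⟨σ b * a, a ⊗ₜ (1 ⊗ₜ (1 ⊗ₜ b)), ?_⟩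
      rw [b₃_tmul]
      simp only [mul_one, one_mul]
      abel
    · refine ⟨a * b, -(a ⊗ₜ (b ⊗ₜ (1 ⊗ₜ 1))), ?_⟩
      rw [map_neg, b₃_tmul]
      simp only [mul_one, map_one, one_mul]
      abel

lemma b₂_degen (σ : A ≃ₐ[ℂ] A) (a : A) :
    b₂ σ (a ⊗ₜ[ℂ] ((1 : A) ⊗ₜ[ℂ] (1 : A))) = a ⊗ₜ 1 := by
  rw [b₂_tmul]; simp

/-- The comparison map from Hochschild homology to normalized Hochschild homology. -/
def toNormalized (σ : A ≃ₐ[ℂ] A) : HH₂ σ →ₗ[ℂ] NHH₂ σ :=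
  Submodule.mapQ _ _
    (Submodule.inclusion (show LinearMap.ker (b₂ σ) ≤ normCycles σ from fun x hx => by
      change b₂ σ x ∈ degen₁ A
      rw [LinearMap.mem_ker.mp hx]
      exact Submodule.zero_mem _))
    (fun _ hx => Submodule.mem_sup_left hx)

lemma toNormalized_bijective (σ : A ≃ₐ[ℂ] A) : Function.Bijective (toNormalized σ) := by
  constructor
  · rw [injective_iff_map_eq_zero]
    intro z hz
    obtain ⟨⟨x, hx⟩, rfl⟩ := Submodule.Quotient.mk_surjective _ z
    have hx' : b₂ σ x = 0 := hx
    have hz' : x ∈ normBoundaries σ := 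
      (Submodule.Quotient.mk_eq_zero ((normBoundaries σ).comap (normCycles σ).subtype)).mp hz
    refine (Submodule.Quotient.mk_eq_zero _).mpr ?_
    change x ∈ LinearMap.range (b₃ σ)
    obtain ⟨y, hy, d, hd, rfl⟩ := Submodule.mem_sup.mp hz'
    obtain ⟨a, ha⟩ := mem_degen₂ σ hd
    have hb : ∀ w ∈ LinearMap.range (b₃ σ), b₂ σ w = 0 := by
      rintro _ ⟨v, rfl⟩
      exact LinearMap.congr_fun (b₂_b₃ σ) v
    have h1 : (a : A) ⊗ₜ[ℂ] (1 : A) = 0 := by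
      have := hb _ ha
      rw [map_sub, b₂_degen] at this
      rw [map_add, hb y hy, zero_add] at hx'
      rw [hx', zero_sub, neg_eq_zero] at this
      exact this
    have h2 : a = 0 := by simpa using congrArg (LinearMap.mul' ℂ A) h1
    rw [h2, TensorProduct.zero_tmul, sub_zero] at ha
    exact Submodule.add_mem _ hy ha
  · intro z
    obtain ⟨⟨x, hx⟩, rfl⟩ := Submodule.Quotient.mk_surjective _ z
    obtain ⟨a, ha⟩ := mem_degen₁ (show b₂ σ x ∈ degen₁ A from hx)
    refine ⟨Submodule.Quotient.mk ⟨x - a ⊗ₜ (1 ⊗ₜ 1), ?_⟩, ?_⟩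
    · rw [LinearMap.mem_ker, map_sub, b₂_degen, ha, sub_self]
    · refine (Submodule.Quotient.eq _).mpr ?_
      change x - a ⊗ₜ (1 ⊗ₜ 1) - x ∈ normBoundaries σ
      rw [sub_sub_cancel_left]
      exact Submodule.neg_mem _ (Submodule.mem_sup_right (Submodule.subset_span ⟨a, 1, Or.inl rfl⟩))

/-- The Hochschild complex and its normalized version have the same second homology. -/
def normalizedEquiv (σ : A ≃ₐ[ℂ] A) : HH₂ σ ≃ₗ[ℂ] NHH₂ σ :=
  LinearEquiv.ofBijective (toNormalized σ) (toNormalized_bijective σ)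

/-- The class in `HH_2^σ(A)` of a chain which is a cycle in the normalized Hochschild complex. -/
def classOf (σ : A ≃ₐ[ℂ] A) (x : A ⊗[ℂ] (A ⊗[ℂ] A)) (hx : x ∈ normCycles σ) : HH₂ σ :=
  (normalizedEquiv σ).symm (Submodule.Quotient.mk ⟨x, hx⟩)

/-- A twisted Hochschild `2`-cocycle: a functional on `A^{⊗ 3}` vanishing on boundaries. -/
def IsCocycle (σ : A ≃ₐ[ℂ] A) (φ : A ⊗[ℂ] (A ⊗[ℂ] A) →ₗ[ℂ] ℂ) : Prop := φ ∘ₗ b₃ σ = 0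

/-- The pairing of a twisted `2`-cocycle with `HH_2^σ(A)`. -/
def pairing (σ : A ≃ₐ[ℂ] A) (φ : A ⊗[ℂ] (A ⊗[ℂ] A) →ₗ[ℂ] ℂ) (hφ : IsCocycle σ φ) :
    HH₂ σ →ₗ[ℂ] ℂ :=
  Submodule.liftQ _ (φ ∘ₗ (LinearMap.ker (b₂ σ)).subtype) (by
    rintro ⟨x, hx⟩ ⟨y, hy⟩
    change φ x = 0
    change b₃ σ y = x at hy
    rw [← hy]
    exact LinearMap.congr_fun hφ y)

/-- The chain `Tr(V (2P - 1) ⊗ P ⊗ P) = ∑ V^i_j (2 P^j_k - δ^j_k) ⊗ P^k_l ⊗ P^l_i` of a matrix `P`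
with entries in `A` and a scalar matrix `V`. -/
def traceChain {κ : Type*} [Fintype κ] [DecidableEq κ] (V : Matrix κ κ ℂ) (P : Matrix κ κ A) :
    A ⊗[ℂ] (A ⊗[ℂ] A) :=
  ∑ i, ∑ j, ∑ k, ∑ l, (V i j • (2 * P j k - (1 : Matrix κ κ A) j k)) ⊗ₜ (P k l ⊗ₜ P l i)

end

end Hochschild
end QFlag

namespace QFlag

open scoped TensorProduct

variable {ι : Type*} [Fintype ι]

section Cocycles
variable {D : QuantumDatum ι} {A : Type*} [Ring A] [Algebra ℂ A] (f : A →ₐ[ℂ] DualAlg D)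

/-- The functional `a ↦ ε(X ▷ a)` on an algebra `A` included in the dual of `U_q(𝔤)` by `f`. -/
def evalAct (X : Uq D) : A →ₗ[ℂ] ℂ where
  toFun a := dualCounit (lact X (f a))
  map_add' a b := by rw [map_add]; rfl
  map_smul' c a := by rw [map_smul]; rfl

/-- `η_{X,Y}(a_0 ⊗ a_1 ⊗ a_2) = ε(a_0) ε(X ▷ a_1) ε(Y ▷ a_2)`. -/
def etaXY (X Y : Uq D) : A ⊗[ℂ] (A ⊗[ℂ] A) →ₗ[ℂ] ℂ :=
  LinearMap.mul' ℂ ℂ ∘ₗ TensorProduct.map (evalAct f 1)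
    (LinearMap.mul' ℂ ℂ ∘ₗ TensorProduct.map (evalAct f X) (evalAct f Y))

lemma etaXY_tmul (X Y : Uq D) (a₀ a₁ a₂ : A) :
    etaXY f X Y (a₀ ⊗ₜ (a₁ ⊗ₜ a₂)) =
      dualCounit (f a₀) * (dualCounit (lact X (f a₁)) * dualCounit (lact Y (f a₂))) := by
  change dualCounit (lact 1 (f a₀)) * _ = _
  congr 1
  change f a₀ (1 * 1) = f a₀ 1
  rw [one_mul]

/-- `η_a(a_0 ⊗ a_1 ⊗ a_2) = ε(a_0) ε(F_a ▷ a_1) ε(E_a ▷ a_2)`. -/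
def eta (a : ι) : A ⊗[ℂ] (A ⊗[ℂ] A) →ₗ[ℂ] ℂ := etaXY f (Uq.F D a) (Uq.E D a)

end Cocycles

/-- The irreducible representation `V(Λ)` of `U_q(𝔤)`, written in an orthonormal basis of weight
vectors: a nonzero irreducible finite-dimensional representation (of type 1) by matrices such that
`π(X^*)` is the conjugate transpose of `π(X)`. -/
structure UnitaryIrrep (D : QuantumDatum ι) (κ : Type) [Fintype κ] [DecidableEq κ]
    extends WeightRep D κ where
  nonempty : Nonempty κ
  irreducible : ∀ W : Submodule ℂ (κ → ℂ),
    (∀ X : Uq D, ∀ w ∈ W, (π X).mulVec w ∈ W) → W = ⊥ ∨ W = ⊤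
  unitary : ∀ X : Uq D, π (Uq.starMap D X) = (π X).conjTranspose

namespace UnitaryIrrep

variable {D : QuantumDatum ι} {κ : Type} [Fintype κ] [DecidableEq κ] (V : UnitaryIrrep D κ)

/-- The matrix unit `𝖬^n_m`, with entries `(𝖬^n_m)^i_j = u^{m*}_i u^n_j`. -/
def M (m n : κ) : Matrix κ κ (DualAlg D) :=
  Matrix.of fun i j => dualStar (V.coef m i) * V.coef n j

/-- The matrix unit `𝖭^n_m`, with entries `(𝖭^n_m)^i_j = u^i_m u^{j*}_n`. -/
def N (m n : κ) : Matrix κ κ (DualAlg D) :=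
  Matrix.of fun i j => V.coef i m * dualStar (V.coef j n)

/-- `𝖯 = ∑ c^m_n 𝖬^n_m`, where `c^m_n` is `c m n`. -/
def P (c : Matrix κ κ ℂ) : Matrix κ κ (DualAlg D) := ∑ m, ∑ n, c m n • V.M m n

/-- `𝖰 = ∑ c^m_n 𝖭^n_m`, where `c^m_n` is `c m n`. -/
def Q (c : Matrix κ κ ℂ) : Matrix κ κ (DualAlg D) := ∑ m, ∑ n, c m n • V.N m n

/-- `(α_a, λ_i) = d_a ⟨λ_i, α_a^∨⟩`. -/
def pairRoot (a : ι) (i : κ) : ℝ := D.d a * V.wt i a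

/-- `(2ρ, λ_i)`. -/
def pairTwoRho (i : κ) : ℝ := ∑ j, D.twoRho j * V.pairRoot j i

/-- The quantum number `[x]_p = (p^x - p^{-x}) / (p - p⁻¹)` for real `p > 0`. -/
def qNum (p x : ℝ) : ℝ := (p ^ x - p ^ (-x)) / (p - p⁻¹)

/-- `χ_a(𝖯) = ∑ c^i_i q^{(α_a - 2ρ, λ_i)} [d_a⁻¹ (α_a, λ_i)]_{q_a}`. -/
def chi (c : Matrix κ κ ℂ) (a : ι) : ℂ :=
  ∑ i, c i i * ((D.q ^ (V.pairRoot a i - V.pairTwoRho i) *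
    qNum (D.q ^ D.d a) ((D.d a)⁻¹ * V.pairRoot a i) : ℝ) : ℂ)

/-- `χ̃_a(𝖰) = ∑ c^i_i q^{-(α_a - 2ρ, λ_i)} [d_a⁻¹ (α_a, λ_i)]_{q_a}`. -/
def chiTilde (c : Matrix κ κ ℂ) (a : ι) : ℂ :=
  ∑ i, c i i * ((D.q ^ (-(V.pairRoot a i - V.pairTwoRho i)) *
    qNum (D.q ^ D.d a) ((D.d a)⁻¹ * V.pairRoot a i) : ℝ) : ℂ)

end UnitaryIrrep
end QFlag

namespace QFlag

section RootSystem
variable {I K M N : Type*} [Field K] [CharZero K] [AddCommGroup M] [Module K M] [AddCommGroup N]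
  [Module K N] [Fintype I]

open scoped Classical in
/-- The simple reflection `s_j` permutes the positive roots different from `α_j`; hence
`⟨2ρ, α_j^∨⟩ = 2`. -/
lemma sum_pos_pairing {P : RootPairing I K M N} [P.IsCrystallographic] [P.IsReduced]
    (b : P.Base) {j : I} (hj : j ∈ b.support) :
    ∑ β ∈ Finset.univ.filter (fun β => b.IsPos β), P.pairingIn ℤ β j = 2 := by
  have hmem : j ∈ Finset.univ.filter (fun β => b.IsPos β) := by
    simpa using RootPairing.Base.isPos_of_mem_support hj
  rw [← Finset.add_sum_erase _ _ hmem, RootPairing.pairingIn_same]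
  have h0 : ∑ β ∈ (Finset.univ.filter (fun β => b.IsPos β)).erase j, P.pairingIn ℤ β j =
      ∑ β ∈ (Finset.univ.filter (fun β => b.IsPos β)).erase j, -P.pairingIn ℤ β j := by
    refine Finset.sum_nbij' (P.reflectionPerm j) (P.reflectionPerm j) ?_ ?_ ?_ ?_ ?_
    all_goals intro β hβ
    any_goals
      rw [Finset.mem_erase, Finset.mem_filter] at hβ ⊢
      have hp := hβ.2.2.reflectionPerm hj hβ.1
      refine ⟨fun h => ?_, Finset.mem_univ _, hp⟩
      have h2 : P.root β = - P.root j := by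
        rw [← P.reflectionPerm_self j β, P.root_reflectionPerm, h, P.reflection_apply_self]
      have h3 := RootPairing.Base.IsPos.neg_iff_not b j
      have h4 : β = P.reflectionPerm j j := P.root.injective (by
        rw [h2, P.root_reflectionPerm, P.reflection_apply_self])
      rw [h4] at hβ
      exact h3.mp hβ.2.2 (RootPairing.Base.isPos_of_mem_support hj)
    · simp
    · simp
    · rw [← P.pairingIn_reflectionPerm ℤ, P.pairingIn_reflectionPerm_self_right, neg_neg]
  rw [Finset.sum_neg_distrib] at h0
  omega

end RootSystem

section OfLie
variable {𝔤 : Type*} [LieRing 𝔤] [LieAlgebra ℂ 𝔤] [FiniteDimensional ℂ 𝔤] [LieAlgebra.IsSimple ℂ 𝔤]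
  (H : LieSubalgebra ℂ 𝔤) [H.IsCartanSubalgebra]

open LieAlgebra.IsKilling

/-- The squared length `(α, α)` of a root, for the form on `𝔥^*` induced by the Killing form.
It is a positive real number. -/
def killingLength (α : H.root) : ℝ := (α.1 ((cartanEquivDual H).symm α.1)).re

lemma killingLength_aux (α : H.root) : ∃ n : ℕ, 0 < n ∧
    2 • (α.1 ((cartanEquivDual H).symm α.1))⁻¹ • (2 : ℂ) = n := by
  have h1 := traceForm_coroot α.1 (coroot α.1)
  rw [root_apply_coroot (by
    have := α.2
    exact (Finset.mem_filter.mp this).2)] at h1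
  have h2 : LieModule.traceForm ℂ H 𝔤 (coroot α.1) (coroot α.1) =
      (rootSystem H).CorootForm (coroot α.1) (coroot α.1) := by
    rw [corootForm_rootSystem_eq_killing]; rfl
  rw [← h1, h2, RootPairing.corootForm_apply_apply]
  have h3 : ∀ β : H.root, (rootSystem H).root' β (coroot α.1) =
      (((rootSystem H).pairingIn ℤ β α : ℤ) : ℂ) := fun β =>
    ((rootSystem H).algebraMap_pairingIn ℤ β α).symm
  refine ⟨∑ β : H.root, ((rootSystem H).pairingIn ℤ β α).natAbs ^ 2, ?_, ?_⟩
  · refine Finset.sum_pos' (fun _ _ => Nat.zero_le _) ⟨α, Finset.mem_univ _, ?_⟩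
    rw [RootPairing.pairingIn_same]
    norm_num
  · rw [Nat.cast_sum]
    refine Finset.sum_congr rfl fun β _ => ?_
    rw [h3, ← sq, Nat.cast_pow]
    have h4 : ((((rootSystem H).pairingIn ℤ β α).natAbs : ℤ)) ^ 2 =
        (rootSystem H).pairingIn ℤ β α ^ 2 := Int.natAbs_sq _
    have h5 := congrArg (Int.cast : ℤ → ℂ) h4.symm
    rw [Int.cast_pow, Int.cast_pow, Int.cast_natCast] at h5
    exact h5

lemma killingLength_eq (α : H.root) :
    0 < killingLength H α ∧ α.1 ((cartanEquivDual H).symm α.1) = killingLength H α := by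
  obtain ⟨n, hn, h⟩ := killingLength_aux H α
  have hn' : (n : ℂ) ≠ 0 := by exact_mod_cast hn.ne'
  have h1 : α.1 ((cartanEquivDual H).symm α.1) = ((4 / n : ℝ) : ℂ) := by
    have h2 : α.1 ((cartanEquivDual H).symm α.1) ≠ 0 := fun h0 => hn' (by
      rw [← h, h0]; simp)
    rw [nsmul_eq_mul, smul_eq_mul] at h
    push_cast at h ⊢
    field_simp at h ⊢
    linear_combination -h
  have h3 : killingLength H α = 4 / n := by rw [killingLength, h1, Complex.ofReal_re]
  refine ⟨?_, by rw [h1, h3]⟩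
  rw [h3]
  positivity

/-- The form normalized so that short roots have squared length `2`: this is `(α, α) / 2`. -/
def halfLength (α : H.root) : ℝ := killingLength H α / ⨅ β, killingLength H β

lemma halfLength_pos (α : H.root) : 0 < halfLength H α := by
  refine div_pos (killingLength_eq H α).1 ?_
  have : Nonempty H.root := ⟨α⟩
  obtain ⟨β, hβ⟩ := exists_eq_ciInf_of_finite (f := killingLength H)
  rw [← hβ]
  exact (killingLength_eq H β).1

lemma halfLength_symm (α β : H.root) :
    halfLength H α * ((rootSystem H).pairingIn ℤ β α : ℤ) =
      halfLength H β * ((rootSystem H).pairingIn ℤ α β : ℤ) := by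
  have key : ∀ α β : H.root, (((rootSystem H).pairingIn ℤ β α : ℤ) : ℂ) = β.1 (coroot α.1) :=
    fun α β => (rootSystem H).algebraMap_pairingIn ℤ β α
  have h1 := traceForm_coroot α.1 (coroot β.1)
  have h2 := traceForm_coroot β.1 (coroot α.1)
  rw [LieModule.traceForm_comm, h2, (killingLength_eq H α).2, (killingLength_eq H β).2, ← key,
    ← key] at h1
  have hα := (killingLength_eq H α).1.ne'
  have hβ := (killingLength_eq H β).1.ne'
  rw [nsmul_eq_mul, smul_eq_mul, nsmul_eq_mul, smul_eq_mul] at h1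
  have h3 : (killingLength H β)⁻¹ * ((rootSystem H).pairingIn ℤ β α : ℤ) =
      (killingLength H α)⁻¹ * ((rootSystem H).pairingIn ℤ α β : ℤ) := by
    have := mul_left_cancel₀ (by norm_num) h1
    exact_mod_cast this
  unfold halfLength
  field_simp at h3
  rw [div_mul_eq_mul_div, div_mul_eq_mul_div]
  congr 1
  linear_combination h3

variable (b : (rootSystem H).Base)

open scoped Classical in
/-- The coordinates of `2ρ = ∑_{β > 0} β` in the basis of simple roots. -/
def twoRhoCoord (j : b.support) : ℤ :=
  ∑ β ∈ Finset.univ.filter (fun β => b.IsPos β),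
    b.toWeightBasisInt.repr ((rootSystem H).rootSpanMem ℤ β) j

lemma twoRhoCoord_spec (i : b.support) :
    ∑ j : b.support, (rootSystem H).pairingIn ℤ j i * twoRhoCoord H b j = 2 := by
  classical
  rw [← sum_pos_pairing b i.2]
  unfold twoRhoCoord
  simp only [Finset.mul_sum]
  rw [Finset.sum_comm]
  refine Finset.sum_congr (by congr!) fun β _ => ?_
  have h := congrArg Subtype.val (b.toWeightBasisInt.sum_repr ((rootSystem H).rootSpanMem ℤ β))
  rw [Submodule.coe_sum] at h
  have h' := congrArg ((rootSystem H).coroot' i) h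
  rw [map_sum] at h'
  apply (algebraMap ℤ ℂ).injective_int
  rw [RootPairing.algebraMap_pairingIn, map_sum]
  refine Eq.trans (Finset.sum_congr rfl fun j _ => ?_) h'
  rw [Submodule.coe_smul, map_zsmul, RootPairing.Base.coe_toWeightBasisInt_apply, map_mul,
    RootPairing.algebraMap_pairingIn, zsmul_eq_mul, mul_comm]
  rfl

/-- The datum defining `U_q(𝔤)`, for a simple Lie algebra `𝔤` with Cartan subalgebra `𝔥` and simple
roots `α_i`: `a_{ij} = ⟨α_j, α_i^∨⟩` and `d_i = (α_i, α_i) / 2`. -/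
def QuantumDatum.ofLie (q : ℝ) (hq : 0 < q) (hq1 : q ≠ 1) : QuantumDatum b.support where
  q := q
  q_pos := hq
  q_ne_one := hq1
  cartan i j := (rootSystem H).pairingIn ℤ j i
  d i := halfLength H i
  d_pos i := halfLength_pos H i
  cartan_diag _ := RootPairing.pairingIn_same _ _ _
  cartan_offdiag i j h := RootPairing.Base.cartanMatrix_le_zero_of_ne b j i h.symm
  cartan_symm i j := halfLength_symm H i j
  twoRho := twoRhoCoord H b
  twoRho_spec := twoRhoCoord_spec H b

end OfLie
end QFlag

end

/-! The matrices `𝖯` and `𝖰` are best read as functions on `U_q(𝔤)`. Unitarity turns `u^{m*}_i` into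
a coefficient of the dual representation, so that `𝖯(X) = π(S(X_(1))) c π(X_(2))` and `𝖰(X) =
π(X_(1)) c π(S(X_(2)))` (`P_apply`, `Q_apply`). Everything else is obtained by evaluating these
formulas. Write `V` for `π(K_{2ρ}⁻¹)` in the case of `𝖯` and for `π(K_{2ρ})` in the case of `𝖰`.

Cycle. Since `c` preserves weights it commutes with `π(K_λ)`, hence `𝖯` is invariant under `◁ K_λ`.
One factor `K_{2ρ}` of the twist is thereby absorbed, the other conjugates, and `θ(𝖯) V = V 𝖯`. From
`S² = Ad K_{2ρ}` and the antipode axiom, the quantum trace `Tr(V 𝖯)` is a scalar. For any idempotent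
with these two properties the three faces of `Tr(V(2𝖯 - 1) ⊗ 𝖯 ⊗ 𝖯)` add up to `Tr(V ⊗ 𝖯) = 1 ⊗ Tr(V
𝖯)`, which is degenerate (`traceChain_mem_normCycles`).

Cocycle. On torus-invariant functions `K_a^{±1}` evaluate as the counit, so evaluations at `E_a` and
`F_a` are derivations over `ε`, and `ε ∘ θ = ε`. Thus `η_a`, the product of `ε` and two
`ε`-derivations, is a twisted cocycle (`isCocycle_eta`). Derivations kill constants, so `η_a`
vanishes on degenerate chains and its pairing with the class is its value on the chain itself
(`pairing_classOf`).

Value. `η_a` evaluates the three tensor factors at `1`, `F_a`, `E_a`. There `𝖯` takes the values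
`c`, `π(K_a)[c, π(F_a)]` and `[c, π(E_a)]`, so the pairing is `Tr(W(2c - 1)[c, F][c, E])` with `W =
π(K_{α_a - 2ρ})`. Because `(α_a - 2ρ, α_a) = 0`, `W` commutes with `π(E_a)`, and for idempotent `c`
the trace collapses to `Tr(W c [E, F])` (`trace_idempotent_commutators`). Both `W` and `[E, F]` are
diagonal, with entries `q^{(α_a - 2ρ, λ_i)}` and quantum numbers; this is `χ_a`. For `𝖰` the sides
are exchanged and `W` is replaced by its inverse. -/

noncomputable section
namespace QFlag

open scoped TensorProduct

variable {ι : Type*} [Fintype ι]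

namespace Uq

/-! ### The antipode axioms -/

section Antipode
variable {D : QuantumDatum ι}

/-- Induction on elements of `U_q(𝔤)`. -/
lemma induction {p : Uq D → Prop} (hc : ∀ c : ℂ, p (algebraMap ℂ _ c))
    (hE : ∀ i, p (E D i)) (hF : ∀ i, p (F D i)) (hK : ∀ i, p (K D i)) (hL : ∀ i, p (Kinv D i))
    (hmul : ∀ x y, p x → p y → p (x * y)) (hadd : ∀ x y, p x → p y → p (x + y)) (x : Uq D) :
    p x := by
  obtain ⟨x, rfl⟩ := RingQuot.mkAlgHom_surjective ℂ (Rel D) x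
  change p (mk D x)
  induction x using FreeAlgebra.induction with
  | grade0 r => rw [AlgHom.commutes]; exact hc r
  | grade1 x =>
    cases x with
    | E i => exact hE i
    | F i => exact hF i
    | K i => exact hK i
    | Kinv i => exact hL i
  | mul a b ha hb => rw [map_mul]; exact hmul _ _ ha hb
  | add a b ha hb => rw [map_add]; exact hadd _ _ ha hb

lemma antipode_mul (x y : Uq D) : antipode D (x * y) = antipode D y * antipode D x := by
  simp only [antipode, map_mul, MulOpposite.unop_mul]

lemma antipode_add (x y : Uq D) : antipode D (x + y) = antipode D x + antipode D y := by
  simp only [antipode, map_add, MulOpposite.unop_add]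

lemma antipode_algebraMap (c : ℂ) : antipode D (algebraMap ℂ _ c) = algebraMap ℂ _ c := by
  rw [antipode, AlgHom.commutes]; rfl

lemma antipode_one : antipode D 1 = 1 := by
  simp only [antipode, map_one, MulOpposite.unop_one]

lemma antipode_E (i : ι) : antipode D (E D i) = -(E D i * Kinv D i) := by
  rw [antipode, antipodeHom, lift_E]; rfl

lemma antipode_F (i : ι) : antipode D (F D i) = -(K D i * F D i) := by
  rw [antipode, antipodeHom, lift_F]; rfl

lemma antipode_K (i : ι) : antipode D (K D i) = Kinv D i := by
  rw [antipode, antipodeHom, lift_K]; rfl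

lemma antipode_Kinv (i : ι) : antipode D (Kinv D i) = K D i := by
  rw [antipode, antipodeHom, lift_Kinv]; rfl

lemma comul_E (i : ι) :
    Coalgebra.comul (R := ℂ) (E D i) = E D i ⊗ₜ[ℂ] K D i + 1 ⊗ₜ E D i := lift_E _ i

lemma comul_F (i : ι) :
    Coalgebra.comul (R := ℂ) (F D i) = F D i ⊗ₜ[ℂ] 1 + Kinv D i ⊗ₜ F D i := lift_F _ i

lemma comul_K (i : ι) : Coalgebra.comul (R := ℂ) (K D i) = K D i ⊗ₜ[ℂ] K D i := lift_K _ i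

lemma comul_Kinv (i : ι) :
    Coalgebra.comul (R := ℂ) (Kinv D i) = Kinv D i ⊗ₜ[ℂ] Kinv D i := lift_Kinv _ i

lemma counit_E (i : ι) : Coalgebra.counit (R := ℂ) (E D i) = 0 := lift_E _ i
lemma counit_F (i : ι) : Coalgebra.counit (R := ℂ) (F D i) = 0 := lift_F _ i
lemma counit_K (i : ι) : Coalgebra.counit (R := ℂ) (K D i) = 1 := lift_K _ i
lemma counit_Kinv (i : ι) : Coalgebra.counit (R := ℂ) (Kinv D i) = 1 := lift_Kinv _ i

variable (D) in
/-- The antipode as a linear map. -/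
def antipodeLin : Uq D →ₗ[ℂ] Uq D :=
  (MulOpposite.opLinearEquiv ℂ).symm.toLinearMap ∘ₗ (antipodeHom D).toLinearMap

variable (D) in
/-- The map `x ⊗ y ↦ x S(y)`. -/
def mulAntipode : Uq D ⊗[ℂ] Uq D →ₗ[ℂ] Uq D :=
  LinearMap.mul' ℂ _ ∘ₗ (antipodeLin D).lTensor _

variable (D) in
/-- The map `x ⊗ y ↦ S(x) y`. -/
def antipodeMul : Uq D ⊗[ℂ] Uq D →ₗ[ℂ] Uq D :=
  LinearMap.mul' ℂ _ ∘ₗ (antipodeLin D).rTensor _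

lemma mulAntipode_tmul (x y : Uq D) : mulAntipode D (x ⊗ₜ y) = x * antipode D y := rfl

lemma antipodeMul_tmul (x y : Uq D) : antipodeMul D (x ⊗ₜ y) = antipode D x * y := rfl

/-- Since `S` reverses products, `(x ⊗ y)(a ⊗ b)` goes to `x (a S(b)) S(y)`, with the contribution
of `t` enclosed in the middle; a central value can be pulled out. This makes the antipode axiom
stable under products, so that it need only be checked on generators. -/
lemma mulAntipode_mul {t : Uq D ⊗[ℂ] Uq D} {c : ℂ} (ht : mulAntipode D t = algebraMap ℂ _ c)
    (s : Uq D ⊗[ℂ] Uq D) : mulAntipode D (s * t) = c • mulAntipode D s := by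
  have key : ∀ x y, mulAntipode D ((x ⊗ₜ y) * t) = x * mulAntipode D t * antipode D y := by
    intro x y
    clear ht
    induction t using TensorProduct.induction_on with
    | zero => simp
    | add a b ha hb => rw [mul_add, map_add, ha, hb, map_add, mul_add, add_mul]
    | tmul a b =>
      rw [Algebra.TensorProduct.tmul_mul_tmul, mulAntipode_tmul, mulAntipode_tmul, antipode_mul]
      simp only [mul_assoc]
  induction s using TensorProduct.induction_on with
  | zero => simp
  | add a b ha hb => rw [add_mul, map_add, ha, hb, map_add, smul_add]
  | tmul x y =>
    rw [key, ht, mulAntipode_tmul, ← Algebra.commutes, mul_assoc, Algebra.smul_def]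

/-- The mirror image: `(a ⊗ b)(x ⊗ y)` goes to `S(x) (S(a) b) y`, so here it is the left factor
whose value sits in the middle. -/
lemma antipodeMul_mul {s : Uq D ⊗[ℂ] Uq D} {c : ℂ} (hs : antipodeMul D s = algebraMap ℂ _ c)
    (t : Uq D ⊗[ℂ] Uq D) : antipodeMul D (s * t) = c • antipodeMul D t := by
  have key : ∀ x y, antipodeMul D (s * (x ⊗ₜ y)) = antipode D x * antipodeMul D s * y := by
    intro x y
    clear hs
    induction s using TensorProduct.induction_on with
    | zero => simp
    | add a b ha hb => rw [add_mul, map_add, ha, hb, map_add, mul_add, add_mul]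
    | tmul a b =>
      rw [Algebra.TensorProduct.tmul_mul_tmul, antipodeMul_tmul, antipodeMul_tmul, antipode_mul]
      simp only [mul_assoc]
  induction t using TensorProduct.induction_on with
  | zero => simp
  | add a b ha hb => rw [mul_add, map_add, ha, hb, map_add, smul_add]
  | tmul x y =>
    rw [key, hs, antipodeMul_tmul, ← Algebra.commutes, mul_assoc, Algebra.smul_def]

/-- `X_(1) S(X_(2)) = ε(X)`. -/
lemma mulAntipode_comul (x : Uq D) : mulAntipode D (Coalgebra.comul (R := ℂ) x) =
    algebraMap ℂ _ (Coalgebra.counit (R := ℂ) x) := by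
  have h := qrel D
  induction x using Uq.induction with
  | hc c =>
    rw [Bialgebra.comul_algebraMap, Bialgebra.counit_algebraMap,
      Algebra.TensorProduct.algebraMap_apply, mulAntipode_tmul, antipode_one, mul_one]
  | hE i =>
    rw [comul_E, counit_E, map_add, mulAntipode_tmul, mulAntipode_tmul, antipode_K, antipode_E]
    simp
  | hF i =>
    rw [comul_F, counit_F, map_add, mulAntipode_tmul, mulAntipode_tmul, antipode_one, antipode_F,
      mul_neg, ← mul_assoc, h.LK]
    simp
  | hK i => rw [comul_K, counit_K, mulAntipode_tmul, antipode_K, h.KL, map_one]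
  | hL i => rw [comul_Kinv, counit_Kinv, mulAntipode_tmul, antipode_Kinv, h.LK, map_one]
  | hmul x y hx hy =>
    rw [Bialgebra.comul_mul, mulAntipode_mul hy, hx, Bialgebra.counit_mul, map_mul,
      Algebra.smul_def, Algebra.commutes]
  | hadd x y hx hy => simp only [map_add, hx, hy]

/-- `S(X_(1)) X_(2) = ε(X)`. -/
lemma antipodeMul_comul (x : Uq D) : antipodeMul D (Coalgebra.comul (R := ℂ) x) =
    algebraMap ℂ _ (Coalgebra.counit (R := ℂ) x) := by
  have h := qrel D
  induction x using Uq.induction with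
  | hc c =>
    rw [Bialgebra.comul_algebraMap, Bialgebra.counit_algebraMap,
      Algebra.TensorProduct.algebraMap_apply, antipodeMul_tmul, antipode_algebraMap, mul_one]
  | hE i =>
    rw [comul_E, counit_E, map_add, antipodeMul_tmul, antipodeMul_tmul, antipode_one, antipode_E,
      neg_mul, mul_assoc, h.LK]
    simp
  | hF i =>
    rw [comul_F, counit_F, map_add, antipodeMul_tmul, antipodeMul_tmul, antipode_Kinv, antipode_F]
    simp
  | hK i => rw [comul_K, counit_K, antipodeMul_tmul, antipode_K, h.LK, map_one]
  | hL i => rw [comul_Kinv, counit_Kinv, antipodeMul_tmul, antipode_Kinv, h.KL, map_one]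
  | hmul x y hx hy =>
    rw [Bialgebra.comul_mul, antipodeMul_mul hx, hy, Bialgebra.counit_mul, map_mul,
      Algebra.smul_def]
  | hadd x y hx hy => simp only [map_add, hx, hy]

end Antipode

/-! ### The elements `K_λ` and the square of the antipode -/

section Kpow
variable (D : QuantumDatum ι)

open scoped Classical in
-- The exponents satisfying `p` form an additive subgroup of the root lattice that contains the
-- simple roots.
lemma Kpow_induction {p : (ι → ℤ) → Prop} (h0 : p 0) (hadd : ∀ m n, p m → p n → p (m + n))
    (hneg : ∀ n, p n → p (-n)) (hsingle : ∀ j, p (Pi.single j 1)) (n : ι → ℤ) : p n := by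
  let S : AddSubgroup (ι → ℤ) :=
    { carrier := {n | p n}, zero_mem' := h0, add_mem' := hadd _ _, neg_mem' := hneg _ }
  change n ∈ S
  rw [pi_eq_sum_univ' n]
  refine S.sum_mem fun j _ => S.zsmul_mem ?_ _
  exact hsingle j

open scoped Classical in
lemma Kpow_single (j : ι) : Kpow D (Pi.single j 1) = K D j := by
  have : (fun i => Multiplicative.ofAdd ((Pi.single j 1 : ι → ℤ) i)) =
      Pi.mulSingle j (Multiplicative.ofAdd 1) := by
    funext i
    rcases eq_or_ne i j with rfl | h
    · simp
    · simp [h]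
  rw [Kpow, this, KHom, MonoidHom.noncommPiCoprod_mulSingle]
  simp [Kunit]

/-- `K_λ` commutes up to a scalar with an element on which the `K_j` act by scalars. -/
lemma Kpow_mul_of_weight {x : Uq D} {c : ι → ℂ} (hc : ∀ j, c j ≠ 0)
    (hx : ∀ j, K D j * x = c j • (x * K D j)) (n : ι → ℤ) :
    Kpow D n * x = (∏ j, c j ^ n j) • (x * Kpow D n) := by
  induction n using Kpow_induction with
  | h0 => simp [Kpow_zero]
  | hadd m n hm hn =>
    rw [Kpow_add, mul_assoc, hn, mul_smul_comm, ← mul_assoc, hm, smul_mul_assoc, smul_smul,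
      mul_assoc, mul_comm (∏ j, c j ^ n j), ← Finset.prod_mul_distrib]
    congr 1
    exact Finset.prod_congr rfl fun j _ => (zpow_add₀ (hc j) _ _).symm
  | hneg n hn =>
    have h0 : ∏ j, c j ^ n j ≠ 0 := Finset.prod_ne_zero_iff.mpr fun j _ => zpow_ne_zero _ (hc j)
    have e : ∏ j, c j ^ (-n) j = (∏ j, c j ^ n j)⁻¹ := by simp
    have h1 := congrArg (fun z => Kpow D (-n) * z * Kpow D (-n)) hn
    simp only [mul_smul_comm, smul_mul_assoc] at h1
    rw [← mul_assoc, Kpow_neg_mul, one_mul, mul_assoc, mul_assoc x, Kpow_mul_neg, mul_one] at h1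
    rw [e, h1, smul_smul, inv_mul_cancel₀ h0, one_smul]
  | hsingle j =>
    rw [Kpow_single, hx, Finset.prod_eq_single j]
    · simp
    · intro k _ hk; simp [hk]
    · simp

/-- The relation between `K_j` and `E_i` carries `q_j^{a_{ji}}`; symmetrizability rewrites it as
`q_i^{a_{ij}}`. The whole factor `q^{(λ, α_i)}` is then a power of the single base `q_i`, which is
what `prod_twoRho` can evaluate. -/
lemma Kpow_mul_E (n : ι → ℤ) (i : ι) :
    Kpow D n * E D i = (∏ j, (D.qi i ^ D.cartan i j) ^ n j) • (E D i * Kpow D n) :=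
  Kpow_mul_of_weight D (fun _ => QRel.qne D i _)
    (fun j => by rw [(qrel D).K_E, D.qi_zpow_symm]) n

lemma Kpow_mul_F (n : ι → ℤ) (i : ι) :
    Kpow D n * F D i = (∏ j, (D.qi i ^ D.cartan i j) ^ n j)⁻¹ • (F D i * Kpow D n) := by
  rw [Kpow_mul_of_weight D (fun _ => inv_ne_zero (QRel.qne D i _))
    (fun j => by rw [(qrel D).K_F, D.qi_zpow_symm]) n]
  simp

/-- This is `q^{(2ρ, α_i)} = q^{(α_i, α_i)}`, a consequence of `⟨2ρ, α_i^∨⟩ = 2`. -/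
lemma prod_twoRho (i : ι) : ∏ j, (D.qi i ^ D.cartan i j) ^ D.twoRho j = D.qi i ^ 2 := by
  simp only [← zpow_mul]
  rw [← zpow_natCast, Nat.cast_two, ← D.twoRho_spec i]
  -- After the `2` in the exponent is replaced by the sum, the claim is that a power of a sum is a
  -- product of powers; this holds over every finite index set and is proved by induction on it.
  generalize (Finset.univ : Finset ι) = s
  classical
  induction s using Finset.induction_on with
  | empty => simp
  | insert a s ha ih => rw [Finset.prod_insert ha, Finset.sum_insert ha, zpow_add₀ (D.qi_ne i), ih]

lemma Kpow_comm_K (n : ι → ℤ) (i : ι) : Kpow D n * K D i = K D i * Kpow D n := by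
  simpa using Kpow_mul_of_weight D (x := K D i) (c := fun _ => 1) (by simp)
    (fun j => by rw [one_smul, (qrel D).KK]) n

lemma Kpow_comm_Kinv (n : ι → ℤ) (i : ι) : Kpow D n * Kinv D i = Kinv D i * Kpow D n := by
  simpa using Kpow_mul_of_weight D (x := Kinv D i) (c := fun _ => 1) (by simp)
    (fun j => by rw [one_smul, (qrel D).KL_comm]) n

/-- The square of the antipode is conjugation by `K_{2ρ}`. -/
lemma antipode_antipode_mul (x : Uq D) :
    antipode D (antipode D x) * Kpow D D.twoRho = Kpow D D.twoRho * x := by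
  have h := qrel D
  have neg : ∀ y : Uq D, antipode D (-y) = -antipode D y := fun y =>
    map_neg (antipodeLin D) y
  induction x using Uq.induction with
  | hc c => rw [antipode_algebraMap, antipode_algebraMap, Algebra.commutes]
  | hE i =>
    rw [antipode_E, neg, antipode_mul, antipode_Kinv, antipode_E, mul_neg, neg_neg, ← mul_assoc,
      -- On `E_i` the square of the antipode is conjugation by `K_i`, with factor `q_i^{a_{ii}} =
      -- q_i²`; conjugation by `K_{2ρ}` gives the same factor.
      h.KE, QRel.qi_self, Kpow_mul_E, prod_twoRho, smul_mul_assoc]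
  | hF i =>
    rw [antipode_F, neg, antipode_mul, antipode_K, antipode_F, neg_mul,
      neg_mul, neg_mul, neg_neg, h.KF, zpow_neg, QRel.qi_self, Kpow_mul_F, prod_twoRho, smul_mul_assoc]
  | hK i => rw [antipode_K, antipode_Kinv, Kpow_comm_K]
  | hL i => rw [antipode_Kinv, antipode_K, Kpow_comm_Kinv]
  | hmul x y hx hy =>
    rw [antipode_mul, antipode_mul, mul_assoc, hy, ← mul_assoc, hx, mul_assoc]
  | hadd x y hx hy => rw [antipode_add, antipode_add, add_mul, mul_add, hx, hy]

/-- For a group-like element the axiom `X_(1) S(X_(2)) = ε(X)` says that `S` gives a right inverse.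
-/
lemma antipode_Kpow (n : ι → ℤ) : antipode D (Kpow D n) = Kpow D (-n) := by
  have h := mulAntipode_comul (Kpow D n)
  rw [comul_Kpow, counit_Kpow, mulAntipode_tmul, map_one] at h
  rw [← one_mul (antipode D _), ← Kpow_neg_mul D n, mul_assoc, h, mul_one]

end Kpow
end Uq

/-! ### Representations in a weight basis and their duals -/

namespace WeightRep

variable {D : QuantumDatum ι} {κ : Type} [Fintype κ] [DecidableEq κ] (V : WeightRep D κ)

lemma π_Kinv (j : ι) : V.π (Uq.Kinv D j) = Matrix.diagonal fun k => (D.qi j ^ V.wt k j)⁻¹ := by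
  have h1 : V.π (Uq.K D j) * V.π (Uq.Kinv D j) = 1 := by
    rw [← map_mul, (Uq.qrel D).KL, map_one]
  have h2 : (Matrix.diagonal fun k => (D.qi j ^ V.wt k j)⁻¹) * V.π (Uq.K D j) = 1 := by
    rw [V.π_K, Matrix.diagonal_mul_diagonal, ← Matrix.diagonal_one]
    congr 1
    funext k
    exact inv_mul_cancel₀ (QRel.qne D j _)
  rw [← one_mul (V.π _), ← h2, mul_assoc, h1, mul_one]

lemma π_Kpow (n : ι → ℤ) :
    V.π (Uq.Kpow D n) = Matrix.diagonal fun k => ∏ j, (D.qi j ^ V.wt k j) ^ n j := by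
  classical
  induction n using Uq.Kpow_induction with
  | h0 => simp [Uq.Kpow_zero]
  | hadd m n hm hn =>
    rw [Uq.Kpow_add, map_mul, hm, hn, Matrix.diagonal_mul_diagonal]
    congr 1
    funext k
    rw [← Finset.prod_mul_distrib]
    exact Finset.prod_congr rfl fun j _ => (zpow_add₀ (QRel.qne D j _) _ _).symm
  | hneg n hn =>
    have h1 : V.π (Uq.Kpow D n) * V.π (Uq.Kpow D (-n)) = 1 := by
      rw [← map_mul, Uq.Kpow_mul_neg, map_one]
    have h2 : (Matrix.diagonal fun k => ∏ j, (D.qi j ^ V.wt k j) ^ (-n) j) *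
        V.π (Uq.Kpow D n) = 1 := by
      rw [hn, Matrix.diagonal_mul_diagonal, ← Matrix.diagonal_one]
      congr 1
      funext k
      rw [← Finset.prod_mul_distrib]
      refine Finset.prod_eq_one fun j _ => ?_
      rw [Pi.neg_apply, zpow_neg, inv_mul_cancel₀ (zpow_ne_zero _ (QRel.qne D j _))]
    rw [← one_mul (V.π (Uq.Kpow D (-n))), ← h2, mul_assoc, h1, mul_one]
  | hsingle j =>
    rw [Uq.Kpow_single, V.π_K]
    congr 1
    funext k
    rw [Finset.prod_eq_single j]
    · simp
    · intro i _ hi; simp [hi]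
    · simp

/-- A matrix preserving weights commutes with the action of the `K_λ`. -/
lemma commute_π_Kpow {c : Matrix κ κ ℂ} (hc : ∀ m n, V.wt m ≠ V.wt n → c m n = 0) (n : ι → ℤ) :
    Commute c (V.π (Uq.Kpow D n)) := by
  rw [π_Kpow]
  ext i j
  rw [Matrix.mul_diagonal, Matrix.diagonal_mul]
  by_cases h : V.wt i = V.wt j
  · rw [h, mul_comm]
  · rw [hc i j h, mul_zero, zero_mul]

/-- The dual representation `X ↦ π(S(X))ᵀ`. -/
def dual : WeightRep D κ where
  -- The antipode and the transpose each reverse products, so the composite is a homomorphism.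
  π := (Matrix.transposeAlgEquiv κ ℂ ℂ).symm.toAlgHom.comp
    ((AlgHom.op V.π).comp (Uq.antipodeHom D))
  wt k := -V.wt k
  π_K j := by
    change (V.π (Uq.antipode D (Uq.K D j))).transpose = _
    rw [Uq.antipode_K, π_Kinv, Matrix.diagonal_transpose]
    congr 1
    funext k
    rw [Pi.neg_apply, zpow_neg]

end WeightRep

/-! ### Pairing with normalized cycles and the trace chain of an idempotent -/

namespace Hochschild

variable {A : Type*} [Ring A] [Algebra ℂ A]

set_option maxSynthPendingDepth 6 in
/-- The pairing of a cocycle vanishing on degenerate chains with a normalized cycle. -/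
lemma pairing_classOf (σ : A ≃ₐ[ℂ] A) (φ : A ⊗[ℂ] (A ⊗[ℂ] A) →ₗ[ℂ] ℂ) (hφ : IsCocycle σ φ)
    (h1 : ∀ a b, φ (a ⊗ₜ (1 ⊗ₜ b)) = 0) (h2 : ∀ a b, φ (a ⊗ₜ (b ⊗ₜ 1)) = 0)
    (x : A ⊗[ℂ] (A ⊗[ℂ] A)) (hx : x ∈ normCycles σ) :
    pairing σ φ hφ (classOf σ x hx) = φ x := by
  -- The class is defined through the inverse of the comparison isomorphism. Any representative `y`
  -- of it differs from `x` by a boundary plus a degenerate chain, and `φ` kills both.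
  suffices h : ∀ z : HH₂ σ, toNormalized σ z = Submodule.Quotient.mk ⟨x, hx⟩ →
      pairing σ φ hφ z = φ x from
    h _ ((normalizedEquiv σ).apply_symm_apply (Submodule.Quotient.mk ⟨x, hx⟩))
  intro z hz
  obtain ⟨⟨y, hy⟩, rfl⟩ := Submodule.Quotient.mk_surjective _ z
  have h4 : y - x ∈ normBoundaries σ :=
    (Submodule.Quotient.eq ((normBoundaries σ).comap (normCycles σ).subtype)).mp hz
  have h5 : normBoundaries σ ≤ LinearMap.ker φ := by
    refine sup_le ?_ (Submodule.span_le.mpr ?_)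
    · rintro _ ⟨z, rfl⟩
      exact LinearMap.congr_fun hφ z
    · rintro _ ⟨a, b, rfl | rfl⟩
      exacts [h1 a b, h2 a b]
  have h6 : φ y - φ x = 0 := (map_sub φ y x).symm.trans (LinearMap.mem_ker.mp (h5 h4))
  exact sub_eq_zero.mp h6

section
variable {κ : Type*} [Fintype κ]

/-- `Tr(X ⊗ Y) = ∑ X^i_j ⊗ Y^j_i`. -/
def traceTensor (X Y : Matrix κ κ A) : A ⊗[ℂ] A := ∑ i, ∑ j, X i j ⊗ₜ Y j i

lemma traceTensor_sub_left (X X' Y : Matrix κ κ A) :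
    traceTensor (X - X') Y = traceTensor X Y - traceTensor X' Y := by
  simp [traceTensor, TensorProduct.sub_tmul]

lemma traceTensor_add_left (X X' Y : Matrix κ κ A) :
    traceTensor (X + X') Y = traceTensor X Y + traceTensor X' Y := by
  simp [traceTensor, TensorProduct.add_tmul, Finset.sum_add_distrib]

variable [DecidableEq κ]

/-- Absorbing `V` and one summation into the first matrix turns each face of the boundary into a
product of matrices. -/
lemma traceChain_eq (V : Matrix κ κ ℂ) (P : Matrix κ κ A) :
    traceChain V P = ∑ i, ∑ k, ∑ l,
      ((V.map (algebraMap ℂ A) * (2 * P - 1) : Matrix κ κ A) i k) ⊗ₜ (P k l ⊗ₜ[ℂ] P l i) := by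
  have two : ∀ j k, (2 * P - 1 : Matrix κ κ A) j k = 2 * P j k - (1 : Matrix κ κ A) j k := fun j k => by
    rw [Matrix.sub_apply, two_mul, two_mul, Matrix.add_apply]
  unfold traceChain
  refine Finset.sum_congr rfl fun i _ => ?_
  rw [Finset.sum_comm]
  refine Finset.sum_congr rfl fun k _ => ?_
  rw [Finset.sum_comm]
  refine Finset.sum_congr rfl fun l _ => ?_
  rw [Matrix.mul_apply, TensorProduct.sum_tmul]
  refine Finset.sum_congr rfl fun j _ => ?_
  rw [Matrix.map_apply, two, Algebra.smul_def]

/-- The chain `Tr(V (2P - 1) ⊗ P ⊗ P)` of an idempotent `P` with `σ(P) V = V P` and `Tr(V P)` scalar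
is a normalized cycle. -/
lemma traceChain_mem_normCycles (σ : A ≃ₐ[ℂ] A) (V : Matrix κ κ ℂ) (P : Matrix κ κ A)
    (hP : P * P = P) (hσ : P.map σ * V.map (algebraMap ℂ A) = V.map (algebraMap ℂ A) * P)
    {t : ℂ} (ht : (V.map (algebraMap ℂ A) * P).trace = algebraMap ℂ A t) :
    traceChain V P ∈ normCycles σ := by
  change b₂ σ _ ∈ degen₁ A
  set W := V.map (algebraMap ℂ A) with hW
  -- `e1`, `e2` and `e3` are the three faces of the chain. Each contracts one index, and in the last
  -- one `σ(P)` multiplies from the left.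
  have e1 : ∑ i, ∑ k, ∑ l, ((W * (2 * P - 1) : Matrix κ κ A) i k * P k l) ⊗ₜ[ℂ] P l i =
      traceTensor (W * (2 * P - 1) * P) P := by
    refine Finset.sum_congr rfl fun i _ => ?_
    rw [Finset.sum_comm]
    refine Finset.sum_congr rfl fun l _ => ?_
    rw [Matrix.mul_apply, TensorProduct.sum_tmul]
  have e2 : ∑ i, ∑ k, ∑ l, (W * (2 * P - 1) : Matrix κ κ A) i k ⊗ₜ[ℂ] (P k l * P l i) =
      traceTensor (W * (2 * P - 1)) (P * P) := by
    refine Finset.sum_congr rfl fun i _ => Finset.sum_congr rfl fun k _ => ?_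
    rw [Matrix.mul_apply (M := P), TensorProduct.tmul_sum]
  have e3 : ∑ i, ∑ k, ∑ l, (σ (P l i) * (W * (2 * P - 1) : Matrix κ κ A) i k) ⊗ₜ[ℂ] P k l =
      traceTensor (P.map σ * (W * (2 * P - 1))) P := by
    have : ∀ l k, (P.map σ * (W * (2 * P - 1)) : Matrix κ κ A) l k ⊗ₜ[ℂ] P k l =
        ∑ i, (σ (P l i) * (W * (2 * P - 1) : Matrix κ κ A) i k) ⊗ₜ[ℂ] P k l := fun l k => by
      rw [Matrix.mul_apply, TensorProduct.sum_tmul]; rfl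
    simp only [traceTensor, this]
    rw [Finset.sum_congr rfl fun i _ => Finset.sum_comm, Finset.sum_comm]
    exact Finset.sum_congr rfl fun l _ => Finset.sum_comm
  -- The entries of `W` are scalars and cross the tensor sign, so `Tr(W ⊗ P) = 1 ⊗ Tr(W P) = t (1 ⊗
  -- 1)`.
  have e4 : traceTensor W P = (algebraMap ℂ A t) ⊗ₜ[ℂ] (1 : A) := by
    rw [Algebra.algebraMap_eq_smul_one, TensorProduct.smul_tmul, ← Algebra.algebraMap_eq_smul_one,
      ← ht, Matrix.trace, TensorProduct.tmul_sum]
    refine Finset.sum_congr rfl fun i _ => ?_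
    rw [Matrix.diag_apply, Matrix.mul_apply, TensorProduct.tmul_sum]
    refine Finset.sum_congr rfl fun j _ => ?_
    rw [hW, Matrix.map_apply, Algebra.algebraMap_eq_smul_one, TensorProduct.smul_tmul,
      smul_mul_assoc, one_mul]
  -- The symmetry `2P - 1` acts as the identity on the image of `P`.
  have p1 : (2 * P - 1) * P = P := by rw [sub_mul, mul_assoc, hP, two_mul, one_mul, add_sub_cancel_right]
  have p2 : P * (2 * P - 1) = P := by rw [mul_sub, mul_one, two_mul, mul_add, hP, add_sub_cancel_right]
  -- The outer faces both give `Tr(WP ⊗ P)`, the last one by `σ(P) W = W P`. The middle face gives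
  -- `Tr(W(2P - 1) ⊗ P)`, so the terms in `WP` cancel and only `Tr(W ⊗ P)` survives.
  have key : b₂ σ (traceChain V P) = traceTensor W P := by
    rw [traceChain_eq]
    simp only [map_sum, b₂_tmul, Finset.sum_sub_distrib, Finset.sum_add_distrib]
    rw [e1, e2, e3, hP, mul_assoc, p1, ← mul_assoc (P.map σ), hσ, mul_assoc, p2, mul_sub, mul_one,
      two_mul, mul_add, traceTensor_sub_left, traceTensor_add_left]
    abel
  rw [key, e4]
  exact Submodule.subset_span ⟨_, rfl⟩

end
end Hochschild

/-! ### Evaluation of functionals and the cocycles `η_a` -/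

section Dual
variable {D : QuantumDatum ι}

/-- Evaluation of a functional at `X`. -/
def evalLin (X : Uq D) : DualAlg D →ₗ[ℂ] ℂ where
  toFun φ := φ X
  map_add' _ _ := rfl
  map_smul' _ _ := rfl

lemma evalLin_apply (X : Uq D) (φ : DualAlg D) : evalLin X φ = φ X := rfl

lemma dual_ext {φ ψ : DualAlg D} (h : ∀ X, φ X = ψ X) : φ = ψ :=
  WithConv.ext (LinearMap.ext h)

lemma dual_one_apply (X : Uq D) : (1 : DualAlg D) X = Coalgebra.counit (R := ℂ) X := rfl

lemma dual_mul_apply_one (φ ψ : DualAlg D) : (φ * ψ) 1 = φ 1 * ψ 1 := by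
  rw [LinearMap.convMul_apply, Bialgebra.comul_one, Algebra.TensorProduct.one_def]; rfl

/-- `E_i` is skew-primitive, so evaluation at it satisfies a Leibniz rule twisted by `K_i`. It
becomes a genuine derivation over the counit on functions for which `K_i` evaluates as `1`. -/
lemma dual_mul_apply_E (φ ψ : DualAlg D) (i : ι) :
    (φ * ψ) (Uq.E D i) = φ (Uq.E D i) * ψ (Uq.K D i) + φ 1 * ψ (Uq.E D i) := by
  rw [LinearMap.convMul_apply, Uq.comul_E, map_add]; rfl

lemma dual_mul_apply_F (φ ψ : DualAlg D) (i : ι) :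
    (φ * ψ) (Uq.F D i) = φ (Uq.F D i) * ψ 1 + φ (Uq.Kinv D i) * ψ (Uq.F D i) := by
  rw [LinearMap.convMul_apply, Uq.comul_F, map_add]; rfl

lemma evalAct_apply {A : Type*} [Ring A] [Algebra ℂ A] (f : A →ₐ[ℂ] DualAlg D) (X : Uq D) (a : A) :
    evalAct f X a = f a X := by
  change f a (1 * X) = f a X
  rw [one_mul]

lemma eta_tmul {A : Type*} [Ring A] [Algebra ℂ A] (f : A →ₐ[ℂ] DualAlg D) (i : ι) (a₀ a₁ a₂ : A) :
    eta f i (a₀ ⊗ₜ (a₁ ⊗ₜ a₂)) = f a₀ 1 * (f a₁ (Uq.F D i) * f a₂ (Uq.E D i)) := by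
  have h : eta f i (a₀ ⊗ₜ (a₁ ⊗ₜ a₂)) =
    evalAct f 1 a₀ * (evalAct f (Uq.F D i) a₁ * evalAct f (Uq.E D i) a₂) := rfl
  rw [h, evalAct_apply, evalAct_apply, evalAct_apply]

/-- `η_i` is a twisted cocycle on algebras on which the functionals `K_i`, `K_i⁻¹` and the twist
composed with the counit agree with the counit. -/
lemma isCocycle_eta {A : Type*} [Ring A] [Algebra ℂ A] (f : A →ₐ[ℂ] DualAlg D) (σ : A ≃ₐ[ℂ] A)
    (i : ι) (hK : ∀ a, f a (Uq.K D i) = f a 1) (hL : ∀ a, f a (Uq.Kinv D i) = f a 1)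
    (hσ : ∀ a, f (σ a) 1 = f a 1) : Hochschild.IsCocycle σ (eta f i) := by
  refine TensorProduct.ext' fun a₀ y => ?_
  induction y using TensorProduct.induction_on with
  | zero => simp
  | add x y hx hy => rw [TensorProduct.tmul_add, map_add, map_add, hx, hy]
  | tmul a₁ y => ?_
  induction y using TensorProduct.induction_on with
  | zero => simp
  | add x y hx hy => rw [TensorProduct.tmul_add, TensorProduct.tmul_add, map_add, map_add, hx, hy]
  | tmul a₂ a₃ => ?_
  rw [LinearMap.comp_apply, Hochschild.b₃_tmul]
  -- With `K_i^{±1}` and the twist replaced by the counit, each middle face splits in two by the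
  -- Leibniz rule, and the six resulting terms cancel in pairs.
  simp only [map_add, map_sub, eta_tmul, map_mul, dual_mul_apply_one, dual_mul_apply_E,
    dual_mul_apply_F, hK, hL, hσ, LinearMap.zero_apply]
  ring

/-- `η_i` is a product of evaluations at `1`, `F_i`, `E_i`, one for each tensor factor, so the index
contraction of the chain becomes the trace of a product of scalar matrices. -/
lemma eta_traceChain {A : Type*} [Ring A] [Algebra ℂ A] (f : A →ₐ[ℂ] DualAlg D) (i : ι)
    {κ : Type*} [Fintype κ] [DecidableEq κ] (V : Matrix κ κ ℂ) (P : Matrix κ κ A) :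
    eta f i (Hochschild.traceChain V P) =
      (V * (2 * P.map (fun a => f a 1) - 1) * P.map (fun a => f a (Uq.F D i)) *
        P.map (fun a => f a (Uq.E D i))).trace := by
  have h1 : ∀ j k, f ((2 * P - 1 : Matrix κ κ A) j k) 1 =
      (2 * P.map (fun a => f a 1) - 1 : Matrix κ κ ℂ) j k := fun j k => by
    rw [Matrix.sub_apply, Matrix.sub_apply, two_mul, two_mul, Matrix.add_apply, Matrix.add_apply,
      ← evalLin_apply]
    simp only [map_sub, map_add]
    congr 1
    rcases eq_or_ne j k with rfl | h
    · rw [Matrix.one_apply_eq, Matrix.one_apply_eq, map_one, evalLin_apply, dual_one_apply,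
        Bialgebra.counit_one]
    · rw [Matrix.one_apply_ne h, Matrix.one_apply_ne h, map_zero, map_zero]
  have h2 : ∀ j k, f ((V.map (algebraMap ℂ A) * (2 * P - 1) : Matrix κ κ A) j k) 1 =
      (V * (2 * P.map (fun a => f a 1) - 1) : Matrix κ κ ℂ) j k := fun j k => by
    rw [Matrix.mul_apply, Matrix.mul_apply, map_sum, ← evalLin_apply, map_sum]
    refine Finset.sum_congr rfl fun l _ => ?_
    rw [Matrix.map_apply, ← Algebra.smul_def, map_smul, map_smul, evalLin_apply, h1, smul_eq_mul]
  rw [Hochschild.traceChain_eq, Matrix.trace]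
  simp only [map_sum, eta_tmul, h2]
  refine Finset.sum_congr rfl fun j _ => ?_
  rw [Matrix.diag_apply, Matrix.mul_assoc, Matrix.mul_apply]
  refine Finset.sum_congr rfl fun k _ => ?_
  rw [Matrix.mul_apply (M := P.map _), Finset.mul_sum]
  rfl

end Dual

/-! ### A trace identity for idempotent matrices -/

/-- `Tr(W (2C - 1) [C, F] [C, E]) = Tr(W C [E, F])` for an idempotent `C` and a matrix `W` which
commutes with `C` and `E`. -/
lemma trace_idempotent_commutators {κ : Type*} [Fintype κ] [DecidableEq κ]
    {C E F W : Matrix κ κ ℂ} (hC : C * C = C) (hW : C * W = W * C) (hE : E * W = W * E) :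
    (W * (2 * C - 1) * (C * F - F * C) * (C * E - E * C)).trace =
      (W * C * (E * F - F * E)).trace := by
  -- An identity valid for arbitrary matrices: the summands containing `C * C - C` record each use
  -- of idempotence, and they vanish by `hC`.
  have e : W * (2 * C - 1) * (C * F - F * C) * (C * E - E * C) =
      W * (F * C * E) - W * ((C * C) * F * C * E) - W * (C * F * E * C) +
        2 • (W * (C * F * C * E * C)) - W * (F * C * E * C)
        + 2 • (W * ((C * C - C) * F * C * E)) - 2 • (W * ((C * C - C) * F * E * C))
        - 2 • (W * (C * F * (C * C - C) * E)) + W * (F * (C * C - C) * E)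
        + W * ((C * C - C) * F * C * E) := by
    noncomm_ring
  -- Since `W` commutes with `C`, the functional `Tr(W ·)` is cyclic with respect to `C`. The terms
  -- with two or more inner copies of `C` reduce to multiples `-1 + 2 - 1` of `Tr(W C F C E)` and
  -- cancel.
  have cyc : ∀ Y, (W * (Y * C)).trace = (W * (C * Y)).trace := fun Y => by
    rw [← mul_assoc, Matrix.trace_mul_comm, ← mul_assoc, hW, mul_assoc]
  rw [e, hC, sub_self]
  simp only [zero_mul, mul_zero, smul_zero, add_zero, sub_zero, Matrix.trace_add, Matrix.trace_sub,
    Matrix.trace_smul]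
  have t1 : (W * (C * F * E * C)).trace = (W * (C * F * E)).trace := by
    rw [cyc, ← mul_assoc C, ← mul_assoc C, hC]
  have t2 : (W * (C * F * C * E * C)).trace = (W * (C * F * C * E)).trace := by
    rw [cyc, ← mul_assoc C, ← mul_assoc C, ← mul_assoc C, hC]
  have t3 : (W * (F * C * E * C)).trace = (W * (C * F * C * E)).trace := by
    rw [cyc]; simp only [mul_assoc]
  -- Commutation of `W` with `E` enters only here: it carries `E` cyclically past `W` to the front
  -- of `F`.
  have t4 : (W * (F * C * E)).trace = (W * (C * (E * F))).trace := by
    rw [← mul_assoc, Matrix.trace_mul_comm, ← mul_assoc, hE, mul_assoc, ← cyc, ← mul_assoc E]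
  rw [t1, t2, t3, t4, mul_sub, Matrix.trace_sub]
  simp only [mul_assoc]
  ring

/-! ### The matrices `𝖯` and `𝖰` as functions on `U_q(𝔤)` -/

namespace UnitaryIrrep

variable {D : QuantumDatum ι} {κ : Type} [Fintype κ] [DecidableEq κ] (V : UnitaryIrrep D κ)

/-- By unitarity `π(S(X)^*)` is the conjugate transpose of `π(S(X))`, and the two conjugations
cancel. The involution disappears from all later computations, and `u^{k*}_l` is seen to be a matrix
coefficient. -/
lemma dualStar_coef (k l : κ) : dualStar (V.coef k l) = V.dual.coef k l := by
  refine dual_ext fun X => ?_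
  change (starRingEnd ℂ) (V.π (Uq.starMap D (Uq.antipode D X)) k l) = V.π (Uq.antipode D X) l k
  rw [V.unitary, Matrix.conjTranspose_apply]
  exact Complex.conj_conj _

variable (c : Matrix κ κ ℂ)

/-- The map `x ⊗ y ↦ π(S(x)) c π(y)`. -/
def antipodeConj : Uq D ⊗[ℂ] Uq D →ₗ[ℂ] Matrix κ κ ℂ :=
  LinearMap.mul' ℂ _ ∘ₗ TensorProduct.map
    (LinearMap.mulRight ℂ c ∘ₗ V.π.toLinearMap ∘ₗ Uq.antipodeLin D) V.π.toLinearMap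

/-- The map `x ⊗ y ↦ π(x) c π(S(y))`. -/
def conjAntipode : Uq D ⊗[ℂ] Uq D →ₗ[ℂ] Matrix κ κ ℂ :=
  LinearMap.mul' ℂ _ ∘ₗ TensorProduct.map
    (LinearMap.mulRight ℂ c ∘ₗ V.π.toLinearMap) (V.π.toLinearMap ∘ₗ Uq.antipodeLin D)

lemma antipodeConj_tmul (x y : Uq D) :
    V.antipodeConj c (x ⊗ₜ y) = V.π (Uq.antipode D x) * c * V.π y := rfl

lemma conjAntipode_tmul (x y : Uq D) :
    V.conjAntipode c (x ⊗ₜ y) = V.π x * c * V.π (Uq.antipode D y) := rfl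

/-- `𝖯(X) = π(S(X_(1))) c π(X_(2))`. -/
lemma P_apply (X : Uq D) (i j : κ) :
    V.P c i j X = V.antipodeConj c (Coalgebra.comul (R := ℂ) X) i j := by
  rw [← evalLin_apply]
  simp only [P, Matrix.sum_apply, map_sum, Matrix.smul_apply, map_smul, M, Matrix.of_apply,
    dualStar_coef, evalLin_apply, LinearMap.convMul_apply]
  induction Coalgebra.comul (R := ℂ) X using TensorProduct.induction_on with
  | zero => simp
  | add x y hx hy =>
    simp only [map_add, smul_add, Finset.sum_add_distrib, hx, hy, Matrix.add_apply]
  | tmul x y =>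
    rw [antipodeConj_tmul, Matrix.mul_apply, Finset.sum_comm]
    refine Finset.sum_congr rfl fun n _ => ?_
    rw [Matrix.mul_apply, Finset.sum_mul]
    refine Finset.sum_congr rfl fun m _ => ?_
    -- The transpose in the dual representation makes `u^{m*}_i` take the value `π(S(x))^i_m` at
    -- `x`.
    change c m n * (V.π (Uq.antipode D x) i m * V.π y n j) = _
    ring

/-- `𝖰(X) = π(X_(1)) c π(S(X_(2)))`. -/
lemma Q_apply (X : Uq D) (i j : κ) :
    V.Q c i j X = V.conjAntipode c (Coalgebra.comul (R := ℂ) X) i j := by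
  rw [← evalLin_apply]
  simp only [Q, Matrix.sum_apply, map_sum, Matrix.smul_apply, map_smul, N, Matrix.of_apply,
    dualStar_coef, evalLin_apply, LinearMap.convMul_apply]
  induction Coalgebra.comul (R := ℂ) X using TensorProduct.induction_on with
  | zero => simp
  | add x y hx hy =>
    simp only [map_add, smul_add, Finset.sum_add_distrib, hx, hy, Matrix.add_apply]
  | tmul x y =>
    rw [conjAntipode_tmul, Matrix.mul_apply, Finset.sum_comm]
    refine Finset.sum_congr rfl fun n _ => ?_
    rw [Matrix.mul_apply, Finset.sum_mul]
    refine Finset.sum_congr rfl fun m _ => ?_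
    change c m n * (V.π x i m * V.π (Uq.antipode D y) n j) = _
    ring

lemma coef_mem_CqG {κ' : Type} [Fintype κ'] [DecidableEq κ'] (W : WeightRep D κ') (k l : κ') :
    W.coef k l ∈ CqG D :=
  Submodule.subset_span (s := matrixCoeffs D) ⟨κ', inferInstance, inferInstance, W, k, l, rfl⟩

/-- The entries are combinations of products of coefficients of the representation and of its dual,
and `ℂ_q[G]` is a subalgebra. -/
lemma P_mem_CqG (i j : κ) : V.P c i j ∈ CqG D := by
  simp only [P, Matrix.sum_apply, Matrix.smul_apply, M, Matrix.of_apply, dualStar_coef]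
  exact sum_mem fun m _ => sum_mem fun n _ =>
    (CqG D).smul_mem (mul_mem (coef_mem_CqG _ _ _) (coef_mem_CqG _ _ _)) _

lemma Q_mem_CqG (i j : κ) : V.Q c i j ∈ CqG D := by
  simp only [Q, Matrix.sum_apply, Matrix.smul_apply, N, Matrix.of_apply, dualStar_coef]
  exact sum_mem fun m _ => sum_mem fun n _ =>
    (CqG D).smul_mem (mul_mem (coef_mem_CqG _ _ _) (coef_mem_CqG _ _ _)) _

variable {c} (hc : ∀ m n, V.wt m ≠ V.wt n → c m n = 0)
include hc

/-- The factor `K_n` reaches `c` from both sides as `π(K_n)⁻¹ c π(K_n)`, which is `c` because `c`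
preserves weights. This gives the invariance of `𝖯` under `◁ K_λ`. -/
lemma antipodeConj_Kpow_mul (n : ι → ℤ) (t : Uq D ⊗[ℂ] Uq D) :
    V.antipodeConj c ((Uq.Kpow D n ⊗ₜ Uq.Kpow D n) * t) = V.antipodeConj c t := by
  induction t using TensorProduct.induction_on with
  | zero => simp
  | add x y hx hy => rw [mul_add, map_add, map_add, hx, hy]
  | tmul x y =>
    have h := V.commute_π_Kpow hc n
    have h1 : V.π (Uq.Kpow D (-n)) * V.π (Uq.Kpow D n) = 1 := by
      rw [← map_mul, Uq.Kpow_neg_mul, map_one]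
    rw [Algebra.TensorProduct.tmul_mul_tmul, antipodeConj_tmul, antipodeConj_tmul,
      Uq.antipode_mul, Uq.antipode_Kpow, map_mul, map_mul, ← mul_assoc, mul_assoc (V.π _) _ c,
      mul_assoc (V.π _) _ (V.π (Uq.Kpow D n)), mul_assoc _ c, h.eq, ← mul_assoc (V.π _) _ c, h1,
      one_mul]

/-- For `𝖰` it is the right factor that meets `c`, as `π(K_n) c π(K_n)⁻¹`; hence the invariance
under `K_λ ▷`. -/
lemma conjAntipode_mul_Kpow (n : ι → ℤ) (t : Uq D ⊗[ℂ] Uq D) :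
    V.conjAntipode c (t * (Uq.Kpow D n ⊗ₜ Uq.Kpow D n)) = V.conjAntipode c t := by
  induction t using TensorProduct.induction_on with
  | zero => simp
  | add x y hx hy => rw [add_mul, map_add, map_add, hx, hy]
  | tmul x y =>
    have h := V.commute_π_Kpow hc n
    have h1 : V.π (Uq.Kpow D n) * V.π (Uq.Kpow D (-n)) = 1 := by
      rw [← map_mul, Uq.Kpow_mul_neg, map_one]
    rw [Algebra.TensorProduct.tmul_mul_tmul, conjAntipode_tmul, conjAntipode_tmul,
      Uq.antipode_mul, Uq.antipode_Kpow, map_mul, map_mul, mul_assoc (V.π x), ← h.eq, ← mul_assoc,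
      mul_assoc (V.π x) (c * _), mul_assoc c, h1, mul_one]

omit hc in
-- On this side `K_n` lands on the outside and does not cancel. With `n = 2ρ` this is the source of
-- the relation `θ(𝖯) V = V 𝖯`.
lemma antipodeConj_mul_Kpow (n : ι → ℤ) (t : Uq D ⊗[ℂ] Uq D) :
    V.antipodeConj c (t * (Uq.Kpow D n ⊗ₜ Uq.Kpow D n)) =
      V.π (Uq.Kpow D (-n)) * V.antipodeConj c t * V.π (Uq.Kpow D n) := by
  induction t using TensorProduct.induction_on with
  | zero => simp
  | add x y hx hy => rw [add_mul, map_add, map_add, hx, hy, mul_add, add_mul]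
  | tmul x y =>
    rw [Algebra.TensorProduct.tmul_mul_tmul, antipodeConj_tmul, antipodeConj_tmul,
      Uq.antipode_mul, Uq.antipode_Kpow, map_mul, map_mul]
    simp only [mul_assoc]

omit hc in
-- The counterpart for `𝖰`, with the opposite direction of conjugation; this is why `C(𝖰)` contains
-- `K_{2ρ}` and `C(𝖯)` its inverse.
lemma conjAntipode_Kpow_mul (n : ι → ℤ) (t : Uq D ⊗[ℂ] Uq D) :
    V.conjAntipode c ((Uq.Kpow D n ⊗ₜ Uq.Kpow D n) * t) =
      V.π (Uq.Kpow D n) * V.conjAntipode c t * V.π (Uq.Kpow D (-n)) := by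
  induction t using TensorProduct.induction_on with
  | zero => simp
  | add x y hx hy => rw [mul_add, map_add, map_add, hx, hy, mul_add, add_mul]
  | tmul x y =>
    rw [Algebra.TensorProduct.tmul_mul_tmul, conjAntipode_tmul, conjAntipode_tmul,
      Uq.antipode_mul, Uq.antipode_Kpow, map_mul, map_mul]
    simp only [mul_assoc]

lemma P_apply_Kpow_mul (n : ι → ℤ) (X : Uq D) (i j : κ) :
    V.P c i j (Uq.Kpow D n * X) = V.P c i j X := by
  rw [P_apply, P_apply, Bialgebra.comul_mul, Uq.comul_Kpow, V.antipodeConj_Kpow_mul hc]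

lemma Q_apply_mul_Kpow (n : ι → ℤ) (X : Uq D) (i j : κ) :
    V.Q c i j (X * Uq.Kpow D n) = V.Q c i j X := by
  rw [Q_apply, Q_apply, Bialgebra.comul_mul, Uq.comul_Kpow, V.conjAntipode_mul_Kpow hc]

lemma P_mem_subTG (i j : κ) : V.P c i j ∈ subTG D :=
  ⟨V.P_mem_CqG c i j, fun n => dual_ext fun X => V.P_apply_Kpow_mul hc n X i j⟩

lemma Q_mem_subGT (i j : κ) : V.Q c i j ∈ subGT D :=
  ⟨V.Q_mem_CqG c i j, fun n => dual_ext fun X => V.Q_apply_mul_Kpow hc n X i j⟩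

omit hc

/-- Cyclicity and `S² = Ad K_{2ρ}`: `Tr(K_{2ρ}⁻¹ S(x) c y) = Tr(c K_{2ρ}⁻¹ S(x S(y)))`. -/
lemma trace_antipodeConj (t : Uq D ⊗[ℂ] Uq D) :
    (V.π (Uq.Kpow D (-D.twoRho)) * V.antipodeConj c t).trace =
      (c * V.π (Uq.Kpow D (-D.twoRho)) * V.π (Uq.antipode D (Uq.mulAntipode D t))).trace := by
  have add : ∀ x y : Uq D, Uq.antipode D (x + y) = Uq.antipode D x + Uq.antipode D y :=
    Uq.antipode_add
  induction t using TensorProduct.induction_on with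
  | zero => simp [Uq.antipode]
  | add x y hx hy => simp only [map_add, add, mul_add, Matrix.trace_add, hx, hy]
  | tmul x y =>
    -- This is `S²(y) K_{2ρ} = K_{2ρ} y` multiplied by `K_{2ρ}⁻¹` on both sides, the form in which
    -- `y` can pass `K_{2ρ}⁻¹` after a cyclic rotation of the trace.
    have h1 : y * Uq.Kpow D (-D.twoRho) =
        Uq.Kpow D (-D.twoRho) * Uq.antipode D (Uq.antipode D y) := by
      have h := congrArg (fun z => Uq.Kpow D (-D.twoRho) * z * Uq.Kpow D (-D.twoRho))
        (Uq.antipode_antipode_mul D y)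
      rw [mul_assoc, mul_assoc _ _ (Uq.Kpow D (-D.twoRho)), Uq.Kpow_mul_neg, mul_one, ← mul_assoc _ _ y,
        Uq.Kpow_neg_mul, one_mul] at h
      exact h.symm
    rw [antipodeConj_tmul, Uq.mulAntipode_tmul, Uq.antipode_mul, mul_assoc c, ← map_mul,
      ← mul_assoc (Uq.Kpow D _), ← h1, map_mul, map_mul, ← mul_assoc, ← mul_assoc,
      Matrix.trace_mul_comm, ← mul_assoc, ← mul_assoc, Matrix.trace_mul_comm, ← mul_assoc,
      ← mul_assoc]

/-- Cyclicity and `S² = Ad K_{2ρ}`: `Tr(K_{2ρ} x c S(y)) = Tr(c S(S(x) y) K_{2ρ})`. -/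
lemma trace_conjAntipode (t : Uq D ⊗[ℂ] Uq D) :
    (V.π (Uq.Kpow D D.twoRho) * V.conjAntipode c t).trace =
      (c * V.π (Uq.antipode D (Uq.antipodeMul D t)) * V.π (Uq.Kpow D D.twoRho)).trace := by
  have add : ∀ x y : Uq D, Uq.antipode D (x + y) = Uq.antipode D x + Uq.antipode D y :=
    Uq.antipode_add
  induction t using TensorProduct.induction_on with
  | zero => simp [Uq.antipode]
  | add x y hx hy => simp only [map_add, add, mul_add, add_mul, Matrix.trace_add, hx, hy]
  | tmul x y =>
    rw [conjAntipode_tmul, Uq.antipodeMul_tmul, Uq.antipode_mul, mul_assoc c, ← map_mul,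
      mul_assoc (Uq.antipode D y), Uq.antipode_antipode_mul, map_mul, map_mul, ← mul_assoc,
      ← mul_assoc, mul_assoc _ c, Matrix.trace_mul_comm, ← mul_assoc, ← mul_assoc, mul_assoc (c * _)]

end UnitaryIrrep

/-! ### Values at `1`, `E_a`, `F_a` and the numbers `χ_a` -/

namespace UnitaryIrrep

variable {D : QuantumDatum ι} {κ : Type} [Fintype κ] [DecidableEq κ] (V : UnitaryIrrep D κ)
  {c : Matrix κ κ ℂ}

section Values
variable (c)

lemma P_apply_one (i j : κ) : V.P c i j 1 = c i j := by
  rw [P_apply, Bialgebra.comul_one, Algebra.TensorProduct.one_def, antipodeConj_tmul,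
    Uq.antipode_one, map_one, one_mul, mul_one]

lemma Q_apply_one (i j : κ) : V.Q c i j 1 = c i j := by
  rw [Q_apply, Bialgebra.comul_one, Algebra.TensorProduct.one_def, conjAntipode_tmul,
    Uq.antipode_one, map_one, one_mul, mul_one]

variable {c}

/-- Evaluation at `1` is a character of the dual algebra, and it sends `𝖯` to `c`. -/
lemma idempotent_of_P (hP : IsIdempotentElem (V.P c)) : c * c = c := by
  ext i j
  have h := congrArg (evalLin 1) (congrFun (congrFun hP i) j)
  rw [Matrix.mul_apply, map_sum] at h
  simpa only [evalLin_apply, dual_mul_apply_one, P_apply_one, Matrix.mul_apply] using h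

lemma idempotent_of_Q (hQ : IsIdempotentElem (V.Q c)) : c * c = c := by
  ext i j
  have h := congrArg (evalLin 1) (congrFun (congrFun hQ i) j)
  rw [Matrix.mul_apply, map_sum] at h
  simpa only [evalLin_apply, dual_mul_apply_one, Q_apply_one, Matrix.mul_apply] using h

variable (hc : ∀ m n, V.wt m ≠ V.wt n → c m n = 0)
include hc

open scoped Classical in
lemma commute_π_K (a : ι) : c * V.π (Uq.K D a) = V.π (Uq.K D a) * c := by
  rw [← Uq.Kpow_single]
  exact V.commute_π_Kpow hc _

lemma commute_π_Kinv (a : ι) : c * V.π (Uq.Kinv D a) = V.π (Uq.Kinv D a) * c := by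
  have h1 : V.π (Uq.K D a) * V.π (Uq.Kinv D a) = 1 := by
    rw [← map_mul, (Uq.qrel D).KL, map_one]
  have h2 : V.π (Uq.Kinv D a) * V.π (Uq.K D a) = 1 := by
    rw [← map_mul, (Uq.qrel D).LK, map_one]
  rw [← one_mul (c * _), ← h2, mul_assoc, ← mul_assoc _ c, ← V.commute_π_K hc, mul_assoc c, h1,
    mul_one]

omit hc in
-- The factor `π(K_a)`, coming from both `S(F_a)` and `S(K_a⁻¹)`, is what later turns the weight
-- `-2ρ` into `α_a - 2ρ`.
lemma P_apply_F (a : ι) (i j : κ) : V.P c i j (Uq.F D a) =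
    (V.π (Uq.K D a) * (c * V.π (Uq.F D a) - V.π (Uq.F D a) * c)) i j := by
  rw [P_apply, Uq.comul_F, map_add, antipodeConj_tmul, antipodeConj_tmul, Uq.antipode_F,
    Uq.antipode_Kinv, map_one, mul_one, map_neg, map_mul]
  refine congrFun (congrFun ?_ i) j
  noncomm_ring

/-- Here the torus factors cancel: `E_a K_a⁻¹ c K_a = E_a c` since `c` preserves weights. -/
lemma P_apply_E (a : ι) (i j : κ) : V.P c i j (Uq.E D a) =
    (c * V.π (Uq.E D a) - V.π (Uq.E D a) * c) i j := by
  have h2 : V.π (Uq.Kinv D a) * V.π (Uq.K D a) = 1 := by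
    rw [← map_mul, (Uq.qrel D).LK, map_one]
  rw [P_apply, Uq.comul_E, map_add, antipodeConj_tmul, antipodeConj_tmul, Uq.antipode_E,
    Uq.antipode_one, map_one, one_mul, map_neg, map_mul, mul_assoc, V.commute_π_K hc, neg_mul,
    mul_assoc, ← mul_assoc (V.π (Uq.Kinv D a)), h2, one_mul, neg_add_eq_sub]

lemma Q_apply_F (a : ι) (i j : κ) : V.Q c i j (Uq.F D a) =
    (-(c * V.π (Uq.F D a) - V.π (Uq.F D a) * c)) i j := by
  have h2 : V.π (Uq.Kinv D a) * V.π (Uq.K D a) = 1 := by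
    rw [← map_mul, (Uq.qrel D).LK, map_one]
  rw [Q_apply, Uq.comul_F, map_add, conjAntipode_tmul, conjAntipode_tmul, Uq.antipode_F,
    Uq.antipode_one, map_one, mul_one, map_neg, map_mul, ← V.commute_π_Kinv hc, mul_neg,
    mul_assoc c, ← mul_assoc (V.π (Uq.Kinv D a)), h2, one_mul, ← sub_eq_add_neg, neg_sub]

omit hc in
-- For `𝖰` the torus factor is `K_a⁻¹` and is attached to `E_a` instead of `F_a`.
lemma Q_apply_E (a : ι) (i j : κ) : V.Q c i j (Uq.E D a) =
    (-(c * V.π (Uq.E D a) - V.π (Uq.E D a) * c) * V.π (Uq.Kinv D a)) i j := by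
  rw [Q_apply, Uq.comul_E, map_add, conjAntipode_tmul, conjAntipode_tmul, Uq.antipode_E,
    Uq.antipode_K, map_one, one_mul, map_neg, map_mul]
  refine congrFun (congrFun ?_ i) j
  noncomm_ring

end Values

/-- `[π(E_a), π(F_a)]` is diagonal, with quantum numbers as entries. -/
lemma π_EF_comm (a : ι) :
    V.π (Uq.E D a) * V.π (Uq.F D a) - V.π (Uq.F D a) * V.π (Uq.E D a) = Matrix.diagonal fun i =>
      ((qNum (D.q ^ D.d a) ((D.d a)⁻¹ * V.pairRoot a i) : ℝ) : ℂ) := by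
  rw [← map_mul, ← map_mul, ← map_sub, (Uq.qrel D).EF_same, map_smul, map_sub, V.π_K, V.π_Kinv,
    Matrix.diagonal_sub, ← Matrix.diagonal_smul]
  congr 1
  funext i
  have hd := (D.d_pos a).ne'
  -- The argument of the quantum number is the integer `⟨λ_i, α_a^∨⟩`, so the real powers are the
  -- integer powers by which `K_a^{±1}` acts.
  have e : (D.d a)⁻¹ * V.pairRoot a i = (V.wt i a : ℝ) := by
    rw [pairRoot, ← mul_assoc, inv_mul_cancel₀ hd, one_mul]
  have hp : (0 : ℝ) < D.q ^ D.d a := Real.rpow_pos_of_pos D.q_pos _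
  rw [e, qNum, Real.rpow_neg hp.le, Real.rpow_intCast, Pi.smul_apply, smul_eq_mul]
  simp only [QuantumDatum.qi]
  push_cast
  rw [div_eq_inv_mul]

lemma qi_zpow_wt (j : ι) (i : κ) (n : ℤ) :
    (D.qi j ^ V.wt i j) ^ n = ((D.q ^ (n * V.pairRoot j i) : ℝ) : ℂ) := by
  rw [QuantumDatum.qi, ← Complex.ofReal_zpow, ← Complex.ofReal_zpow, ← Real.rpow_intCast,
    ← Real.rpow_intCast, ← Real.rpow_mul D.q_pos.le, ← Real.rpow_mul D.q_pos.le, pairRoot]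
  congr 2
  ring

/-- `K_λ` acts on `v_i` by `q^{(λ, λ_i)}`; expressing the eigenvalue with the single base `q` allows
the comparison with `χ_a`. -/
lemma π_Kpow_eq (n : ι → ℤ) : V.π (Uq.Kpow D n) =
    Matrix.diagonal fun i => ((D.q ^ (∑ j, n j * V.pairRoot j i) : ℝ) : ℂ) := by
  rw [V.π_Kpow]
  congr 1
  funext i
  simp only [qi_zpow_wt]
  rw [← Complex.ofReal_prod]
  congr 1
  exact (Real.rpow_sum_of_pos D.q_pos _ _).symm

open scoped Classical in
-- The commutation factor is `q^{(α_a - 2ρ, α_a)}`, and `(2ρ, α_a) = (α_a, α_a)`. This supplies the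
-- hypothesis on `E` in `trace_idempotent_commutators`.
lemma E_comm_Kpow (a : ι) :
    Uq.E D a * Uq.Kpow D (Pi.single a 1 - D.twoRho) =
      Uq.Kpow D (Pi.single a 1 - D.twoRho) * Uq.E D a := by
  have h := Uq.Kpow_mul_E D (Pi.single a 1 - D.twoRho) a
  have e : ∏ j, (D.qi a ^ D.cartan a j) ^ (Pi.single a 1 - D.twoRho : ι → ℤ) j = 1 := by
    simp only [Pi.sub_apply, zpow_sub₀ (QRel.qne D a _), Finset.prod_div_distrib,
      Uq.prod_twoRho]
    rw [Finset.prod_eq_single a]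
    · rw [Pi.single_eq_same, zpow_one, QRel.qi_self, div_self (pow_ne_zero _ (D.qi_ne a))]
    · intro j _ hj; simp [hj]
    · simp
  rw [e, one_smul] at h
  exact h.symm

open scoped Classical in
lemma sum_single_sub_twoRho (a : ι) (i : κ) :
    ∑ j, ((Pi.single a 1 - D.twoRho : ι → ℤ) j : ℤ) * V.pairRoot j i =
      V.pairRoot a i - V.pairTwoRho i := by
  simp only [Pi.sub_apply, Int.cast_sub, sub_mul, Finset.sum_sub_distrib, pairTwoRho]
  congr 1
  rw [Finset.sum_eq_single a]
  · simp
  · intro j _ hj; simp [hj]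
  · simp

open scoped Classical in
-- Both `π(K_{α_a - 2ρ})` and the commutator are diagonal, so only the diagonal entries of `c`
-- contribute to the trace.
lemma chi_eq (a : ι) : V.chi c a = (V.π (Uq.Kpow D (Pi.single a 1 - D.twoRho)) * c *
    (V.π (Uq.E D a) * V.π (Uq.F D a) - V.π (Uq.F D a) * V.π (Uq.E D a))).trace := by
  rw [π_EF_comm, π_Kpow_eq, Matrix.trace, chi]
  refine Finset.sum_congr rfl fun i _ => ?_
  rw [Matrix.diag_apply, Matrix.mul_diagonal, Matrix.diagonal_mul, sum_single_sub_twoRho]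
  push_cast
  ring

open scoped Classical in
lemma chiTilde_eq (a : ι) : V.chiTilde c a = (V.π (Uq.Kpow D (-(Pi.single a 1 - D.twoRho))) * c *
    (V.π (Uq.E D a) * V.π (Uq.F D a) - V.π (Uq.F D a) * V.π (Uq.E D a))).trace := by
  rw [π_EF_comm, π_Kpow_eq, Matrix.trace, chiTilde]
  refine Finset.sum_congr rfl fun i _ => ?_
  have e : ∑ j, ((-(Pi.single a 1 - D.twoRho) : ι → ℤ) j : ℤ) * V.pairRoot j i =
      -(V.pairRoot a i - V.pairTwoRho i) := by
    rw [← sum_single_sub_twoRho, ← Finset.sum_neg_distrib]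
    exact Finset.sum_congr rfl fun j _ => by rw [Pi.neg_apply, Int.cast_neg, neg_mul]
  rw [Matrix.diag_apply, Matrix.mul_diagonal, Matrix.diagonal_mul, e]
  push_cast
  ring

variable (hc : ∀ m n, V.wt m ≠ V.wt n → c m n = 0)
include hc

/-- `π(K_a)` commutes with `2c - 1` and joins `π(K_{2ρ}⁻¹)` to form `W = π(K_{α_a - 2ρ})`; the trace
identity for idempotents then applies. -/
lemma eta_trace_P (hC : c * c = c) (a : ι) :
    (V.π (Uq.Kpow D (-D.twoRho)) * (2 * c - 1) *
      (V.π (Uq.K D a) * (c * V.π (Uq.F D a) - V.π (Uq.F D a) * c)) *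
      (c * V.π (Uq.E D a) - V.π (Uq.E D a) * c)).trace = V.chi c a := by
  classical
  have hK := V.commute_π_K hc a
  have h : (2 * c - 1) * V.π (Uq.K D a) = V.π (Uq.K D a) * (2 * c - 1) := by
    rw [sub_mul, mul_sub, two_mul, add_mul, mul_add, hK, one_mul, mul_one]
  have hW : V.π (Uq.Kpow D (Pi.single a 1 - D.twoRho)) =
      V.π (Uq.Kpow D (-D.twoRho)) * V.π (Uq.K D a) := by
    rw [← map_mul, ← Uq.Kpow_single, ← Uq.Kpow_add, neg_add_eq_sub]
  rw [chi_eq, ← trace_idempotent_commutators hC (V.commute_π_Kpow hc _)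
    (by rw [← map_mul, E_comm_Kpow, map_mul]), hW, mul_assoc (V.π (Uq.Kpow D (-D.twoRho))) (V.π _),
    ← h]
  simp only [mul_assoc]

/-- The two signs cancel, and a cyclic rotation brings `π(K_a⁻¹)` next to `π(K_{2ρ})`. The resulting
weight `2ρ - α_a` is the opposite of the one for `𝖯`, and its `K` still commutes with `E_a`. -/
lemma eta_trace_Q (hC : c * c = c) (a : ι) :
    (V.π (Uq.Kpow D D.twoRho) * (2 * c - 1) *
      (-(c * V.π (Uq.F D a) - V.π (Uq.F D a) * c)) *
      (-(c * V.π (Uq.E D a) - V.π (Uq.E D a) * c) * V.π (Uq.Kinv D a))).trace =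
        V.chiTilde c a := by
  classical
  have hW : V.π (Uq.Kinv D a) * V.π (Uq.Kpow D D.twoRho) =
      V.π (Uq.Kpow D (-(Pi.single a 1 - D.twoRho))) := by
    have h1 : Uq.Kpow D (-(Pi.single a 1 - D.twoRho)) =
        Uq.Kinv D a * Uq.Kpow D D.twoRho := by
      have h2 : Uq.K D a * Uq.Kpow D (-(Pi.single a 1 - D.twoRho)) = Uq.Kpow D D.twoRho := by
        rw [← Uq.Kpow_single, ← Uq.Kpow_add]
        congr 1
        abel
      rw [← h2, ← mul_assoc, (Uq.qrel D).LK, one_mul]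
    rw [h1, map_mul]
  have hE : V.π (Uq.E D a) * V.π (Uq.Kpow D (-(Pi.single a 1 - D.twoRho))) =
      V.π (Uq.Kpow D (-(Pi.single a 1 - D.twoRho))) * V.π (Uq.E D a) := by
    have h := E_comm_Kpow (D := D) a
    rw [← map_mul, ← map_mul]
    congr 1
    rw [← one_mul (Uq.E D a * _), ← Uq.Kpow_neg_mul D (Pi.single a 1 - D.twoRho), mul_assoc,
      ← mul_assoc _ (Uq.E D a), ← h, mul_assoc, Uq.Kpow_mul_neg, mul_one]
  rw [chiTilde_eq, ← trace_idempotent_commutators hC (V.commute_π_Kpow hc _) hE, ← hW, mul_neg,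
    neg_mul _ (V.π _), neg_mul_neg, ← mul_assoc, Matrix.trace_mul_comm]
  simp only [mul_assoc]

/-! ### The homology classes and their pairings -/

/-- For idempotent `𝖯`, the class `[C(𝖯)]` in `HH_2^θ(ℂ_q[T\G])` and its pairings with `η_a`. -/
theorem class_P (hP : IsIdempotentElem (V.P c)) :
    ∃ P' : Matrix κ κ (CqTG D), P'.map (CqTG.incl D) = V.P c ∧
      ∃ hP : Hochschild.traceChain (V.π (Uq.Kpow D (-D.twoRho))) P' ∈
          Hochschild.normCycles (thetaTG D),
        (∀ a, ∃ hη : Hochschild.IsCocycle (thetaTG D) (eta (CqTG.incl D) a),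
          Hochschild.pairing (thetaTG D) (eta (CqTG.incl D) a) hη
            (Hochschild.classOf (thetaTG D) _ hP) = V.chi c a) ∧
        ((∃ a, V.chi c a ≠ 0) → Hochschild.classOf (thetaTG D) _ hP ≠ 0) := by
  classical
  -- Identities in `ℂ_q[T\G]` are checked in the dual of `U_q(𝔤)`, by evaluating at an arbitrary
  -- `X`.
  have inj : Function.Injective (CqTG.incl D) := Subtype.val_injective
  have inv : ∀ (x : CqTG D) n X, CqTG.incl D x (Uq.Kpow D n * X) = CqTG.incl D x X :=
    fun x n X => congrArg (evalLin X) (x.2.2 n)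
  have hC := V.idempotent_of_P hP
  let P' : Matrix κ κ (CqTG D) := Matrix.of fun i j => ⟨V.P c i j, V.P_mem_subTG hc i j⟩
  have hP' : ∀ i j, CqTG.incl D (P' i j) = V.P c i j := fun _ _ => rfl
  have hid : P' * P' = P' := by
    ext i j
    apply inj
    rw [Matrix.mul_apply, map_sum]
    simp only [map_mul, hP']
    rw [← Matrix.mul_apply, hP.eq]
  have hσ : P'.map (thetaTG D) * (V.π (Uq.Kpow D (-D.twoRho))).map (algebraMap ℂ (CqTG D)) =
      (V.π (Uq.Kpow D (-D.twoRho))).map (algebraMap ℂ (CqTG D)) * P' := by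
    ext i j
    apply inj
    refine dual_ext fun X => ?_
    have h1 : (V.π (Uq.Kpow D D.twoRho)) * (V.π (Uq.Kpow D (-D.twoRho))) = 1 := by
      rw [← map_mul, Uq.Kpow_mul_neg, map_one]
    have hθ : ∀ i j, CqTG.incl D (thetaTG D (P' i j)) X =
        (V.π (Uq.Kpow D (-D.twoRho)) * V.antipodeConj c (Coalgebra.comul (R := ℂ) X) *
          V.π (Uq.Kpow D D.twoRho)) i j := fun i j => by
      -- Of the two factors `K_{2ρ}` of `θ`, the left one is absorbed by invariance and the right
      -- one conjugates.
      rw [thetaTG_apply, mul_assoc, inv, hP', P_apply, Bialgebra.comul_mul, Uq.comul_Kpow,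
        antipodeConj_mul_Kpow]
    rw [Matrix.mul_apply, Matrix.mul_apply, ← evalLin_apply, ← evalLin_apply, map_sum, map_sum,
      map_sum, map_sum]
    simp only [Matrix.map_apply, ← Algebra.smul_def, ← Algebra.commutes, map_smul, evalLin_apply,
      hθ, hP', P_apply, smul_eq_mul]
    rw [← Matrix.mul_apply (M := V.π _)]
    -- The scalars had been moved to the left of the entries of `θ(𝖯)`; returning them to the right
    -- exhibits a matrix product.
    simp only [mul_comm (V.π (Uq.Kpow D (-D.twoRho)) _ _)]
    rw [← Matrix.mul_apply, mul_assoc, mul_assoc, h1, mul_one]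
  have ht : ((V.π (Uq.Kpow D (-D.twoRho))).map (algebraMap ℂ (CqTG D)) * P').trace =
      algebraMap ℂ (CqTG D) (c * V.π (Uq.Kpow D (-D.twoRho))).trace := by
    apply inj
    refine dual_ext fun X => ?_
    rw [AlgHom.commutes, Algebra.algebraMap_eq_smul_one, ← evalLin_apply, ← evalLin_apply,
      map_smul, evalLin_apply X 1, dual_one_apply, Matrix.trace, map_sum, map_sum]
    simp only [Matrix.diag_apply, Matrix.mul_apply, map_sum, Matrix.map_apply, ← Algebra.smul_def,
      map_smul, hP', evalLin_apply, P_apply, smul_eq_mul]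
    -- For the tensor `Δ(X)` the argument `x S(y)` becomes `ε(X)`, so the quantum trace of `𝖯` is a
    -- multiple of the counit, that is, of the unit of the algebra.
    have h := V.trace_antipodeConj (c := c) (Coalgebra.comul (R := ℂ) X)
    rw [Uq.mulAntipode_comul, Uq.antipode_algebraMap, AlgHom.commutes, ← Algebra.commutes,
      ← Algebra.smul_def, Matrix.trace_smul] at h
    simp only [Matrix.trace, Matrix.diag_apply, Matrix.mul_apply, smul_eq_mul] at h ⊢
    rw [h, mul_comm]
  have hcyc := Hochschild.traceChain_mem_normCycles (thetaTG D) _ P' hid hσ ht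
  have hpair : ∀ a, ∃ hη : Hochschild.IsCocycle (thetaTG D) (eta (CqTG.incl D) a),
      Hochschild.pairing (thetaTG D) (eta (CqTG.incl D) a) hη
        (Hochschild.classOf (thetaTG D) _ hcyc) = V.chi c a := fun a => by
    have hη : Hochschild.IsCocycle (thetaTG D) (eta (CqTG.incl D) a) := by
      refine isCocycle_eta _ _ _ (fun x => ?_) (fun x => ?_) (fun x => ?_)
      · rw [← Uq.Kpow_single, ← mul_one (Uq.Kpow D _), inv]
      · rw [← inv x (Pi.single a 1), Uq.Kpow_single, (Uq.qrel D).KL]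
      · rw [thetaTG_apply, mul_assoc, inv, one_mul, ← mul_one (Uq.Kpow D _), inv]
    refine ⟨hη, ?_⟩
    -- The remaining goals are the values of `𝖯` at `1`, `F_a`, `E_a`, and the vanishing of `η_a` on
    -- degenerate chains, due to `ε(F_a) = ε(E_a) = 0`.
    rw [Hochschild.pairing_classOf, eta_traceChain, ← V.eta_trace_P hc hC]
    · congr 3
      · congr 3
        ext i j
        exact V.P_apply_one c i j
      · ext i j
        exact V.P_apply_F a i j
      · ext i j
        exact V.P_apply_E hc a i j
    · intro x y
      rw [eta_tmul, map_one (CqTG.incl D), dual_one_apply, Uq.counit_F, zero_mul, mul_zero]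
    · intro x y
      rw [eta_tmul, map_one (CqTG.incl D), dual_one_apply, Uq.counit_E, mul_zero, mul_zero]
  refine ⟨P', rfl, hcyc, hpair, ?_⟩
  rintro ⟨a, ha⟩ h0
  obtain ⟨hη, h⟩ := hpair a
  rw [h0, map_zero] at h
  exact ha h.symm

/-- For idempotent `𝖰`, the class `[C(𝖰)]` in `HH_2^θ(ℂ_q[G/T])` and its pairings with `η_a`. -/
theorem class_Q (hQ : IsIdempotentElem (V.Q c)) :
    ∃ Q' : Matrix κ κ (CqGT D), Q'.map (CqGT.incl D) = V.Q c ∧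
      ∃ hQ : Hochschild.traceChain (V.π (Uq.Kpow D D.twoRho)) Q' ∈
          Hochschild.normCycles (thetaGT D),
        (∀ a, ∃ hη : Hochschild.IsCocycle (thetaGT D) (eta (CqGT.incl D) a),
          Hochschild.pairing (thetaGT D) (eta (CqGT.incl D) a) hη
            (Hochschild.classOf (thetaGT D) _ hQ) = V.chiTilde c a) ∧
        ((∃ a, V.chiTilde c a ≠ 0) → Hochschild.classOf (thetaGT D) _ hQ ≠ 0) := by
  classical
  have inj : Function.Injective (CqGT.incl D) := Subtype.val_injective
  have inv : ∀ (x : CqGT D) n X, CqGT.incl D x (X * Uq.Kpow D n) = CqGT.incl D x X :=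
    fun x n X => congrArg (evalLin X) (x.2.2 n)
  have hC := V.idempotent_of_Q hQ
  let Q' : Matrix κ κ (CqGT D) := Matrix.of fun i j => ⟨V.Q c i j, V.Q_mem_subGT hc i j⟩
  have hQ' : ∀ i j, CqGT.incl D (Q' i j) = V.Q c i j := fun _ _ => rfl
  have hid : Q' * Q' = Q' := by
    ext i j
    apply inj
    rw [Matrix.mul_apply, map_sum]
    simp only [map_mul, hQ']
    rw [← Matrix.mul_apply, hQ.eq]
  have hσ : Q'.map (thetaGT D) * (V.π (Uq.Kpow D D.twoRho)).map (algebraMap ℂ (CqGT D)) =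
      (V.π (Uq.Kpow D D.twoRho)).map (algebraMap ℂ (CqGT D)) * Q' := by
    ext i j
    apply inj
    refine dual_ext fun X => ?_
    have h1 : (V.π (Uq.Kpow D (-D.twoRho))) * (V.π (Uq.Kpow D D.twoRho)) = 1 := by
      rw [← map_mul, Uq.Kpow_neg_mul, map_one]
    have hθ : ∀ i j, CqGT.incl D (thetaGT D (Q' i j)) X =
        (V.π (Uq.Kpow D D.twoRho) * V.conjAntipode c (Coalgebra.comul (R := ℂ) X) *
          V.π (Uq.Kpow D (-D.twoRho))) i j := fun i j => by
      -- Now the right factor `K_{2ρ}` is absorbed and the left one conjugates, whence `V =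
      -- π(K_{2ρ})`.
      rw [thetaGT_apply, inv, hQ', Q_apply, Bialgebra.comul_mul, Uq.comul_Kpow,
        conjAntipode_Kpow_mul]
    rw [Matrix.mul_apply, Matrix.mul_apply, ← evalLin_apply, ← evalLin_apply, map_sum, map_sum,
      map_sum, map_sum]
    simp only [Matrix.map_apply, ← Algebra.smul_def, ← Algebra.commutes, map_smul, evalLin_apply,
      hθ, hQ', Q_apply, smul_eq_mul]
    rw [← Matrix.mul_apply (M := V.π _)]
    simp only [mul_comm (V.π (Uq.Kpow D D.twoRho) _ _)]
    rw [← Matrix.mul_apply, mul_assoc, mul_assoc, h1, mul_one]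
  have ht : ((V.π (Uq.Kpow D D.twoRho)).map (algebraMap ℂ (CqGT D)) * Q').trace =
      algebraMap ℂ (CqGT D) (c * V.π (Uq.Kpow D D.twoRho)).trace := by
    apply inj
    refine dual_ext fun X => ?_
    rw [AlgHom.commutes, Algebra.algebraMap_eq_smul_one, ← evalLin_apply, ← evalLin_apply,
      map_smul, evalLin_apply X 1, dual_one_apply, Matrix.trace, map_sum, map_sum]
    simp only [Matrix.diag_apply, Matrix.mul_apply, map_sum, Matrix.map_apply, ← Algebra.smul_def,
      map_smul, hQ', evalLin_apply, Q_apply, smul_eq_mul]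
    -- The other half of the antipode axiom, `S(X_(1)) X_(2) = ε(X)`, makes this quantum trace
    -- scalar.
    have h := V.trace_conjAntipode (c := c) (Coalgebra.comul (R := ℂ) X)
    rw [Uq.antipodeMul_comul, Uq.antipode_algebraMap, AlgHom.commutes, ← Algebra.commutes,
      mul_assoc, ← Algebra.smul_def, Matrix.trace_smul] at h
    simp only [Matrix.trace, Matrix.diag_apply, Matrix.mul_apply, smul_eq_mul] at h ⊢
    rw [h, mul_comm]
  have hcyc := Hochschild.traceChain_mem_normCycles (thetaGT D) _ Q' hid hσ ht
  have hpair : ∀ a, ∃ hη : Hochschild.IsCocycle (thetaGT D) (eta (CqGT.incl D) a),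
      Hochschild.pairing (thetaGT D) (eta (CqGT.incl D) a) hη
        (Hochschild.classOf (thetaGT D) _ hcyc) = V.chiTilde c a := fun a => by
    have hη : Hochschild.IsCocycle (thetaGT D) (eta (CqGT.incl D) a) := by
      refine isCocycle_eta _ _ _ (fun x => ?_) (fun x => ?_) (fun x => ?_)
      · rw [← Uq.Kpow_single, ← one_mul (Uq.Kpow D _), inv]
      · rw [← inv x (Pi.single a 1), Uq.Kpow_single, (Uq.qrel D).LK]
      · rw [thetaGT_apply, inv, mul_one, ← one_mul (Uq.Kpow D _), inv]
    refine ⟨hη, ?_⟩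
    rw [Hochschild.pairing_classOf, eta_traceChain, ← V.eta_trace_Q hc hC]
    · congr 3
      · congr 3
        ext i j
        exact V.Q_apply_one c i j
      · ext i j
        exact V.Q_apply_F hc a i j
      · ext i j
        exact V.Q_apply_E a i j
    · intro x y
      rw [eta_tmul, map_one (CqGT.incl D), dual_one_apply, Uq.counit_F, zero_mul, mul_zero]
    · intro x y
      rw [eta_tmul, map_one (CqGT.incl D), dual_one_apply, Uq.counit_E, mul_zero, mul_zero]
  refine ⟨Q', rfl, hcyc, hpair, ?_⟩
  rintro ⟨a, ha⟩ h0
  obtain ⟨hη, h⟩ := hpair a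
  rw [h0, map_zero] at h
  exact ha h.symm

end UnitaryIrrep

end QFlag
end

theorem mainTheorem2 {𝔤 : Type*} [LieRing 𝔤] [LieAlgebra ℂ 𝔤] [FiniteDimensional ℂ 𝔤]
    [LieAlgebra.IsSimple ℂ 𝔤] (H : LieSubalgebra ℂ 𝔤) [H.IsCartanSubalgebra]
    (b : (LieAlgebra.IsKilling.rootSystem H).Base) (q : ℝ) (hq : 0 < q) (hq1 : q ≠ 1)
    (κ : Type) [Fintype κ] [DecidableEq κ]
    (V : QFlag.UnitaryIrrep (QFlag.QuantumDatum.ofLie H b q hq hq1) κ)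
    (c : Matrix κ κ ℂ) (hc : ∀ m n, V.wt m ≠ V.wt n → c m n = 0) :
    let D := QFlag.QuantumDatum.ofLie H b q hq hq1
    (IsIdempotentElem (V.P c) →
      ∃ P' : Matrix κ κ (QFlag.CqTG D), P'.map (QFlag.CqTG.incl D) = V.P c ∧
      ∃ hP : QFlag.Hochschild.traceChain (V.π (QFlag.Uq.Kpow D (-D.twoRho))) P' ∈
          QFlag.Hochschild.normCycles (QFlag.thetaTG D),
        (∀ a, ∃ hη : QFlag.Hochschild.IsCocycle (QFlag.thetaTG D) (QFlag.eta (QFlag.CqTG.incl D) a),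
          QFlag.Hochschild.pairing (QFlag.thetaTG D) (QFlag.eta (QFlag.CqTG.incl D) a) hη
            (QFlag.Hochschild.classOf (QFlag.thetaTG D) _ hP) = V.chi c a) ∧
        ((∃ a, V.chi c a ≠ 0) → QFlag.Hochschild.classOf (QFlag.thetaTG D) _ hP ≠ 0)) ∧
    (IsIdempotentElem (V.Q c) →
      ∃ Q' : Matrix κ κ (QFlag.CqGT D), Q'.map (QFlag.CqGT.incl D) = V.Q c ∧
      ∃ hQ : QFlag.Hochschild.traceChain (V.π (QFlag.Uq.Kpow D D.twoRho)) Q' ∈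
          QFlag.Hochschild.normCycles (QFlag.thetaGT D),
        (∀ a, ∃ hη : QFlag.Hochschild.IsCocycle (QFlag.thetaGT D) (QFlag.eta (QFlag.CqGT.incl D) a),
          QFlag.Hochschild.pairing (QFlag.thetaGT D) (QFlag.eta (QFlag.CqGT.incl D) a) hη
            (QFlag.Hochschild.classOf (QFlag.thetaGT D) _ hQ) = V.chiTilde c a) ∧
        ((∃ a, V.chiTilde c a ≠ 0) → QFlag.Hochschild.classOf (QFlag.thetaGT D) _ hQ ≠ 0)) :=
  ⟨V.class_P hc, V.class_Q hc⟩
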